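/- Let $\mathcal C$ be a braided monoidal category with braiding $\Psi_{X,Y}\colon X\otimes Y\to Y\otimes X$ (associativity and unit isomorphisms are suppressed in the formulas; $\circ$ is composition, identities are written $1$). A Hopf algebra $H$ in $\mathcal C$ is a bialgebra $(H,\mu,\eta,\Delta,\varepsilon)$ in $\mathcal C$ with an antipode $S$ that is an invertible morphism. A right crossed module over $H$ is an object $X$ with a right $H$-module structure $\triangleleft\colon X\otimes H\to X$ and a right $H$-comodule structure $\beta\colon X\to X\otimes H$ such that $$(1_X\otimes\mu)(\Psi_{H,X}\otimes 1_H)(1_H\otimes\beta)(1_H\otimes\triangleleft)(\Psi_{X,H}\otimes 1_H)(1_X\otimes\Delta)=(\triangleleft\otimes\mu)(1_X\otimes\Psi_{H,H}\otimes 1_H)(\beta\otimes\Delta)$$ as morphisms $X\otimes H\to X\otimes H$. The category $\mathcal C^H_H$ of right crossed modules, with the morphisms of $\mathcal C$ that are both module and comodule maps, is braided monoidal: $X\otimes Y$ has action $(\triangleleft\otimes\triangleleft)(1_X\otimes\Psi_{Y,H}\otimes 1_H)(1_X\otimes 1_Y\otimes\Delta)$ and coaction $(1_X\otimes 1_Y\otimes\mu)(1_X\otimes\Psi_{H,Y}\otimes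 1_H)(\beta\otimes\beta)$, the unit object has the trivial structure, and the braiding is $(1_Y\otimes\triangleleft)(\Psi_{X,Y}\otimes 1_H)(1_X\otimes\beta)\colon X\otimes Y\to Y\otimes X$. Let $A$ be a Hopf algebra in $\mathcal C$ and $B$ a Hopf algebra in $\mathcal C^A_A$; write $\triangleleft,\beta$ for the action and coaction of $A$ on $B$. The cross product $A\ltimes B$ is the object $A\otimes B$ of $\mathcal C$ with unit $\eta_A\otimes\eta_B$, counit $\varepsilon_A\otimes\varepsilon_B$ and $$\mu_{A\ltimes B}=(\mu_A\otimes\mu_B)(1_A\otimes 1_A\otimes\triangleleft\otimes 1_B)(1_A\otimes\Psi_{B,A}\otimes 1_A\otimes 1_B)(1_A\otimes 1_B\otimes\Delta_A\otimes 1_B),$$ $$\Delta_{A\ltimes B}=(1_A\otimes 1_B\otimes\mu_A\otimes 1_B)(1_A\otimes\Psi_{A,B}\otimes 1_A\otimes 1_B)(1_A\otimes 1_A\otimes\beta\otimes 1_B)(\Delta_A\otimes\Delta_B),$$ $$S_{A\ltimes B}=(1_A\otimes\triangleleft)(\Psi_{B,A}\otimes 1_A)(1_B\otimes\Delta_A)(S_B\otimes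 S_A)(1_B\otimes\mu_A)(\Psi_{A,B}\otimes 1_A)(1_A\otimes\beta).$$ Then $A\ltimes B$ is a Hopf algebra in $\mathcal C$ (with invertible antipode), and the braided categories $(\mathcal C^A_A)^B_B$ and $\mathcal C^{A\ltimes B}_{A\ltimes B}$ are isomorphic. More precisely, for every crossed module $X$ over $B$ in $\mathcal C^A_A$, the action $$X\otimes A\otimes B\xrightarrow{\ \triangleleft_A\otimes 1_B\ }X\otimes B\xrightarrow{\ \triangleleft_B\ }X$$ and the coaction $$X\xrightarrow{\ \beta_B\ }X\otimes B\xrightarrow{\ \beta_A\otimes 1_B\ }X\otimes A\otimes B$$ make the underlying object $X$ of $\mathcal C$ a right crossed module over $A\ltimes B$, and the functor $(\mathcal C^A_A)^B_B\to\mathcal C^{A\ltimes B}_{A\ltimes B}$ defined in this way on objects, and as the identity on underlying morphisms of $\mathcal C$, is an isomorphism of categories and a strict braided monoidal functor (its structure isomorphisms $F(X)\otimes F(Y)\to F(X\otimes Y)$ and $\underline 1\to F(\underline 1)$ are identities of $\mathcal C$). -/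

import Mathlib

open CategoryTheory MonoidalCategory
open scoped MonObj ComonObj HopfObj

universe v u

namespace Braided

/-!
Hopf algebras in a braided category are Mathlib's `HopfObj` together with `IsIso 𝒮[H]`.

The definitions are `IsCrossedModule`, `tensorAct`, `tensorCoact`, `unitAct`, `unitCoact`, `yBr`,
`CrossedModule` with its braided monoidal structure, and the cross product at the end.
Everything else consists of proved facts which show that crossed modules form a braided category.
-/

/-! ### Auxiliary calculus

`sA Z f`, `sC Z f`, `sX Z f` are `id_Z ⊗ f`, bracketed to the left. -/


section Strand

variable {C : Type u} [Category.{v} C] [MonoidalCategory C]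

def sA (Z : C) {X Y W : C} (f : X ⊗ Y ⟶ W) : (Z ⊗ X) ⊗ Y ⟶ Z ⊗ W :=
  (α_ Z X Y).hom ≫ Z ◁ f

def sC (Z : C) {X Y W : C} (f : W ⟶ X ⊗ Y) : Z ⊗ W ⟶ (Z ⊗ X) ⊗ Y :=
  Z ◁ f ≫ (α_ Z X Y).inv

def sX (Z : C) {X Y V W : C} (f : X ⊗ Y ⟶ V ⊗ W) : (Z ⊗ X) ⊗ Y ⟶ (Z ⊗ V) ⊗ W :=
  (α_ Z X Y).hom ≫ Z ◁ f ≫ (α_ Z V W).inv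

theorem whiskerLeft_inj {X Y : C} {f g : X ⟶ Y} (h : 𝟙_ C ◁ f = 𝟙_ C ◁ g) : f = g := by
  simpa using h

theorem sA_inj {X Y W : C} {f g : X ⊗ Y ⟶ W} (h : sA (𝟙_ C) f = sA (𝟙_ C) g) : f = g := by
  simpa [sA] using h

theorem sX_inj {X Y V W : C} {f g : X ⊗ Y ⟶ V ⊗ W} (h : sX (𝟙_ C) f = sX (𝟙_ C) g) : f = g := by
  simpa [sX] using h

theorem sA_nat {Z Z' X Y W : C} (z : Z ⟶ Z') (f : X ⊗ Y ⟶ W) :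
    z ▷ X ▷ Y ≫ sA Z' f = sA Z f ≫ z ▷ W := by
  simp [sA, whisker_exchange]

theorem sC_nat {Z Z' X Y W : C} (z : Z ⟶ Z') (f : W ⟶ X ⊗ Y) :
    z ▷ W ≫ sC Z' f = sC Z f ≫ z ▷ X ▷ Y := by
  simp [sC, ← whisker_exchange_assoc]

theorem sX_nat {Z Z' X Y V W : C} (z : Z ⟶ Z') (f : X ⊗ Y ⟶ V ⊗ W) :
    z ▷ X ▷ Y ≫ sX Z' f = sX Z f ≫ z ▷ V ▷ W := by
  rw [sX, sX, associator_naturality_left_assoc, ← whisker_exchange_assoc,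
    Category.assoc, Category.assoc, associator_inv_naturality_left]

variable [BraidedCategory C]

def sB (Z X Y : C) : (Z ⊗ X) ⊗ Y ⟶ (Z ⊗ Y) ⊗ X := sX Z (β_ X Y).hom

def sBi (Z X Y : C) : (Z ⊗ Y) ⊗ X ⟶ (Z ⊗ X) ⊗ Y := sX Z (β_ X Y).inv

theorem sB_nat {Z Z' : C} (z : Z ⟶ Z') (X Y : C) :
    z ▷ X ▷ Y ≫ sB Z' X Y = sB Z X Y ≫ z ▷ Y ▷ X := sX_nat _ _

theorem sBi_nat {Z Z' : C} (z : Z ⟶ Z') (X Y : C) :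
    z ▷ Y ▷ X ≫ sBi Z' X Y = sBi Z X Y ≫ z ▷ X ▷ Y := sX_nat _ _

@[simp]
theorem sB_sBi (Z X Y : C) : sB Z X Y ≫ sBi Z X Y = 𝟙 _ := by simp [sB, sBi, sX]

@[simp]
theorem sBi_sB (Z X Y : C) : sBi Z X Y ≫ sB Z X Y = 𝟙 _ := by simp [sB, sBi, sX]


open BraidedCategory in
theorem sA_sB (Z : C) {X Y W : C} (f : X ⊗ Y ⟶ W) (V : C) :
    sA Z f ▷ V ≫ sB Z W V = sB (Z ⊗ X) Y V ≫ sB Z X V ▷ Y ≫ sA (Z ⊗ V) f := by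
  simp only [sA, sB, sX]
  calc
    _ = 𝟙 _ ⊗≫ Z ◁ (f ▷ V ≫ (β_ W V).hom) ⊗≫ 𝟙 _ := by monoidal
    _ = _ := by rw [braiding_naturality_left, braiding_tensor_left_hom]; monoidal

open BraidedCategory in
theorem sA_sB' (Z : C) {X Y W : C} (f : X ⊗ Y ⟶ W) (V : C) :
    sA (Z ⊗ V) f ≫ sB Z V W = sB Z V X ▷ Y ≫ sB (Z ⊗ X) V Y ≫ sA Z f ▷ V := by
  simp only [sA, sB, sX]
  calc
    _ = 𝟙 _ ⊗≫ Z ◁ (V ◁ f ≫ (β_ V W).hom) ⊗≫ 𝟙 _ := by monoidal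
    _ = _ := by rw [braiding_naturality_right, braiding_tensor_right_hom]; monoidal

open BraidedCategory in
theorem sC_sB (Z : C) {X Y W : C} (f : W ⟶ X ⊗ Y) (V : C) :
    sC Z f ▷ V ≫ sB (Z ⊗ X) Y V ≫ sB Z X V ▷ Y = sB Z W V ≫ sC (Z ⊗ V) f := by
  simp only [sC, sB, sX]
  symm
  calc
    _ = 𝟙 _ ⊗≫ Z ◁ ((β_ W V).hom ≫ V ◁ f) ⊗≫ 𝟙 _ := by monoidal
    _ = _ := by rw [← braiding_naturality_left, braiding_tensor_left_hom]; monoidal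

open BraidedCategory in
theorem sC_sB' (Z : C) {X Y W : C} (f : W ⟶ X ⊗ Y) (V : C) :
    sC (Z ⊗ V) f ≫ sB Z V X ▷ Y ≫ sB (Z ⊗ X) V Y = sB Z V W ≫ sC Z f ▷ V := by
  simp only [sC, sB, sX]
  symm
  calc
    _ = 𝟙 _ ⊗≫ Z ◁ ((β_ V W).hom ≫ f ▷ V) ⊗≫ 𝟙 _ := by monoidal
    _ = _ := by rw [← braiding_naturality_right, braiding_tensor_right_hom]; monoidal

theorem sB_yb (Z X Y V : C) :
    sB (Z ⊗ X) Y V ≫ sB Z X V ▷ Y ≫ sB (Z ⊗ V) X Y =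
      sB Z X Y ▷ V ≫ sB (Z ⊗ Y) X V ≫ sB Z Y V ▷ X := by
  simp only [sB, sX]
  have := BraidedCategory.yang_baxter X Y V
  calc
    _ = 𝟙 _ ⊗≫ Z ◁ ((X ◁ (β_ Y V).hom) ⊗≫ (β_ X V).hom ▷ Y ⊗≫ V ◁ (β_ X Y).hom) ⊗≫ 𝟙 _ := by monoidal
    _ = 𝟙 _ ⊗≫ Z ◁ ((α_ X Y V).inv ≫ (β_ X Y).hom ▷ V ≫ (α_ Y X V).hom ≫
      Y ◁ (β_ X V).hom ≫ (α_ Y V X).inv ≫ (β_ Y V).hom ▷ X ≫ (α_ V Y X).hom) ⊗≫ 𝟙 _ := by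
        rw [this]; monoidal
    _ = _ := by monoidal

theorem sA_nat' {Z Z' X Y W : C} (z : Z ⟶ Z') (f : X ⊗ Y ⟶ W) :
    sA Z f ≫ z ▷ W = z ▷ X ▷ Y ≫ sA Z' f := (sA_nat z f).symm

theorem sA_natp_w1 {Z Z' X Y W : C} (z : Z ⟶ Z') (f : X ⊗ Y ⟶ W) (V1 : C) :
    sA Z f ▷ V1 ≫ z ▷ W ▷ V1 =
      z ▷ X ▷ Y ▷ V1 ≫ sA Z' f ▷ V1 := by
  simpa only [comp_whiskerRight, Category.assoc] using
    congrArg (· ▷ V1) (sA_nat' z f)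

theorem sC_nat_w1 {Z Z' X Y W : C} (z : Z ⟶ Z') (f : W ⟶ X ⊗ Y) (V1 : C) :
    z ▷ W ▷ V1 ≫ sC Z' f ▷ V1 =
      sC Z f ▷ V1 ≫ z ▷ X ▷ Y ▷ V1 := by
  simpa only [comp_whiskerRight, Category.assoc] using
    congrArg (· ▷ V1) (sC_nat z f)

theorem sC_nat_w2 {Z Z' X Y W : C} (z : Z ⟶ Z') (f : W ⟶ X ⊗ Y) (V1 V2 : C) :
    z ▷ W ▷ V1 ▷ V2 ≫ sC Z' f ▷ V1 ▷ V2 =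
      sC Z f ▷ V1 ▷ V2 ≫ z ▷ X ▷ Y ▷ V1 ▷ V2 := by
  simpa only [comp_whiskerRight, Category.assoc] using
    congrArg (· ▷ V2) (sC_nat_w1 z f V1)

theorem sB_nat_w1 {Z Z' : C} (z : Z ⟶ Z') (X Y : C) (V1 : C) :
    z ▷ X ▷ Y ▷ V1 ≫ sB Z' X Y ▷ V1 =
      sB Z X Y ▷ V1 ≫ z ▷ Y ▷ X ▷ V1 := by
  simpa only [comp_whiskerRight, Category.assoc] using
    congrArg (· ▷ V1) (sB_nat z X Y)

theorem sB_nat_w2 {Z Z' : C} (z : Z ⟶ Z') (X Y : C) (V1 V2 : C) :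
    z ▷ X ▷ Y ▷ V1 ▷ V2 ≫ sB Z' X Y ▷ V1 ▷ V2 =
      sB Z X Y ▷ V1 ▷ V2 ≫ z ▷ Y ▷ X ▷ V1 ▷ V2 := by
  simpa only [comp_whiskerRight, Category.assoc] using
    congrArg (· ▷ V2) (sB_nat_w1 z X Y V1)

theorem sB_nat_w3 {Z Z' : C} (z : Z ⟶ Z') (X Y : C) (V1 V2 V3 : C) :
    z ▷ X ▷ Y ▷ V1 ▷ V2 ▷ V3 ≫ sB Z' X Y ▷ V1 ▷ V2 ▷ V3 =
      sB Z X Y ▷ V1 ▷ V2 ▷ V3 ≫ z ▷ Y ▷ X ▷ V1 ▷ V2 ▷ V3 := by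
  simpa only [comp_whiskerRight, Category.assoc] using
    congrArg (· ▷ V3) (sB_nat_w2 z X Y V1 V2)

theorem sA_sB_w1 (Z : C) {X Y W : C} (f : X ⊗ Y ⟶ W) (V : C) (V1 : C) :
    sA Z f ▷ V ▷ V1 ≫ sB Z W V ▷ V1 =
      sB (Z ⊗ X) Y V ▷ V1 ≫ sB Z X V ▷ Y ▷ V1 ≫ sA (Z ⊗ V) f ▷ V1 := by
  simpa only [comp_whiskerRight, Category.assoc] using
    congrArg (· ▷ V1) (sA_sB Z f V)

theorem sA_sB_w2 (Z : C) {X Y W : C} (f : X ⊗ Y ⟶ W) (V : C) (V1 V2 : C) :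
    sA Z f ▷ V ▷ V1 ▷ V2 ≫ sB Z W V ▷ V1 ▷ V2 =
      sB (Z ⊗ X) Y V ▷ V1 ▷ V2 ≫ sB Z X V ▷ Y ▷ V1 ▷ V2 ≫ sA (Z ⊗ V) f ▷ V1 ▷ V2 := by
  simpa only [comp_whiskerRight, Category.assoc] using
    congrArg (· ▷ V2) (sA_sB_w1 Z f V V1)

theorem sA_sBp_w1 (Z : C) {X Y W : C} (f : X ⊗ Y ⟶ W) (V : C) (V1 : C) :
    sA (Z ⊗ V) f ▷ V1 ≫ sB Z V W ▷ V1 =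
      sB Z V X ▷ Y ▷ V1 ≫ sB (Z ⊗ X) V Y ▷ V1 ≫ sA Z f ▷ V ▷ V1 := by
  simpa only [comp_whiskerRight, Category.assoc] using
    congrArg (· ▷ V1) (sA_sB' Z f V)

theorem sA_sBp_w2 (Z : C) {X Y W : C} (f : X ⊗ Y ⟶ W) (V : C) (V1 V2 : C) :
    sA (Z ⊗ V) f ▷ V1 ▷ V2 ≫ sB Z V W ▷ V1 ▷ V2 =
      sB Z V X ▷ Y ▷ V1 ▷ V2 ≫ sB (Z ⊗ X) V Y ▷ V1 ▷ V2 ≫ sA Z f ▷ V ▷ V1 ▷ V2 := by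
  simpa only [comp_whiskerRight, Category.assoc] using
    congrArg (· ▷ V2) (sA_sBp_w1 Z f V V1)

theorem sB_sC (Z : C) {X Y W : C} (f : W ⟶ X ⊗ Y) (V : C) :
    sB Z W V ≫ sC (Z ⊗ V) f = sC Z f ▷ V ≫ sB (Z ⊗ X) Y V ≫ sB Z X V ▷ Y := (sC_sB Z f V).symm

theorem sB_sC_w1 (Z : C) {X Y W : C} (f : W ⟶ X ⊗ Y) (V : C) (V1 : C) :
    sB Z W V ▷ V1 ≫ sC (Z ⊗ V) f ▷ V1 =
      sC Z f ▷ V ▷ V1 ≫ sB (Z ⊗ X) Y V ▷ V1 ≫ sB Z X V ▷ Y ▷ V1 := by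
  simpa only [comp_whiskerRight, Category.assoc] using
    congrArg (· ▷ V1) (sB_sC Z f V)

theorem sB_sC_w2 (Z : C) {X Y W : C} (f : W ⟶ X ⊗ Y) (V : C) (V1 V2 : C) :
    sB Z W V ▷ V1 ▷ V2 ≫ sC (Z ⊗ V) f ▷ V1 ▷ V2 =
      sC Z f ▷ V ▷ V1 ▷ V2 ≫ sB (Z ⊗ X) Y V ▷ V1 ▷ V2 ≫ sB Z X V ▷ Y ▷ V1 ▷ V2 := by
  simpa only [comp_whiskerRight, Category.assoc] using
    congrArg (· ▷ V2) (sB_sC_w1 Z f V V1)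

theorem sB_sC' (Z : C) {X Y W : C} (f : W ⟶ X ⊗ Y) (V : C) :
    sB Z V W ≫ sC Z f ▷ V = sC (Z ⊗ V) f ≫ sB Z V X ▷ Y ≫ sB (Z ⊗ X) V Y := (sC_sB' Z f V).symm

theorem sB_sCp_w1 (Z : C) {X Y W : C} (f : W ⟶ X ⊗ Y) (V : C) (V1 : C) :
    sB Z V W ▷ V1 ≫ sC Z f ▷ V ▷ V1 =
      sC (Z ⊗ V) f ▷ V1 ≫ sB Z V X ▷ Y ▷ V1 ≫ sB (Z ⊗ X) V Y ▷ V1 := by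
  simpa only [comp_whiskerRight, Category.assoc] using
    congrArg (· ▷ V1) (sB_sC' Z f V)

end Strand

section CM

variable {C : Type u} [Category.{v} C] [MonoidalCategory C] [BraidedCategory C]

/-- `act` is a right `H`-module structure on `X`, `coact` is a right `H`-comodule structure on `X`,
and they satisfy the compatibility axiom of a right crossed module:
`(1 ⊗ Δ)`, `Ψ_{X,H} ⊗ 1`, `1 ⊗ act`, `1 ⊗ coact`, `Ψ_{H,X} ⊗ 1`, `1 ⊗ μ` (in this order) compose
to `(act ⊗ μ) ∘ (1 ⊗ Ψ_{H,H} ⊗ 1) ∘ (coact ⊗ Δ)`. -/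
structure IsCrossedModule (H : C) [HopfObj H] {X : C} (act : X ⊗ H ⟶ X) (coact : X ⟶ X ⊗ H) :
    Prop where
  act_one : X ◁ η[H] ≫ act = (ρ_ X).hom
  act_mul : X ◁ μ[H] ≫ act = (α_ X H H).inv ≫ act ▷ H ≫ act
  coact_counit : coact ≫ X ◁ ε[H] = (ρ_ X).inv
  coact_comul : coact ≫ X ◁ Δ[H] = coact ≫ coact ▷ H ≫ (α_ X H H).hom
  compat :
    X ◁ Δ[H] ≫ (α_ X H H).inv ≫ (β_ X H).hom ▷ H ≫ (α_ H X H).hom ≫ H ◁ act ≫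
      H ◁ coact ≫ (α_ H X H).inv ≫ (β_ H X).hom ▷ H ≫ (α_ X H H).hom ≫ X ◁ μ[H] =
    (coact ⊗ₘ Δ[H]) ≫ tensorμ X H H H ≫ (act ⊗ₘ μ[H])

variable {H : C} [HopfObj H]

theorem sA_assoc (Z : C) : sA Z μ[H] ▷ H ≫ sA Z μ[H] = sA (Z ⊗ H) μ[H] ≫ sA Z μ[H] := by
  simp only [sA]
  calc
    _ = 𝟙 _ ⊗≫ Z ◁ (μ[H] ▷ H ≫ μ[H]) ⊗≫ 𝟙 _ := by monoidal
    _ = _ := by rw [MonObj.mul_assoc]; monoidal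

theorem sC_coassoc (Z : C) : sC Z Δ[H] ≫ sC Z Δ[H] ▷ H = sC Z Δ[H] ≫ sC (Z ⊗ H) Δ[H] := by
  simp only [sC]
  symm
  calc
    _ = 𝟙 _ ⊗≫ Z ◁ (Δ[H] ≫ H ◁ Δ[H]) ⊗≫ 𝟙 _ := by monoidal
    _ = _ := by rw [ComonObj.comul_assoc]; monoidal

theorem sA_sC (Z : C) : sA Z μ[H] ≫ sC Z Δ[H] =
    sC (Z ⊗ H) Δ[H] ≫ sC Z Δ[H] ▷ H ▷ H ≫ sB (Z ⊗ H) H H ▷ H ≫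
      sA Z μ[H] ▷ H ▷ H ≫ sA (Z ⊗ H) μ[H] := by
  simp only [sA, sC, sB, sX]
  calc
    _ = 𝟙 _ ⊗≫ Z ◁ (μ[H] ≫ Δ[H]) ⊗≫ 𝟙 _ := by monoidal
    _ = _ := by
      rw [BimonObj.mul_comul, tensorμ, MonoidalCategory.tensorHom_def', MonoidalCategory.tensorHom_def]; monoidal

section single
variable {X : C} {a : X ⊗ H ⟶ X} {c : X ⟶ X ⊗ H}

theorem IsCrossedModule.sA_act (h : IsCrossedModule H a c) (Z : C) : sA Z a ▷ H ≫ sA Z a = sA (Z ⊗ X) μ[H] ≫ sA Z a := by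
  simp only [sA]
  symm
  calc
    _ = 𝟙 _ ⊗≫ Z ◁ (X ◁ μ[H] ≫ a) ⊗≫ 𝟙 _ := by monoidal
    _ = _ := by rw [h.act_mul]; monoidal

theorem IsCrossedModule.sC_coact (h : IsCrossedModule H a c) (Z : C) :
    sC Z c ≫ sC Z c ▷ H = sC Z c ≫ sC (Z ⊗ X) Δ[H] := by
  simp only [sC]
  symm
  calc
    _ = 𝟙 _ ⊗≫ Z ◁ (c ≫ X ◁ Δ[H]) ⊗≫ 𝟙 _ := by monoidal
    _ = _ := by rw [h.coact_comul]; monoidal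

theorem IsCrossedModule.s_compat (h : IsCrossedModule H a c) (Z : C) :
    sC (Z ⊗ X) Δ[H] ≫ sB Z X H ▷ H ≫ sA (Z ⊗ H) a ≫ sC (Z ⊗ H) c ≫ sB Z H X ▷ H ≫
      sA (Z ⊗ X) μ[H] =
    sC (Z ⊗ X) Δ[H] ≫ sC Z c ▷ H ▷ H ≫ sB (Z ⊗ X) H H ▷ H ≫
      sA Z a ▷ H ▷ H ≫ sA (Z ⊗ X) μ[H] := by
  simp only [sA, sC, sB, sX]
  have := h.compat
  calc
    _ = 𝟙 _ ⊗≫ Z ◁ (X ◁ Δ[H] ≫ (α_ X H H).inv ≫ (β_ X H).hom ▷ H ≫ (α_ H X H).hom ≫ H ◁ a ≫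
      H ◁ c ≫ (α_ H X H).inv ≫ (β_ H X).hom ▷ H ≫ (α_ X H H).hom ≫ X ◁ μ[H]) ⊗≫ 𝟙 _ := by monoidal
    _ = _ := by
      rw [h.compat, tensorμ, MonoidalCategory.tensorHom_def', MonoidalCategory.tensorHom_def]; monoidal

end single

section tensor

/-- The diagonal action on `X ⊗ Y`: split `H` by `Δ`, move the first leg past `Y` by `Ψ_{Y,H}`,
then act. -/
def tensorAct {X Y : C} (a : X ⊗ H ⟶ X) (b : Y ⊗ H ⟶ Y) : (X ⊗ Y) ⊗ H ⟶ X ⊗ Y :=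
  (X ⊗ Y) ◁ Δ[H] ≫ tensorμ X Y H H ≫ (a ⊗ₘ b)

/-- The diagonal coaction on `X ⊗ Y`: coact, move the first `H` past `Y` by `Ψ_{H,Y}`,
then multiply. -/
def tensorCoact {X Y : C} (c : X ⟶ X ⊗ H) (d : Y ⟶ Y ⊗ H) : X ⊗ Y ⟶ (X ⊗ Y) ⊗ H :=
  (c ⊗ₘ d) ≫ tensorμ X H Y H ≫ (X ⊗ Y) ◁ μ[H]

def tA (Z : C) {X Y : C} (a : X ⊗ H ⟶ X) (b : Y ⊗ H ⟶ Y) :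
    ((Z ⊗ X) ⊗ Y) ⊗ H ⟶ (Z ⊗ X) ⊗ Y :=
  sC ((Z ⊗ X) ⊗ Y) Δ[H] ≫ sB (Z ⊗ X) Y H ▷ H ≫ sA Z a ▷ Y ▷ H ≫ sA (Z ⊗ X) b

def tC (Z : C) {X Y : C} (c : X ⟶ X ⊗ H) (d : Y ⟶ Y ⊗ H) :
    (Z ⊗ X) ⊗ Y ⟶ ((Z ⊗ X) ⊗ Y) ⊗ H :=
  sC (Z ⊗ X) d ≫ sC Z c ▷ Y ▷ H ≫ sB (Z ⊗ X) H Y ▷ H ≫ sA ((Z ⊗ X) ⊗ Y) μ[H]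

variable {X Y : C} {a : X ⊗ H ⟶ X} {c : X ⟶ X ⊗ H} {b : Y ⊗ H ⟶ Y} {d : Y ⟶ Y ⊗ H}

theorem tA_eq (Z : C) : tA Z a b = (α_ Z X Y).hom ▷ H ≫ sA Z (tensorAct a b) ≫ (α_ Z X Y).inv := by
  simp only [tA, sA, sC, sB, sX, tensorAct, tensorμ, MonoidalCategory.tensorHom_def]
  monoidal

theorem tC_eq (Z : C) :
    tC Z c d = (α_ Z X Y).hom ≫ sC Z (tensorCoact c d) ≫ (α_ Z X Y).inv ▷ H := by
  simp only [tC, sA, sC, sB, sX, tensorCoact, tensorμ, MonoidalCategory.tensorHom_def']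
  monoidal


theorem tensorAct_mul (h : IsCrossedModule H a c) (k : IsCrossedModule H b d) :
    (X ⊗ Y) ◁ μ[H] ≫ tensorAct a b =
      (α_ (X ⊗ Y) H H).inv ≫ tensorAct a b ▷ H ≫ tensorAct a b := by
  have ha : a ▷ H ≫ a = (α_ X H H).hom ≫ X ◁ μ[H] ≫ a := by simp [h.act_mul]
  have hb : b ▷ H ≫ b = (α_ Y H H).hom ≫ Y ◁ μ[H] ≫ b := by simp [k.act_mul]
  rw [Iso.eq_inv_comp]
  simp only [tensorAct, comp_whiskerRight, Category.assoc]
  rw [← whisker_exchange_assoc, tensorμ_natural_left_assoc, tensorHom_comp_tensorHom, ha, hb,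
    ← tensorHom_comp_tensorHom, ← tensorHom_comp_tensorHom, ← whisker_exchange_assoc,
    tensor_associativity_assoc, ← tensorμ_natural_right_assoc]
  have := congrArg (fun t => (X ⊗ Y) ◁ t) (BimonObj.mul_comul H)
  simp only [whiskerLeft_comp] at this
  rw [reassoc_of% this, MonoidalCategory.tensorHom_def Δ[H] Δ[H]]
  simp

theorem tensorCoact_comul (h : IsCrossedModule H a c) (k : IsCrossedModule H b d) :
    tensorCoact c d ≫ (X ⊗ Y) ◁ Δ[H] =
      tensorCoact c d ≫ tensorCoact c d ▷ H ≫ (α_ (X ⊗ Y) H H).hom := by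
  have hc : c ≫ c ▷ H = c ≫ X ◁ Δ[H] ≫ (α_ X H H).inv := by simp [reassoc_of% h.coact_comul]
  have hd : d ≫ d ▷ H = d ≫ Y ◁ Δ[H] ≫ (α_ Y H H).inv := by simp [reassoc_of% k.coact_comul]
  have n1 := tensorμ_natural c (𝟙 H) d (𝟙 H)
  have n2 := tensorμ_natural (𝟙 X) Δ[H] (𝟙 Y) Δ[H]
  have n3 := associator_monoidal X H H Y H H
  simp only [tensorHom_id, id_tensorHom, id_whiskerRight] at n1 n2
  have this := congrArg (fun t => (X ⊗ Y) ◁ t) (BimonObj.mul_comul H)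
  simp only [whiskerLeft_comp] at this
  simp only [tensorCoact, comp_whiskerRight, Category.assoc]
  rw [this, ← reassoc_of% n2, tensorHom_comp_tensorHom_assoc, h.coact_comul, k.coact_comul]
  rw [← tensorHom_comp_tensorHom_assoc, ← tensorHom_comp_tensorHom_assoc, ← reassoc_of% n3]
  have m1 : c ≫ c ▷ H ≫ (α_ X H H).hom = c ≫ X ◁ Δ[H] := h.coact_comul.symm
  have m2 : d ≫ d ▷ H ≫ (α_ Y H H).hom = d ≫ Y ◁ Δ[H] := k.coact_comul.symm
  rw [reassoc_of% n1, whisker_exchange_assoc, whisker_exchange_assoc]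
  congr 2
  rw [MonoidalCategory.tensorHom_def' μ[H] μ[H]]
  simp


theorem tensorAct_one (h : IsCrossedModule H a c) (k : IsCrossedModule H b d) :
    (X ⊗ Y) ◁ η[H] ≫ tensorAct a b = (ρ_ (X ⊗ Y)).hom := by
  have := congrArg (fun t => (X ⊗ Y) ◁ t) (Bimon.one_comul H)
  simp only [whiskerLeft_comp] at this
  rw [tensorAct, reassoc_of% this, tensorμ_natural_right_assoc, tensorHom_comp_tensorHom,
    h.act_one, k.act_one, ← tensor_right_unitality]

theorem tensorCoact_counit (h : IsCrossedModule H a c) (k : IsCrossedModule H b d) :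
    tensorCoact c d ≫ (X ⊗ Y) ◁ ε[H] = (ρ_ (X ⊗ Y)).inv := by
  have := congrArg (fun t => (X ⊗ Y) ◁ t) (Bimon.mul_counit H)
  simp only [whiskerLeft_comp] at this
  have n2 := tensorμ_natural (𝟙 X) ε[H] (𝟙 Y) ε[H]
  simp only [id_tensorHom, whiskerLeft_id] at n2
  simp only [tensorCoact, Category.assoc]
  rw [this, ← reassoc_of% n2, tensorHom_comp_tensorHom_assoc, h.coact_counit, k.coact_counit,
    ← cancel_mono (ρ_ (X ⊗ Y)).hom]
  simp only [Category.assoc]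
  rw [← rightUnitor_monoidal]
  simp


theorem t_compat (h : IsCrossedModule H a c) (k : IsCrossedModule H b d) (Z : C) :
    sC ((Z ⊗ X) ⊗ Y) Δ[H] ≫ sB (Z ⊗ X) Y H ▷ H ≫ sB Z X H ▷ Y ▷ H ≫ tA (Z ⊗ H) a b ≫
      tC (Z ⊗ H) c d ≫ sB Z H X ▷ Y ▷ H ≫ sB (Z ⊗ X) H Y ▷ H ≫ sA ((Z ⊗ X) ⊗ Y) μ[H] =
    sC ((Z ⊗ X) ⊗ Y) Δ[H] ≫ tC Z c d ▷ H ▷ H ≫ sB ((Z ⊗ X) ⊗ Y) H H ▷ H ≫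
      tA Z a b ▷ H ▷ H ≫ sA ((Z ⊗ X) ⊗ Y) μ[H] := by
  have yb := congrArg (· ▷ H ▷ H ▷ H) (sB_yb (Z ⊗ X) H Y H)
  simp only [comp_whiskerRight, Category.assoc] at yb
  calc
    _ = sC ((Z ⊗ X) ⊗ Y) Δ[H] ≫ sB (Z ⊗ X) Y H ▷ H ≫
      (sC (Z ⊗ X) Δ[H] ≫ sB Z X H ▷ H ≫ sA (Z ⊗ H) a ≫ sC (Z ⊗ H) c ≫ sB Z H X ▷ H ≫
      sA (Z ⊗ X) μ[H]) ▷ Y ▷ H ≫ sA ((Z ⊗ X) ⊗ H) b ≫ sC ((Z ⊗ X) ⊗ H) d ≫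
        sB (Z ⊗ X) H Y ▷ H ≫ sA ((Z ⊗ X) ⊗ Y) μ[H] := by
      simp only [comp_whiskerRight, Category.assoc]
      rw [reassoc_of% @sA_nat, reassoc_of% @sA_nat, reassoc_of% @sA_nat, reassoc_of% @sC_nat, reassoc_of% @sC_nat, reassoc_of% @sC_nat]
      simp only [tA, tC, Category.assoc, reassoc_of% @sA_nat', reassoc_of% @sC_nat,
        reassoc_of% @sB_nat_w1, reassoc_of% @sA_sB_w1, sA_assoc, reassoc_of% @sB_sCp_w1,
        reassoc_of% @sC_coassoc]
    _ = (sC ((Z ⊗ X) ⊗ Y) Δ[H] ≫ sB (Z ⊗ X) Y H ▷ H ≫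
      (sC Z c ▷ H ≫ sB (Z ⊗ X) H H ≫ sA Z a ▷ H) ▷ Y ▷ H) ≫
      (sC (((Z ⊗ X) ⊗ H) ⊗ Y) Δ[H] ≫ sB ((Z ⊗ X) ⊗ H) Y H ▷ H ≫ sA (((Z ⊗ X) ⊗ H) ⊗ H) b ≫
       sC (((Z ⊗ X) ⊗ H) ⊗ H) d ≫ sB ((Z ⊗ X) ⊗ H) H Y ▷ H ≫ sA (((Z ⊗ X) ⊗ H) ⊗ Y) μ[H]) ≫
        sB (Z ⊗ X) H Y ▷ H ≫ sA ((Z ⊗ X) ⊗ Y) μ[H] := by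
      rw [h.s_compat]
      simp only [comp_whiskerRight, Category.assoc]
      rw [reassoc_of% @sA_nat, reassoc_of% @sC_nat]
      simp only [reassoc_of% @sA_sB_w1, sA_assoc, reassoc_of% @sB_sCp_w1, reassoc_of% @sC_coassoc,
        reassoc_of% @sA_nat', reassoc_of% @sC_nat, reassoc_of% @sB_nat_w1]
    _ = _ := by
      rw [k.s_compat]
      simp only [comp_whiskerRight, Category.assoc, reassoc_of% @sA_nat', reassoc_of% @sA_sBp_w2,
        reassoc_of% @sC_nat, reassoc_of% @sC_nat_w2, reassoc_of% @sB_nat_w1,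
        reassoc_of% @sB_nat_w3, reassoc_of% @sB_nat_w2, reassoc_of% @sB_sC_w2, tC, tA,
        reassoc_of% @sB_sCp_w1, reassoc_of% @sC_nat_w1, reassoc_of% @sA_sB_w2,
        reassoc_of% @sA_sB_w1, reassoc_of% @sA_natp_w1, sA_assoc, reassoc_of% @sC_coassoc]
      rw [← reassoc_of% @sB_nat_w3, reassoc_of% yb]
      simp only [reassoc_of% @sB_nat_w2]

theorem sX_compat {X : C} (a : X ⊗ H ⟶ X) (c : X ⟶ X ⊗ H) (Z : C) : 
    sX Z (X ◁ Δ[H] ≫ (α_ X H H).inv ≫ (β_ X H).hom ▷ H ≫ (α_ H X H).hom ≫ H ◁ a ≫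
      H ◁ c ≫ (α_ H X H).inv ≫ (β_ H X).hom ▷ H ≫ (α_ X H H).hom ≫ X ◁ μ[H]) =
    sC (Z ⊗ X) Δ[H] ≫ sB Z X H ▷ H ≫ sA (Z ⊗ H) a ≫ sC (Z ⊗ H) c ≫ sB Z H X ▷ H ≫
      sA (Z ⊗ X) μ[H] := by
  simp only [sA, sC, sB, sX]
  monoidal

theorem sX_compat' {X : C} (a : X ⊗ H ⟶ X) (c : X ⟶ X ⊗ H) (Z : C) :
    sX Z ((c ⊗ₘ Δ[H]) ≫ tensorμ X H H H ≫ (a ⊗ₘ μ[H])) =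
    sC (Z ⊗ X) Δ[H] ≫ sC Z c ▷ H ▷ H ≫ sB (Z ⊗ X) H H ▷ H ≫
      sA Z a ▷ H ▷ H ≫ sA (Z ⊗ X) μ[H] := by
  simp only [sA, sC, sB, sX, tensorμ]
  rw [MonoidalCategory.tensorHom_def' c, MonoidalCategory.tensorHom_def a]
  monoidal

open BraidedCategory in
theorem sB_tensor_left (Z X Y V : C) :
    sB Z (X ⊗ Y) V = (α_ Z X Y).inv ▷ V ≫ sB (Z ⊗ X) Y V ≫ sB Z X V ▷ Y ≫ (α_ (Z ⊗ V) X Y).hom := by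
  simp only [sB, sX, braiding_tensor_left_hom]; monoidal

open BraidedCategory in
theorem sB_tensor_right (Z X Y V : C) :
    sB Z V (X ⊗ Y) = (α_ (Z ⊗ V) X Y).inv ≫ sB Z V X ▷ Y ≫ sB (Z ⊗ X) V Y ≫ (α_ Z X Y).hom ▷ V := by
  simp only [sB, sX, braiding_tensor_right_hom]; monoidal

theorem sA_tensorAct (Z : C) :
    sA Z (tensorAct a b) = (α_ Z X Y).inv ▷ H ≫ tA Z a b ≫ (α_ Z X Y).hom := by
  rw [tA_eq]; simp

theorem sC_tensorCoact (Z : C) :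
    sC Z (tensorCoact c d) = (α_ Z X Y).inv ≫ tC Z c d ≫ (α_ Z X Y).hom ▷ H := by
  rw [tC_eq]; simp

theorem IsCrossedModule.tensor (h : IsCrossedModule H a c) (k : IsCrossedModule H b d) :
    IsCrossedModule H (tensorAct a b) (tensorCoact c d) where
  act_one := tensorAct_one h k
  act_mul := tensorAct_mul h k
  coact_counit := tensorCoact_counit h k
  coact_comul := tensorCoact_comul h k
  compat := by
    apply sX_inj
    rw [sX_compat, sX_compat']
    simp only [sA_tensorAct, sC_tensorCoact, sB_tensor_left, sB_tensor_right, comp_whiskerRight,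
      Category.assoc, Iso.hom_inv_id_assoc, Iso.inv_hom_id_assoc, hom_inv_whiskerRight_assoc]
    have e := t_compat h k (𝟙_ C)
    have e2 := (α_ (𝟙_ C) X Y).inv ▷ H ≫= e =≫ (α_ (𝟙_ C) X Y).hom ▷ H
    simp only [Category.assoc, sA_nat', reassoc_of% @sC_nat, reassoc_of% @sB_nat] at e2 ⊢
    rw [e2, reassoc_of% @sB_nat_w1]
    simp

theorem tensorAct_hom {X' Y' : C} {a' : X' ⊗ H ⟶ X'} {b' : Y' ⊗ H ⟶ Y'} {f : X ⟶ X'} {g : Y ⟶ Y'}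
    (hf : a ≫ f = f ▷ H ≫ a') (hg : b ≫ g = g ▷ H ≫ b') :
    tensorAct a b ≫ (f ⊗ₘ g) = (f ⊗ₘ g) ▷ H ≫ tensorAct a' b' := by
  simp only [tensorAct, Category.assoc, tensorHom_comp_tensorHom, hf, hg]
  rw [← tensorHom_comp_tensorHom, ← tensorμ_natural_left_assoc, whisker_exchange_assoc]

theorem tensorCoact_hom {X' Y' : C} {c' : X' ⟶ X' ⊗ H} {d' : Y' ⟶ Y' ⊗ H} {f : X ⟶ X'} {g : Y ⟶ Y'}
    (hf : f ≫ c' = c ≫ f ▷ H) (hg : g ≫ d' = d ≫ g ▷ H) :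
    (f ⊗ₘ g) ≫ tensorCoact c' d' = tensorCoact c d ≫ (f ⊗ₘ g) ▷ H := by
  have n := tensorμ_natural f (𝟙 H) g (𝟙 H)
  simp only [tensorHom_id, id_tensorHom, id_whiskerRight] at n
  simp only [tensorCoact, Category.assoc, tensorHom_comp_tensorHom_assoc, hf, hg]
  rw [← tensorHom_comp_tensorHom_assoc, reassoc_of% n, whisker_exchange]

theorem tensorAct_assoc {W : C} (e : W ⊗ H ⟶ W) :
    tensorAct (tensorAct a b) e ≫ (α_ X Y W).hom =
      (α_ X Y W).hom ▷ H ≫ tensorAct a (tensorAct b e) := by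
  have n := tensorμ_natural (𝟙 (X ⊗ Y)) (𝟙 W) Δ[H] (𝟙 H)
  have n' := tensorμ_natural (𝟙 X) (𝟙 (Y ⊗ W)) (𝟙 H) Δ[H]
  have e1 : tensorAct a b ⊗ₘ e = ((X ⊗ Y) ◁ Δ[H]) ▷ (W ⊗ H) ≫ tensorμ X Y H H ▷ (W ⊗ H) ≫
      ((a ⊗ₘ b) ⊗ₘ e) := by
    rw [tensorAct, MonoidalCategory.tensorHom_def, comp_whiskerRight, comp_whiskerRight,
      Category.assoc, Category.assoc, ← MonoidalCategory.tensorHom_def]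
  have e2 : a ⊗ₘ tensorAct b e = (X ⊗ H) ◁ (Y ⊗ W) ◁ Δ[H] ≫ (X ⊗ H) ◁ tensorμ Y W H H ≫
      (a ⊗ₘ (b ⊗ₘ e)) := by
    rw [tensorAct, MonoidalCategory.tensorHom_def', whiskerLeft_comp, whiskerLeft_comp,
      Category.assoc, Category.assoc, ← MonoidalCategory.tensorHom_def']
  have f1 : tensorAct (tensorAct a b) e = ((X ⊗ Y) ⊗ W) ◁ Δ[H] ≫ tensorμ (X ⊗ Y) W H H ≫
    (tensorAct a b ⊗ₘ e) := rfl
  have f2 : tensorAct a (tensorAct b e) = (X ⊗ (Y ⊗ W)) ◁ Δ[H] ≫ tensorμ X (Y ⊗ W) H H ≫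
    (a ⊗ₘ tensorAct b e) := rfl
  simp only [tensorHom_id, id_tensorHom, id_whiskerRight, whiskerLeft_id] at n n'
  have m' := congrArg (fun t => (X ⊗ (Y ⊗ W)) ◁ t) (ComonObj.comul_assoc H)
  simp only [whiskerLeft_comp] at m'
  have q := associator_monoidal X Y W H H H
  rw [f1, f2, e1, e2]
  simp only [Category.assoc]
  rw [← reassoc_of% n, ← reassoc_of% n', reassoc_of% m', associator_naturality, reassoc_of% q,
    MonoidalCategory.tensorHom_def, Category.assoc, whisker_exchange_assoc, whisker_exchange_assoc]

theorem tensorCoact_assoc {W : C} (e : W ⟶ W ⊗ H) :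
    (α_ X Y W).hom ≫ tensorCoact c (tensorCoact d e) =
      tensorCoact (tensorCoact c d) e ≫ (α_ X Y W).hom ▷ H := by
  have n := tensorμ_natural (𝟙 (X ⊗ Y)) μ[H] (𝟙 W) (𝟙 H)
  have n' := tensorμ_natural (𝟙 X) (𝟙 H) (𝟙 (Y ⊗ W)) μ[H]
  have e1 : tensorCoact c d ⊗ₘ e = ((c ⊗ₘ d) ⊗ₘ e) ≫ tensorμ X H Y H ▷ (W ⊗ H) ≫
      ((X ⊗ Y) ◁ μ[H]) ▷ (W ⊗ H) := by
    rw [tensorCoact, MonoidalCategory.tensorHom_def', comp_whiskerRight, comp_whiskerRight,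
      ← Category.assoc, ← MonoidalCategory.tensorHom_def']
  have e2 : c ⊗ₘ tensorCoact d e = (c ⊗ₘ (d ⊗ₘ e)) ≫ (X ⊗ H) ◁ tensorμ Y H W H ≫
      (X ⊗ H) ◁ (Y ⊗ W) ◁ μ[H] := by
    rw [tensorCoact, MonoidalCategory.tensorHom_def, whiskerLeft_comp, whiskerLeft_comp,
      ← Category.assoc, ← MonoidalCategory.tensorHom_def]
  have f1 : tensorCoact (tensorCoact c d) e = (tensorCoact c d ⊗ₘ e) ≫ tensorμ (X ⊗ Y) H W H ≫
    ((X ⊗ Y) ⊗ W) ◁ μ[H] := rfl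
  have f2 : tensorCoact c (tensorCoact d e) = (c ⊗ₘ tensorCoact d e) ≫ tensorμ X H (Y ⊗ W) H ≫
    (X ⊗ (Y ⊗ W)) ◁ μ[H] := rfl
  simp only [tensorHom_id, id_tensorHom, id_whiskerRight, whiskerLeft_id] at n n'
  have m' := congrArg (fun t => (X ⊗ (Y ⊗ W)) ◁ t) (MonObj.mul_assoc H)
  simp only [whiskerLeft_comp] at m'
  have q := tensor_associativity X H Y H W H
  rw [f1, f2, e1, e2]
  simp only [Category.assoc]
  rw [reassoc_of% n, reassoc_of% n', ← associator_naturality_assoc, ← reassoc_of% q,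
    MonoidalCategory.tensorHom_def (α_ X Y W).hom, Category.assoc, whisker_exchange,
    whisker_exchange_assoc, m']

/-- The braiding of crossed modules: coact on `Y`, braid `X` with `Y`, act on `X`. -/
def yBr (X : C) {Y : C} (a : X ⊗ H ⟶ X) (d : Y ⟶ Y ⊗ H) : X ⊗ Y ⟶ Y ⊗ X :=
  X ◁ d ≫ (α_ X Y H).inv ≫ (β_ X Y).hom ▷ H ≫ (α_ Y X H).hom ≫ Y ◁ a

def yB (Z : C) (a : X ⊗ H ⟶ X) (d : Y ⟶ Y ⊗ H) : (Z ⊗ X) ⊗ Y ⟶ (Z ⊗ Y) ⊗ X :=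
  sC (Z ⊗ X) d ≫ sB Z X Y ▷ H ≫ sA (Z ⊗ Y) a

theorem sX_yBr (Z : C) : sX Z (yBr X a d) = yB Z a d := by
  simp only [yB, yBr, sA, sC, sB, sX]; monoidal

theorem yB_act (h : IsCrossedModule H a c) (k : IsCrossedModule H b d) (Z : C) :
    tA Z a b ≫ yB Z a d = yB Z a d ▷ H ≫ tA Z b a := by
  calc
    _ = (sC ((Z ⊗ X) ⊗ Y) Δ[H] ≫ sB (Z ⊗ X) Y H ▷ H ≫ sA ((Z ⊗ X) ⊗ H) b ≫ sC ((Z ⊗ X) ⊗ H) d ≫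
        sB (Z ⊗ X) H Y ▷ H ≫ sA ((Z ⊗ X) ⊗ Y) μ[H]) ≫ sB Z X Y ▷ H ≫ sA (Z ⊗ Y) a := by
      simp only [tA, yB, Category.assoc]
      rw [reassoc_of% @sA_nat, reassoc_of% @sC_nat]
      simp only [reassoc_of% @sA_sB_w1, h.sA_act, reassoc_of% @sA_nat']
    _ = _ := by
      rw [k.s_compat]
      simp only [Category.assoc, reassoc_of% @sA_nat', reassoc_of% @sA_sBp_w2, yB,
        comp_whiskerRight, tA, reassoc_of% @sC_nat, reassoc_of% @sA_sB_w1, reassoc_of% @sA_natp_w1,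
        h.sA_act, reassoc_of% @sB_nat_w1]

theorem yB_coact (h : IsCrossedModule H a c) (k : IsCrossedModule H b d) (Z : C) :
    yB Z a d ≫ tC Z d c = tC Z c d ≫ yB Z a d ▷ H := by
  calc
    _ = sC (Z ⊗ X) d ≫ sB Z X Y ▷ H ≫ (sC ((Z ⊗ Y) ⊗ X) Δ[H] ≫ sB (Z ⊗ Y) X H ▷ H ≫
      sA ((Z ⊗ Y) ⊗ H) a ≫ sC ((Z ⊗ Y) ⊗ H) c ≫ sB (Z ⊗ Y) H X ▷ H ≫ sA ((Z ⊗ Y) ⊗ X) μ[H]) := by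
      simp only [tC, yB, Category.assoc]
      rw [← reassoc_of% @sC_nat, ← reassoc_of% @sA_nat]
      simp only [reassoc_of% @sB_sCp_w1, reassoc_of% k.sC_coact, reassoc_of% @sC_nat]
    _ = _ := by
      rw [h.s_compat]
      simp only [reassoc_of% @sC_nat, reassoc_of% @sB_sC_w2, reassoc_of% @sB_nat_w1, tC, yB,
        comp_whiskerRight, Category.assoc, reassoc_of% @sA_nat', sA_nat', reassoc_of% @sB_sCp_w1,
        reassoc_of% @sC_nat_w1, reassoc_of% k.sC_coact]

theorem yB_hexagon (h : IsCrossedModule H a c) {W : C} (e : W ⟶ W ⊗ H) (Z : C) :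
    tC (Z ⊗ X) d e ≫ sB Z X Y ▷ W ▷ H ≫ sB (Z ⊗ Y) X W ▷ H ≫ sA ((Z ⊗ Y) ⊗ W) a =
      yB Z a d ▷ W ≫ yB (Z ⊗ Y) a e := by
  simp only [tC, Category.assoc, reassoc_of% @sA_nat', yB, comp_whiskerRight, reassoc_of% @sC_nat,
    reassoc_of% @sA_sB_w1, h.sA_act, reassoc_of% @sB_nat_w1]

theorem yB_hexagon' {W : C} {q : W ⊗ H ⟶ W} {e : W ⟶ W ⊗ H} (h : IsCrossedModule H q e) (Z : C) :
    sC ((Z ⊗ X) ⊗ Y) e ≫ sB (Z ⊗ X) Y W ▷ H ≫ sB Z X W ▷ Y ▷ H ≫ tA (Z ⊗ W) a b =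
      yB (Z ⊗ X) b e ≫ yB Z a e ▷ Y := by
  simp only [tA, reassoc_of% @sC_nat, reassoc_of% @sB_nat_w1, yB, comp_whiskerRight,
    Category.assoc, reassoc_of% @sA_nat', sA_nat', reassoc_of% @sB_sCp_w1, reassoc_of% h.sC_coact]


theorem yBr_act (h : IsCrossedModule H a c) (k : IsCrossedModule H b d) :
    tensorAct a b ≫ yBr X a d = yBr X a d ▷ H ≫ tensorAct b a := by
  have e := yB_act h k (𝟙_ C)
  simp only [← sX_yBr, tA_eq] at e
  apply whiskerLeft_inj
  simp only [sA, sX, Category.assoc, comp_whiskerRight, Iso.inv_hom_id_assoc,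
    inv_hom_whiskerRight_assoc, cancel_epi, whisker_assoc] at e
  simpa only [← Category.assoc, cancel_mono, whiskerLeft_comp] using e

theorem yBr_coact (h : IsCrossedModule H a c) (k : IsCrossedModule H b d) :
    yBr X a d ≫ tensorCoact d c = tensorCoact c d ≫ yBr X a d ▷ H := by
  have e := yB_coact h k (𝟙_ C)
  simp only [← sX_yBr, tC_eq] at e
  apply whiskerLeft_inj
  simp [sC, sX] at e ⊢
  simpa only [← Category.assoc, cancel_mono] using e

open BraidedCategory in
theorem yBr_hexagon (h : IsCrossedModule H a c) {W : C} (e : W ⟶ W ⊗ H) :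
    (α_ X Y W).hom ≫ yBr X a (tensorCoact d e) ≫ (α_ Y W X).hom =
      yBr X a d ▷ W ≫ (α_ Y X W).hom ≫ Y ◁ yBr X a e := by
  have q := yB_hexagon (d := d) h e (𝟙_ C)
  calc
    _ = 𝟙 _ ⊗≫ (tC (𝟙_ C ⊗ X) d e ≫ sB (𝟙_ C) X Y ▷ W ▷ H ≫ sB (𝟙_ C ⊗ Y) X W ▷ H ≫
        sA ((𝟙_ C ⊗ Y) ⊗ W) a) ⊗≫ 𝟙 _ := by
      simp only [yBr, tensorCoact, tC, sA, sB, sC, sX, tensorμ, braiding_tensor_right_hom,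
        MonoidalCategory.tensorHom_def']
      monoidal
    _ = _ := by
      rw [q]
      simp only [yB, yBr, sA, sB, sC, sX]
      monoidal

open BraidedCategory in
theorem yBr_hexagon' {W : C} {q : W ⊗ H ⟶ W} {e : W ⟶ W ⊗ H} (h : IsCrossedModule H q e) :
    (α_ X Y W).inv ≫ yBr (X ⊗ Y) (tensorAct a b) e ≫ (α_ W X Y).inv =
      X ◁ yBr Y b e ≫ (α_ X W Y).inv ≫ yBr X a e ▷ Y := by
  have q := yB_hexagon' (a := a) (b := b) h (𝟙_ C)
  calc
    _ = 𝟙 _ ⊗≫ (sC ((𝟙_ C ⊗ X) ⊗ Y) e ≫ sB (𝟙_ C ⊗ X) Y W ▷ H ≫ sB (𝟙_ C) X W ▷ Y ▷ H ≫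
        tA (𝟙_ C ⊗ W) a b) ⊗≫ 𝟙 _ := by
      simp only [yBr, tensorAct, tA, sA, sB, sC, sX, tensorμ, braiding_tensor_left_hom,
        MonoidalCategory.tensorHom_def]
      monoidal
    _ = _ := by
      rw [q]
      simp only [yB, yBr, sA, sB, sC, sX]
      monoidal

theorem yBr_nat {X' Y' : C} {a' : X' ⊗ H ⟶ X'} {d' : Y' ⟶ Y' ⊗ H} {f : X ⟶ X'} {g : Y ⟶ Y'}
    (hf : a ≫ f = f ▷ H ≫ a') (hg : g ≫ d' = d ≫ g ▷ H) :
    (f ⊗ₘ g) ≫ yBr X' a' d' = yBr X a d ≫ (g ⊗ₘ f) := by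
  calc
    _ = 𝟙 _ ⊗≫ f ▷ Y ⊗≫ X' ◁ (g ≫ d') ⊗≫ (β_ X' Y').hom ▷ H ⊗≫ Y' ◁ a' := by
      rw [yBr, MonoidalCategory.tensorHom_def]; monoidal
    _ = 𝟙 _ ⊗≫ (f ▷ Y ≫ X' ◁ d) ⊗≫ (X' ◁ g ≫ (β_ X' Y').hom) ▷ H ⊗≫ Y' ◁ a' := by
      rw [hg]; monoidal
    _ = 𝟙 _ ⊗≫ X ◁ d ⊗≫ (f ▷ Y ≫ (β_ X' Y).hom) ▷ H ⊗≫ (g ▷ (X' ⊗ H) ≫ Y' ◁ a') := by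
      rw [← whisker_exchange, BraidedCategory.braiding_naturality_right]; monoidal
    _ = 𝟙 _ ⊗≫ X ◁ d ⊗≫ (β_ X Y).hom ▷ H ⊗≫ Y ◁ (f ▷ H ≫ a') ⊗≫ g ▷ X' := by
      rw [← whisker_exchange, BraidedCategory.braiding_naturality_left]; monoidal
    _ = _ := by
      rw [← hf, yBr, MonoidalCategory.tensorHom_def']; monoidal

section inverse

variable [IsIso 𝒮[H]]

theorem conv1 : Δ[H] ≫ (β_ H H).inv ≫ (𝟙 H ⊗ₘ inv 𝒮[H]) ≫ μ[H] = ε[H] ≫ η[H] := by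
  rw [← cancel_mono 𝒮[H]]
  simp only [Category.assoc, HopfObj.mul_antipode, HopfObj.one_antipode]
  rw [tensorHom_comp_tensorHom_assoc, ← BraidedCategory.braiding_inv_naturality_assoc]
  simp

theorem conv2 : Δ[H] ≫ (β_ H H).inv ≫ (inv 𝒮[H] ⊗ₘ 𝟙 H) ≫ μ[H] = ε[H] ≫ η[H] := by
  rw [← cancel_mono 𝒮[H]]
  simp only [Category.assoc, HopfObj.mul_antipode, HopfObj.one_antipode]
  rw [tensorHom_comp_tensorHom_assoc, ← BraidedCategory.braiding_inv_naturality_assoc]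
  simp

def phi (a : X ⊗ H ⟶ X) (d : Y ⟶ Y ⊗ H) (f : H ⟶ H) : X ⊗ Y ⟶ X ⊗ Y :=
  X ◁ (d ≫ Y ◁ f ≫ (β_ H Y).inv) ≫ (α_ X H Y).inv ≫ a ▷ Y

open BraidedCategory in
theorem phi_comp (h : IsCrossedModule H a c) (k : IsCrossedModule H b d) (f g : H ⟶ H)
    (w : Δ[H] ≫ (β_ H H).inv ≫ (f ⊗ₘ g) ≫ μ[H] = ε[H] ≫ η[H]) :
    phi a d f ≫ phi a d g = 𝟙 _ := by
  have e : d ≫ Y ◁ f ≫ (β_ H Y).inv ≫ H ◁ (d ≫ Y ◁ g ≫ (β_ H Y).inv) ≫ (α_ H H Y).inv ≫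
      μ[H] ▷ Y = (λ_ Y).inv ≫ η[H] ▷ Y := by
    calc
      _ = d ≫ Y ◁ f ≫ ((β_ H Y).inv ≫ H ◁ d) ≫ H ◁ Y ◁ g ≫ H ◁ (β_ H Y).inv ≫ (α_ H H Y).inv ≫
          μ[H] ▷ Y := by monoidal
      _ = (d ≫ Y ◁ f ≫ d ▷ H) ≫ (β_ H (Y ⊗ H)).inv ≫ H ◁ Y ◁ g ≫ H ◁ (β_ H Y).inv ≫
          (α_ H H Y).inv ≫ μ[H] ▷ Y := by
        rw [← braiding_inv_naturality_left]; simp only [Category.assoc]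
      _ = (d ≫ Y ◁ Δ[H]) ≫ (α_ Y H H).inv ≫ (Y ⊗ H) ◁ f ≫ (Y ◁ g) ▷ H ≫ (β_ H (Y ⊗ H)).inv ≫
          H ◁ (β_ H Y).inv ≫ (α_ H H Y).inv ≫ μ[H] ▷ Y := by
        rw [k.coact_comul, whisker_exchange, ← braiding_inv_naturality_left_assoc]
        simp only [Category.assoc, Iso.hom_inv_id_assoc]
      _ = d ≫ Y ◁ (Δ[H] ≫ (β_ H H).inv ≫ (f ⊗ₘ g) ≫ μ[H]) ≫ (β_ H Y).inv := by
        rw [← braiding_inv_naturality_assoc]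
        simp only [whiskerLeft_comp, Category.assoc]
        rw [braiding_inv_naturality_right, braiding_tensor_right_inv, braiding_tensor_left_inv,
          MonoidalCategory.tensorHom_def']
        monoidal
      _ = _ := by
        rw [w, whiskerLeft_comp, Category.assoc, reassoc_of% k.coact_counit,
          braiding_inv_naturality_right]
        simp
  calc
    _ = 𝟙 _ ⊗≫ X ◁ (d ≫ Y ◁ f ≫ (β_ H Y).inv) ⊗≫
        (a ▷ Y ≫ X ◁ (d ≫ Y ◁ g ≫ (β_ H Y).inv)) ⊗≫ a ▷ Y := by
      simp only [phi]; monoidal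
    _ = 𝟙 _ ⊗≫ X ◁ (d ≫ Y ◁ f ≫ (β_ H Y).inv) ⊗≫
        X ◁ H ◁ (d ≫ Y ◁ g ≫ (β_ H Y).inv) ⊗≫ (a ▷ H ≫ a) ▷ Y := by
      rw [← whisker_exchange]; monoidal
    _ = 𝟙 _ ⊗≫ X ◁ (d ≫ Y ◁ f ≫ (β_ H Y).inv ≫ H ◁ (d ≫ Y ◁ g ≫ (β_ H Y).inv) ≫
      (α_ H H Y).inv ≫ μ[H] ▷ Y) ⊗≫ a ▷ Y := by
      have : a ▷ H ≫ a = (α_ X H H).hom ≫ X ◁ μ[H] ≫ a := by simp [h.act_mul]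
      rw [this]; monoidal
    _ = 𝟙 _ ⊗≫ (X ◁ η[H] ≫ a) ▷ Y ⊗≫ 𝟙 _ := by
      rw [e]; monoidal
    _ = _ := by rw [h.act_one]; monoidal

theorem yBr_eq_phi : yBr X a d = phi a d (𝟙 H) ≫ (β_ X Y).hom := by
  simp only [phi, yBr, Category.assoc, BraidedCategory.braiding_naturality_left]
  simp

noncomputable def yBrInv (X : C) {Y : C} (a : X ⊗ H ⟶ X) (d : Y ⟶ Y ⊗ H) : Y ⊗ X ⟶ X ⊗ Y :=
  (β_ X Y).inv ≫ phi a d (inv 𝒮[H])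

theorem yBr_inv (h : IsCrossedModule H a c) (k : IsCrossedModule H b d) :
    yBr X a d ≫ yBrInv X a d = 𝟙 _ := by
  rw [yBr_eq_phi, yBrInv, Category.assoc, Iso.hom_inv_id_assoc, phi_comp h k _ _ conv1]

theorem yBrInv_hom (h : IsCrossedModule H a c) (k : IsCrossedModule H b d) :
    yBrInv X a d ≫ yBr X a d = 𝟙 _ := by
  rw [yBr_eq_phi, yBrInv, Category.assoc, reassoc_of% phi_comp h k _ _ conv2, Iso.inv_hom_id]

end inverse

end tensor

section unit

variable (H) in
/-- The trivial action. -/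
def unitAct : 𝟙_ C ⊗ H ⟶ 𝟙_ C := (λ_ H).hom ≫ ε[H]

variable (H) in
/-- The trivial coaction. -/
def unitCoact : 𝟙_ C ⟶ 𝟙_ C ⊗ H := η[H] ≫ (λ_ H).inv

theorem IsCrossedModule.unit : IsCrossedModule H (unitAct H) (unitCoact H) where
  act_one := by simp [unitAct, unitors_equal]
  act_mul := by
    simp [unitAct, Bimon.mul_counit, MonoidalCategory.tensorHom_def]
  coact_counit := by simp [unitCoact, unitors_inv_equal]
  coact_comul := by
    calc
      _ = 𝟙 _ ⊗≫ (η[H] ≫ Δ[H]) ⊗≫ 𝟙 _ := by rw [unitCoact]; monoidal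
      _ = _ := by
        rw [Bimon.one_comul, unitCoact, MonoidalCategory.tensorHom_def']
        monoidal
  compat := by
    calc
      _ = 𝟙 _ ⊗≫ (Δ[H] ≫ H ◁ ε[H]) ⊗≫ (H ◁ η[H] ≫ μ[H]) ⊗≫ 𝟙 _ := by
        simp only [braiding_tensorUnit_left, braiding_tensorUnit_right, unitAct, unitCoact]
        monoidal
      _ = 𝟙 _ ⊗≫ (Δ[H] ≫ ε[H] ▷ H) ⊗≫ (η[H] ▷ H ≫ μ[H]) ⊗≫ 𝟙 _ := by
        rw [ComonObj.comul_counit, MonObj.mul_one, ComonObj.counit_comul, MonObj.one_mul]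
        monoidal
      _ = 𝟙 _ ⊗≫ Δ[H] ⊗≫ (ε[H] ▷ 𝟙_ C ≫ 𝟙_ C ◁ η[H]) ▷ H ⊗≫ μ[H] ⊗≫ 𝟙 _ := by
        monoidal
      _ = 𝟙 _ ⊗≫ Δ[H] ⊗≫ ((β_ (𝟙_ C) H).hom ≫ H ◁ η[H]) ▷ H ⊗≫ ε[H] ▷ H ▷ H ⊗≫ μ[H] ⊗≫
          𝟙 _ := by
        rw [← whisker_exchange, braiding_tensorUnit_left]; monoidal
      _ = _ := by
        rw [← BraidedCategory.braiding_naturality_left, tensorμ, unitAct, unitCoact,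
          MonoidalCategory.tensorHom_def', MonoidalCategory.tensorHom_def]
        monoidal

variable {X : C} {b : X ⊗ H ⟶ X} {d : X ⟶ X ⊗ H}

theorem leftUnitor_act : tensorAct (unitAct H) b ≫ (λ_ X).hom = (λ_ X).hom ▷ H ≫ b := by
  rw [tensorAct, unitAct, tensorμ, MonoidalCategory.tensorHom_def]
  calc
    _ = 𝟙 _ ⊗≫ X ◁ Δ[H] ⊗≫ ((β_ X H).hom ≫ ε[H] ▷ X) ▷ H ⊗≫ b := by monoidal
    _ = 𝟙 _ ⊗≫ X ◁ (Δ[H] ≫ ε[H] ▷ H) ⊗≫ (β_ X (𝟙_ C)).hom ▷ H ⊗≫ b := by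
      rw [← BraidedCategory.braiding_naturality_right]; monoidal
    _ = _ := by rw [ComonObj.counit_comul, braiding_tensorUnit_right]; monoidal

theorem leftUnitor_coact :
    (λ_ X).hom ≫ d = tensorCoact (unitCoact H) d ≫ (λ_ X).hom ▷ H := by
  rw [tensorCoact, unitCoact, tensorμ, MonoidalCategory.tensorHom_def']
  symm
  calc
    _ = 𝟙 _ ⊗≫ d ⊗≫ (η[H] ▷ X ≫ (β_ H X).hom) ▷ H ⊗≫ X ◁ μ[H] := by monoidal
    _ = 𝟙 _ ⊗≫ d ⊗≫ (β_ (𝟙_ C) X).hom ▷ H ⊗≫ X ◁ (η[H] ▷ H ≫ μ[H]) := by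
      rw [BraidedCategory.braiding_naturality_left]; monoidal
    _ = _ := by rw [MonObj.one_mul, braiding_tensorUnit_left]; monoidal

theorem rightUnitor_act : tensorAct b (unitAct H) ≫ (ρ_ X).hom = (ρ_ X).hom ▷ H ≫ b := by
  rw [tensorAct, unitAct, tensorμ, MonoidalCategory.tensorHom_def', braiding_tensorUnit_left]
  calc
    _ = 𝟙 _ ⊗≫ X ◁ (Δ[H] ≫ H ◁ ε[H]) ⊗≫ b := by monoidal
    _ = _ := by rw [ComonObj.comul_counit]; monoidal

theorem rightUnitor_coact :
    (ρ_ X).hom ≫ d = tensorCoact d (unitCoact H) ≫ (ρ_ X).hom ▷ H := by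
  rw [tensorCoact, unitCoact, tensorμ, MonoidalCategory.tensorHom_def, braiding_tensorUnit_right]
  symm
  calc
    _ = 𝟙 _ ⊗≫ d ⊗≫ X ◁ (H ◁ η[H] ≫ μ[H]) := by monoidal
    _ = _ := by rw [MonObj.mul_one]; monoidal

end unit

end CM


/-- A right crossed module over the Hopf algebra `H`. -/
structure CrossedModule {C : Type u} [Category.{v} C] [MonoidalCategory C] [BraidedCategory C]
    (H : C) [HopfObj H] where
  X : C
  act : X ⊗ H ⟶ X
  coact : X ⟶ X ⊗ H
  isCrossedModule : IsCrossedModule H act coact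

namespace CrossedModule

variable {C : Type u} [Category.{v} C] [MonoidalCategory C] [BraidedCategory C]
  {H : C} [HopfObj H]

/-- Morphisms of `C` which are both module and comodule maps. -/
@[ext]
structure Hom (M N : CrossedModule H) where
  hom : M.X ⟶ N.X
  act_hom : M.act ≫ hom = hom ▷ H ≫ N.act
  hom_coact : hom ≫ N.coact = M.coact ≫ hom ▷ H

instance : Category (CrossedModule H) where
  Hom M N := Hom M N
  id M := ⟨𝟙 M.X, by simp, by simp⟩
  comp f g := ⟨f.hom ≫ g.hom, by simp [reassoc_of% f.act_hom, g.act_hom],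
    by simp [reassoc_of% f.hom_coact, g.hom_coact]⟩

@[ext]
theorem hom_ext {M N : CrossedModule H} {f g : M ⟶ N} (h : f.hom = g.hom) : f = g :=
  Hom.ext h

@[simp]
theorem id_hom (M : CrossedModule H) : Hom.hom (𝟙 M) = 𝟙 M.X := rfl

@[simp]
theorem comp_hom {M N P : CrossedModule H} (f : M ⟶ N) (g : N ⟶ P) :
    (f ≫ g).hom = f.hom ≫ g.hom := rfl

def mkIso {M N : CrossedModule H} (e : M.X ≅ N.X) (h : M.act ≫ e.hom = e.hom ▷ H ≫ N.act)
    (h' : e.hom ≫ N.coact = M.coact ≫ e.hom ▷ H) : M ≅ N where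
  hom := ⟨e.hom, h, h'⟩
  inv := ⟨e.inv, by rw [Iso.comp_inv_eq, Category.assoc, h]; simp,
    by rw [Iso.inv_comp_eq, reassoc_of% h']; simp⟩

variable (H) in
@[simps]
def forget : CrossedModule H ⥤ C where
  obj M := M.X
  map f := f.hom

instance : (forget H).Faithful where
  map_injective h := hom_ext h

def tensor (M N : CrossedModule H) : CrossedModule H :=
  ⟨M.X ⊗ N.X, tensorAct M.act N.act, tensorCoact M.coact N.coact,
    M.isCrossedModule.tensor N.isCrossedModule⟩

def tensorHom {M N M' N' : CrossedModule H} (f : M ⟶ M') (g : N ⟶ N') :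
    tensor M N ⟶ tensor M' N' :=
  ⟨f.hom ⊗ₘ g.hom, tensorAct_hom f.act_hom g.act_hom, tensorCoact_hom f.hom_coact g.hom_coact⟩

theorem whiskerLeft_act (M : CrossedModule H) {N N' : CrossedModule H} (g : N ⟶ N') :
    tensorAct M.act N.act ≫ M.X ◁ g.hom = (M.X ◁ g.hom) ▷ H ≫ tensorAct M.act N'.act := by
  have := tensorAct_hom (a := M.act) (a' := M.act) (f := 𝟙 M.X) (by simp) g.act_hom
  simpa only [id_tensorHom] using this

theorem whiskerLeft_coact (M : CrossedModule H) {N N' : CrossedModule H} (g : N ⟶ N') :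
    M.X ◁ g.hom ≫ tensorCoact M.coact N'.coact =
      tensorCoact M.coact N.coact ≫ (M.X ◁ g.hom) ▷ H := by
  have := tensorCoact_hom (c := M.coact) (c' := M.coact) (f := 𝟙 M.X) (by simp) g.hom_coact
  simpa only [id_tensorHom] using this

theorem whiskerRight_act {M M' : CrossedModule H} (f : M ⟶ M') (N : CrossedModule H) :
    tensorAct M.act N.act ≫ f.hom ▷ N.X = (f.hom ▷ N.X) ▷ H ≫ tensorAct M'.act N.act := by
  have := tensorAct_hom (b := N.act) (b' := N.act) (g := 𝟙 N.X) f.act_hom (by simp)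
  simpa only [tensorHom_id] using this

theorem whiskerRight_coact {M M' : CrossedModule H} (f : M ⟶ M') (N : CrossedModule H) :
    f.hom ▷ N.X ≫ tensorCoact M'.coact N.coact =
      tensorCoact M.coact N.coact ≫ (f.hom ▷ N.X) ▷ H := by
  have := tensorCoact_hom (d := N.coact) (d' := N.coact) (g := 𝟙 N.X) f.hom_coact (by simp)
  simpa only [tensorHom_id] using this

instance : MonoidalCategoryStruct (CrossedModule H) where
  tensorObj := tensor
  tensorHom := tensorHom
  whiskerLeft M _ _ g := ⟨M.X ◁ g.hom, whiskerLeft_act M g, whiskerLeft_coact M g⟩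
  whiskerRight f N := ⟨f.hom ▷ N.X, whiskerRight_act f N, whiskerRight_coact f N⟩
  tensorUnit := ⟨𝟙_ C, unitAct H, unitCoact H, IsCrossedModule.unit⟩
  associator M N P := mkIso (α_ M.X N.X P.X) (tensorAct_assoc _) (tensorCoact_assoc _)
  leftUnitor M := mkIso (λ_ M.X) leftUnitor_act leftUnitor_coact
  rightUnitor M := mkIso (ρ_ M.X) rightUnitor_act rightUnitor_coact

instance : MonoidalCategory (CrossedModule H) where
  tensorHom_def f g := hom_ext (MonoidalCategory.tensorHom_def f.hom g.hom)
  id_tensorHom_id M N := hom_ext (MonoidalCategory.id_tensorHom_id M.X N.X)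
  tensorHom_comp_tensorHom f g f' g' :=
    hom_ext (MonoidalCategory.tensorHom_comp_tensorHom f.hom g.hom f'.hom g'.hom)
  whiskerLeft_id M N := hom_ext (MonoidalCategory.whiskerLeft_id M.X N.X)
  id_whiskerRight M N := hom_ext (MonoidalCategory.id_whiskerRight M.X N.X)
  associator_naturality f g h :=
    hom_ext (MonoidalCategory.associator_naturality f.hom g.hom h.hom)
  leftUnitor_naturality f := hom_ext (MonoidalCategory.leftUnitor_naturality f.hom)
  rightUnitor_naturality f := hom_ext (MonoidalCategory.rightUnitor_naturality f.hom)
  pentagon M N P Q := hom_ext (MonoidalCategory.pentagon M.X N.X P.X Q.X)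
  triangle M N := hom_ext (MonoidalCategory.triangle M.X N.X)

theorem whiskerLeft_yBr (M : CrossedModule H) {N N' : CrossedModule H} (g : N ⟶ N') :
    M.X ◁ g.hom ≫ yBr M.X M.act N'.coact = yBr M.X M.act N.coact ≫ g.hom ▷ M.X := by
  have := yBr_nat (a := M.act) (a' := M.act) (f := 𝟙 M.X) (by simp) g.hom_coact
  simpa only [id_tensorHom, tensorHom_id] using this

theorem whiskerRight_yBr {M M' : CrossedModule H} (f : M ⟶ M') (N : CrossedModule H) :
    f.hom ▷ N.X ≫ yBr M'.X M'.act N.coact = yBr M.X M.act N.coact ≫ N.X ◁ f.hom := by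
  have := yBr_nat f.act_hom (d := N.coact) (d' := N.coact) (g := 𝟙 N.X) (by simp)
  simpa only [id_tensorHom, tensorHom_id] using this

@[simp]
theorem tensorObj_X (M N : CrossedModule H) : (M ⊗ N).X = M.X ⊗ N.X := rfl

theorem tensorObj_act (M N : CrossedModule H) : (M ⊗ N).act = tensorAct M.act N.act := rfl

theorem tensorObj_coact (M N : CrossedModule H) :
    (M ⊗ N).coact = tensorCoact M.coact N.coact := rfl

@[simp]
theorem tensorUnit_X : (𝟙_ (CrossedModule H)).X = 𝟙_ C := rfl

variable [IsIso 𝒮[H]]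

/-- The category of crossed modules is braided by `yBr`. -/
noncomputable instance : BraidedCategory (CrossedModule H) where
  braiding M N := mkIso
    ⟨yBr M.X M.act N.coact, yBrInv M.X M.act N.coact,
      yBr_inv M.isCrossedModule N.isCrossedModule, yBrInv_hom M.isCrossedModule N.isCrossedModule⟩
    (yBr_act M.isCrossedModule N.isCrossedModule) (yBr_coact M.isCrossedModule N.isCrossedModule)
  braiding_naturality_right M _ _ g := hom_ext (whiskerLeft_yBr M g)
  braiding_naturality_left f N := hom_ext (whiskerRight_yBr f N)
  hexagon_forward M N P := hom_ext (yBr_hexagon M.isCrossedModule P.coact)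
  hexagon_reverse M N P := hom_ext (yBr_hexagon' P.isCrossedModule)

theorem braiding_hom_hom (M N : CrossedModule H) :
    (β_ M N).hom.hom = yBr M.X M.act N.coact := rfl

end CrossedModule

section CrossProduct

variable {C : Type u} [Category.{v} C] [MonoidalCategory C] [BraidedCategory C]
  (A : C) [HopfObj A] [IsIso 𝒮[A]] (B : CrossedModule A) [HopfObj B]

/-! The structure morphisms of the Hopf algebra `B` of crossed modules, as morphisms of `C`. -/

def uOne : 𝟙_ C ⟶ B.X := η[B].hom

def uMul : B.X ⊗ B.X ⟶ B.X := μ[B].hom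

def uCounit : B.X ⟶ 𝟙_ C := ε[B].hom

def uComul : B.X ⟶ B.X ⊗ B.X := Δ[B].hom

def uAntipode : B.X ⟶ B.X := 𝒮[B].hom

/-- The unit of the cross product: `η_A ⊗ η_B`. -/
def crossOne : 𝟙_ C ⟶ A ⊗ B.X :=
  (λ_ (𝟙_ C)).inv ≫ (η[A] ⊗ₘ uOne A B)

/-- The multiplication of the cross product: on `A ⊗ B ⊗ A ⊗ B`, apply `Δ` to the second `A`, move
its first leg past the first `B` by `Ψ_{B,A}`, let the second leg act on the first `B`, and multiply
the two factors `A` and the two factors `B`. -/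
def crossMul : (A ⊗ B.X) ⊗ (A ⊗ B.X) ⟶ A ⊗ B.X :=
  (A ⊗ B.X) ◁ Δ[A] ▷ B.X ⊗≫ A ◁ (β_ B.X A).hom ▷ A ▷ B.X ⊗≫
    A ◁ A ◁ B.act ▷ B.X ⊗≫ (μ[A] ⊗ₘ uMul A B)

/-- The counit of the cross product: `ε_A ⊗ ε_B`. -/
def crossCounit : A ⊗ B.X ⟶ 𝟙_ C :=
  (ε[A] ⊗ₘ uCounit A B) ≫ (λ_ (𝟙_ C)).hom

/-- The comultiplication of the cross product: on `A ⊗ B`, apply `Δ_A ⊗ Δ_B`, let `A` coact on the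
first `B`, move the second `A` past the first `B` by `Ψ_{A,B}`, and multiply the two adjacent factors
`A`. -/
def crossComul : A ⊗ B.X ⟶ (A ⊗ B.X) ⊗ (A ⊗ B.X) :=
  (Δ[A] ⊗ₘ uComul A B) ⊗≫ A ◁ A ◁ B.coact ▷ B.X ⊗≫
    A ◁ (β_ A B.X).hom ▷ A ▷ B.X ⊗≫ (A ⊗ B.X) ◁ μ[A] ▷ B.X

/-- The antipode of the cross product. -/
def crossAntipode : A ⊗ B.X ⟶ A ⊗ B.X :=
  A ◁ B.coact ⊗≫ (β_ A B.X).hom ▷ A ⊗≫ B.X ◁ μ[A] ≫ (uAntipode A B ⊗ₘ 𝒮[A]) ≫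
    B.X ◁ Δ[A] ⊗≫ (β_ B.X A).hom ▷ A ⊗≫ A ◁ B.act

variable {A B}

/-- The action `X ⊗ B ⟶ X` of a crossed module over `B`, as a morphism of `C`. -/
def uAct (X : CrossedModule B) : X.X.X ⊗ B.X ⟶ X.X.X := X.act.hom

/-- The coaction `X ⟶ X ⊗ B` of a crossed module over `B`, as a morphism of `C`. -/
def uCoact (X : CrossedModule B) : X.X.X ⟶ X.X.X ⊗ B.X := X.coact.hom

/-- The action of the cross product on a crossed module over `B`: act by `A`, then by `B`. -/
def crossAct (X : CrossedModule B) : X.X.X ⊗ (A ⊗ B.X) ⟶ X.X.X :=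
  (α_ X.X.X A B.X).inv ≫ X.X.act ▷ B.X ≫ uAct X

/-- The coaction of the cross product on a crossed module over `B`: coact by `B`, then by `A`. -/
def crossCoact (X : CrossedModule B) : X.X.X ⟶ X.X.X ⊗ (A ⊗ B.X) :=
  uCoact X ≫ X.X.coact ▷ B.X ≫ (α_ X.X.X A B.X).hom

theorem crossAct_hom {X Y : CrossedModule B} (f : X ⟶ Y) :
    crossAct X ≫ f.hom.hom = f.hom.hom ▷ (A ⊗ B.X) ≫ crossAct Y := by
  have h1 : uAct X ≫ f.hom.hom = f.hom.hom ▷ B.X ≫ uAct Y :=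
    congrArg CrossedModule.Hom.hom f.act_hom
  have h2 := congrArg (· ▷ B.X) f.hom.act_hom
  simp only [comp_whiskerRight] at h2
  simp only [crossAct, Category.assoc]
  rw [h1, reassoc_of% h2]
  simp

theorem hom_crossCoact {X Y : CrossedModule B} (f : X ⟶ Y) :
    f.hom.hom ≫ crossCoact Y = crossCoact X ≫ f.hom.hom ▷ (A ⊗ B.X) := by
  have h1 : f.hom.hom ≫ uCoact Y = uCoact X ≫ f.hom.hom ▷ B.X :=
    congrArg CrossedModule.Hom.hom f.hom_coact
  have h2 := congrArg (· ▷ B.X) f.hom.hom_coact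
  simp only [comp_whiskerRight] at h2
  simp only [crossCoact, Category.assoc]
  rw [reassoc_of% h1, reassoc_of% h2]
  simp

/-- The functor from crossed modules over `B` in crossed modules over `A` to crossed modules over
the cross product, for a Hopf algebra structure on `A ⊗ B` for which `crossAct` and `crossCoact` are
crossed module structures. It does not change underlying objects and morphisms. -/
def crossFunctor [HopfObj (A ⊗ B.X)]
    (h : ∀ X : CrossedModule B, IsCrossedModule (A ⊗ B.X) (crossAct X) (crossCoact X)) :
    CrossedModule B ⥤ CrossedModule (A ⊗ B.X) where
  obj X := ⟨X.X.X, crossAct X, crossCoact X, h X⟩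
  map f := ⟨f.hom.hom, crossAct_hom f, hom_crossCoact f⟩

end CrossProduct

end Braided

/-!
For an action `a` on `X` and a comultiplication `d` of the object that acts, `twist a d` moves `X`
past that object while acting on `X` by one of the two legs of `d`; similarly for coactions. The
crossed module axiom is an equation between such twists, and so are the bialgebra axiom and the
tensor products of actions and of coactions. Computed in the category of crossed modules over `A`,
where the braiding is itself a twist, the twist for `B` becomes `iterTwist`, and the twist for the
cross product of `A` and `B` is made of twists for `A` and one `iterTwist` for `B`. Hence the axioms
over the cross product follow from those over `A` and over `B`. Conversely, composing them with the
inclusions of the two factors into the cross product and the projections onto them gives back the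
axioms over `A` and over `B`. The braidings agree because both are `iterTwist`.

The identity of the cross product is the convolution product of its projections onto `A` and `B`,
so its convolution inverse, the antipode, is the product of their inverses in the opposite order.
As a morphism this is the composite of a tensor product of two antipodes with two twists, and such
twists are invertible as soon as the antipode of `A` is.
-/

namespace Braided

section Actions

variable {C : Type u} [Category.{v} C] [MonoidalCategory C] {H X Y : C}

/-- `a` is a right action on `X` of an object `H` with unit `e` and multiplication `m`. Nothing is
assumed about `e` and `m`, so this also covers actions of monoids in a category of crossed modules,
seen in the underlying category. -/
structure IsAct (e : 𝟙_ C ⟶ H) (m : H ⊗ H ⟶ H) (a : X ⊗ H ⟶ X) : Prop where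
  one : X ◁ e ≫ a = (ρ_ X).hom
  mul : X ◁ m ≫ a = (α_ X H H).inv ≫ a ▷ H ≫ a

/-- `c` is a right coaction on `X` of an object `H` with counit `f` and comultiplication `d`, the
dual notion to `IsAct`. -/
structure IsCoact (f : H ⟶ 𝟙_ C) (d : H ⟶ H ⊗ H) (c : X ⟶ X ⊗ H) : Prop where
  counit : c ≫ X ◁ f = (ρ_ X).inv
  comul : c ≫ X ◁ d = c ≫ c ▷ H ≫ (α_ X H H).hom

variable (H) in
theorem isAct_mul [MonObj H] : IsAct η[H] μ[H] μ[H] := ⟨MonObj.mul_one H, by simp⟩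

variable (H) in
theorem isCoact_comul [ComonObj H] : IsCoact ε[H] Δ[H] Δ[H] := ⟨ComonObj.comul_counit H, by simp⟩

variable {e : 𝟙_ C ⟶ H} {m : H ⊗ H ⟶ H} {f : H ⟶ 𝟙_ C} {d : H ⟶ H ⊗ H}
  {a : X ⊗ H ⟶ X} {c : X ⟶ X ⊗ H}

theorem IsAct.whiskerRight_comp_self (h : IsAct e m a) :
    a ▷ H ≫ a = (α_ X H H).hom ≫ X ◁ m ≫ a := by
  simp [h.mul]

theorem IsCoact.comp_whiskerRight_self (h : IsCoact f d c) :
    c ≫ c ▷ H = c ≫ X ◁ d ≫ (α_ X H H).inv := by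
  simp [reassoc_of% h.comul]

theorem IsAct.whiskerLeft (h : IsAct e m a) (Z : C) : IsAct e m ((α_ Z X H).hom ≫ Z ◁ a) := by
  constructor
  · calc
      _ = 𝟙 _ ⊗≫ Z ◁ (X ◁ e ≫ a) ⊗≫ 𝟙 _ := by monoidal
      _ = _ := by rw [h.one]; monoidal
  · calc
      _ = 𝟙 _ ⊗≫ Z ◁ (X ◁ m ≫ a) ⊗≫ 𝟙 _ := by monoidal
      _ = _ := by rw [h.mul]; monoidal

theorem IsCoact.whiskerLeft (h : IsCoact f d c) (Z : C) :
    IsCoact f d (Z ◁ c ≫ (α_ Z X H).inv) := by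
  constructor
  · calc
      _ = 𝟙 _ ⊗≫ Z ◁ (c ≫ X ◁ f) ⊗≫ 𝟙 _ := by monoidal
      _ = _ := by rw [h.counit]; monoidal
  · calc
      _ = 𝟙 _ ⊗≫ Z ◁ (c ≫ X ◁ d) ⊗≫ 𝟙 _ := by monoidal
      _ = _ := by rw [h.comul]; monoidal

theorem IsAct.whiskerLeft_tensorHom_comp {P Q : C} (h : IsAct e m a) (x : P ⟶ H) (y : Q ⟶ H) :
    X ◁ ((x ⊗ₘ y) ≫ m) ≫ a = (α_ X P Q).inv ≫ (X ◁ x ≫ a) ▷ Q ≫ X ◁ y ≫ a := by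
  rw [whiskerLeft_comp_assoc, h.mul, MonoidalCategory.tensorHom_def]
  calc
    _ = 𝟙 _ ⊗≫ X ◁ x ▷ Q ⊗≫ ((X ⊗ H) ◁ y ≫ a ▷ H) ≫ a := by monoidal
    _ = _ := by rw [whisker_exchange]; monoidal

theorem IsCoact.comp_whiskerLeft_tensorHom {P Q : C} (h : IsCoact f d c) (x : H ⟶ P)
    (y : H ⟶ Q) :
    c ≫ X ◁ (d ≫ (x ⊗ₘ y)) = (c ≫ X ◁ y) ≫ (c ≫ X ◁ x) ▷ Q ≫ (α_ X P Q).hom := by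
  rw [whiskerLeft_comp, reassoc_of% h.comul, MonoidalCategory.tensorHom_def']
  calc
    _ = c ≫ (c ▷ H ≫ (X ⊗ H) ◁ y) ⊗≫ X ◁ x ▷ Q ⊗≫ 𝟙 _ := by monoidal
    _ = _ := by rw [← whisker_exchange]; monoidal

theorem IsAct.comp {P : C} {e' : 𝟙_ C ⟶ P} {m' : P ⊗ P ⟶ P} {i : P ⟶ H} (h : IsAct e m a)
    (hone : e' ≫ i = e) (hmul : m' ≫ i = (i ⊗ₘ i) ≫ m) : IsAct e' m' (X ◁ i ≫ a) where
  one := by rw [← whiskerLeft_comp_assoc, hone, h.one]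
  mul := by rw [← whiskerLeft_comp_assoc, hmul, h.whiskerLeft_tensorHom_comp]

theorem IsCoact.comp {Q : C} {f' : Q ⟶ 𝟙_ C} {d' : Q ⟶ Q ⊗ Q} {p : H ⟶ Q} (h : IsCoact f d c)
    (hcounit : p ≫ f' = f) (hcomul : p ≫ d' = d ≫ (p ⊗ₘ p)) :
    IsCoact f' d' (c ≫ X ◁ p) where
  counit := by rw [Category.assoc, ← whiskerLeft_comp, hcounit, h.counit]
  comul := by rw [Category.assoc, ← whiskerLeft_comp, hcomul, h.comp_whiskerLeft_tensorHom]

end Actions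

section Twist

variable {C : Type u} [Category.{v} C] [MonoidalCategory C] [BraidedCategory C] {H X Y W : C}

/-- How a module `X` passes a comodule `Y`: coact on `Y`, braid, and let the coefficient act on `X`.
With the action and the coaction of crossed modules this is the braiding of the category of crossed
modules. -/
def twist (a : X ⊗ H ⟶ X) (d : Y ⟶ Y ⊗ H) : X ⊗ Y ⟶ Y ⊗ X :=
  X ◁ d ≫ (α_ X Y H).inv ≫ (β_ X Y).hom ▷ H ≫ (α_ Y X H).hom ≫ Y ◁ a

section Naturality

variable {X' Y' : C} {a : X ⊗ H ⟶ X} {d : Y ⟶ Y ⊗ H} {a' : X' ⊗ H ⟶ X'} {d' : Y' ⟶ Y' ⊗ H}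
  {f : X ⟶ X'} {g : Y ⟶ Y'}

theorem whiskerRight_twist (hf : a ≫ f = f ▷ H ≫ a') (d : Y ⟶ Y ⊗ H) :
    f ▷ Y ≫ twist a' d = twist a d ≫ Y ◁ f := by
  simp only [twist, Category.assoc, ← whiskerLeft_comp, hf]
  calc
    _ = 𝟙 _ ⊗≫ (f ▷ Y ≫ X' ◁ d) ⊗≫ (β_ X' Y).hom ▷ H ⊗≫ Y ◁ a' := by monoidal
    _ = 𝟙 _ ⊗≫ X ◁ d ⊗≫ (f ▷ Y ≫ (β_ X' Y).hom) ▷ H ⊗≫ Y ◁ a' := by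
      rw [← whisker_exchange]; monoidal
    _ = _ := by rw [BraidedCategory.braiding_naturality_left]; monoidal

theorem whiskerLeft_twist (a : X ⊗ H ⟶ X) (hg : g ≫ d' = d ≫ g ▷ H) :
    X ◁ g ≫ twist a d' = twist a d ≫ g ▷ X := by
  simp only [twist, ← whiskerLeft_comp_assoc, hg]
  calc
    _ = 𝟙 _ ⊗≫ X ◁ d ⊗≫ (X ◁ g ≫ (β_ X Y').hom) ▷ H ⊗≫ Y' ◁ a := by monoidal
    _ = 𝟙 _ ⊗≫ X ◁ d ⊗≫ (β_ X Y).hom ▷ H ⊗≫ (g ▷ (X ⊗ H) ≫ Y' ◁ a) := by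
      rw [BraidedCategory.braiding_naturality_right]; monoidal
    _ = _ := by rw [← whisker_exchange]; monoidal

end Naturality

open BraidedCategory in
theorem twist_whiskerLeft_act (a : X ⊗ H ⟶ X) (d : Y ⟶ Y ⊗ H) (Z : C) :
    twist ((α_ Z X H).hom ≫ Z ◁ a) d =
      (α_ Z X Y).hom ≫ Z ◁ twist a d ≫ (α_ Z Y X).inv ≫ (β_ Z Y).hom ▷ X ≫ (α_ Y Z X).hom := by
  calc
    _ = 𝟙 _ ⊗≫ Z ◁ X ◁ d ⊗≫ Z ◁ (β_ X Y).hom ▷ H ⊗≫ ((β_ Z Y).hom ▷ (X ⊗ H) ≫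
        (Y ⊗ Z) ◁ a) ⊗≫ 𝟙 _ := by
      rw [twist, braiding_tensor_left_hom]; monoidal
    _ = _ := by rw [← whisker_exchange, twist]; monoidal

open BraidedCategory in
theorem twist_whiskerLeft_coact (a : X ⊗ H ⟶ X) (d : Y ⟶ Y ⊗ H) (Z : C) :
    twist a (Z ◁ d ≫ (α_ Z Y H).inv) =
      (α_ X Z Y).inv ≫ (β_ X Z).hom ▷ Y ≫ (α_ Z X Y).hom ≫ Z ◁ twist a d ≫ (α_ Z Y X).inv := by
  calc
    _ = 𝟙 _ ⊗≫ ((X ⊗ Z) ◁ d ≫ (β_ X Z).hom ▷ (Y ⊗ H)) ⊗≫ Z ◁ (β_ X Y).hom ▷ H ⊗≫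
        Z ◁ Y ◁ a ⊗≫ 𝟙 _ := by
      rw [twist, braiding_tensor_right_hom]; monoidal
    _ = _ := by rw [whisker_exchange, twist]; monoidal

theorem IsAct.whiskerRight_twist {e : 𝟙_ C ⟶ H} {m : H ⊗ H ⟶ H} {a : X ⊗ H ⟶ X}
    (h : IsAct e m a) (d : Y ⟶ Y ⊗ H) :
    a ▷ Y ≫ twist a d = (α_ X H Y).hom ≫ X ◁ twist m d ≫ (α_ X Y H).inv ≫ (β_ X Y).hom ▷ H ≫
      (α_ Y X H).hom ≫ Y ◁ a := by
  have hm : ((α_ X H H).hom ≫ X ◁ m) ≫ a = a ▷ H ≫ a := by simp [h.whiskerRight_comp_self]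
  rw [Braided.whiskerRight_twist hm, twist_whiskerLeft_act]
  simp only [Category.assoc]

theorem IsCoact.twist_whiskerRight {f : H ⟶ 𝟙_ C} {m : H ⟶ H ⊗ H} {d : Y ⟶ Y ⊗ H}
    (h : IsCoact f m d) (a : X ⊗ H ⟶ X) :
    twist a d ≫ d ▷ X = X ◁ d ≫ (α_ X Y H).inv ≫ (β_ X Y).hom ▷ H ≫ (α_ Y X H).hom ≫
      Y ◁ twist a m ≫ (α_ Y H X).inv := by
  rw [← Braided.whiskerLeft_twist a h.comp_whiskerRight_self.symm, twist_whiskerLeft_coact]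

end Twist

section TwistTensor

variable {C : Type u} [Category.{v} C] [MonoidalCategory C] [BraidedCategory C] {H : C} [HopfObj H]
  {X Y W : C}

theorem tensorAct_eq_twist (a : X ⊗ H ⟶ X) (b : Y ⊗ H ⟶ Y) :
    tensorAct a b = (α_ X Y H).hom ≫ X ◁ twist b Δ[H] ≫ (α_ X H Y).inv ≫ a ▷ Y := by
  rw [tensorAct, tensorμ, twist, MonoidalCategory.tensorHom_def']
  monoidal

theorem tensorCoact_eq_twist (c : X ⟶ X ⊗ H) (d : Y ⟶ Y ⊗ H) :
    tensorCoact c d = c ▷ Y ≫ (α_ X H Y).hom ≫ X ◁ twist μ[H] d ≫ (α_ X Y H).inv := by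
  rw [tensorCoact, tensorμ, twist, MonoidalCategory.tensorHom_def]
  monoidal

open BraidedCategory in
theorem twist_tensorAct (a : X ⊗ H ⟶ X) (b : Y ⊗ H ⟶ Y) {e : W ⟶ W ⊗ H}
    (h : IsCoact ε[H] Δ[H] e) :
    twist (tensorAct a b) e =
      (α_ X Y W).hom ≫ X ◁ twist b e ≫ (α_ X W Y).inv ≫ twist a e ▷ Y ≫ (α_ W X Y).hom := by
  calc
    _ = 𝟙 _ ⊗≫ X ◁ Y ◁ e ⊗≫ X ◁ (β_ Y W).hom ▷ H ⊗≫ ((β_ X W).hom ▷ (Y ⊗ H) ≫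
        (W ⊗ X) ◁ twist b Δ[H]) ⊗≫ W ◁ a ▷ Y ⊗≫ 𝟙 _ := by
      rw [twist, tensorAct_eq_twist, braiding_tensor_left_hom]; monoidal
    _ = 𝟙 _ ⊗≫ X ◁ (Y ◁ e ≫ (α_ Y W H).inv ≫ (β_ Y W).hom ▷ H ≫ (α_ W Y H).hom ≫
        W ◁ twist b Δ[H] ≫ (α_ W H Y).inv) ⊗≫ (β_ X W).hom ▷ H ▷ Y ⊗≫ W ◁ a ▷ Y ⊗≫ 𝟙 _ := by
      rw [← whisker_exchange]; monoidal
    _ = _ := by rw [← h.twist_whiskerRight b, twist.eq_def a]; monoidal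

open BraidedCategory in
theorem twist_tensorCoact {a : X ⊗ H ⟶ X} (h : IsAct η[H] μ[H] a) (d : Y ⟶ Y ⊗ H)
    (e : W ⟶ W ⊗ H) :
    twist a (tensorCoact d e) =
      (α_ X Y W).inv ≫ twist a d ▷ W ≫ (α_ Y X W).hom ≫ Y ◁ twist a e ≫ (α_ Y W X).inv := by
  calc
    _ = 𝟙 _ ⊗≫ X ◁ d ▷ W ⊗≫ ((X ⊗ Y) ◁ twist μ[H] e ≫ (β_ X Y).hom ▷ (W ⊗ H)) ⊗≫
        Y ◁ (β_ X W).hom ▷ H ⊗≫ Y ◁ W ◁ a ⊗≫ 𝟙 _ := by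
      rw [twist, tensorCoact_eq_twist, braiding_tensor_right_hom]; monoidal
    _ = 𝟙 _ ⊗≫ X ◁ d ▷ W ⊗≫ (β_ X Y).hom ▷ H ▷ W ⊗≫ Y ◁ ((α_ X H W).hom ≫
        X ◁ twist μ[H] e ≫ (α_ X W H).inv ≫ (β_ X W).hom ▷ H ≫ (α_ W X H).hom ≫
        W ◁ a) ⊗≫ 𝟙 _ := by
      rw [whisker_exchange]; monoidal
    _ = _ := by rw [← h.whiskerRight_twist e, twist.eq_def a d]; monoidal

end TwistTensor

section CoactTwistAct

variable {C : Type u} [Category.{v} C] [MonoidalCategory C]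

/-- Coact, let `τ` carry the coefficient past the acting object, then act. With a flip `τ` of a
bimonoid this is the right-hand side of the bimonoid axiom and of the crossed module axiom. -/
def coactTwistAct {P Q X : C} (c : X ⟶ X ⊗ Q) (τ : Q ⊗ P ⟶ P ⊗ Q) (a : X ⊗ P ⟶ X) :
    X ⊗ P ⟶ X ⊗ Q :=
  c ▷ P ≫ (α_ X Q P).hom ≫ X ◁ τ ≫ (α_ X P Q).inv ≫ a ▷ Q

theorem whiskerLeft_coactTwistAct_whiskerLeft {P Q H K X : C} {i : P ⟶ H} {p : K ⟶ Q}
    {τ : K ⊗ H ⟶ H ⊗ K} {τ' : Q ⊗ P ⟶ P ⊗ Q} (c : X ⟶ X ⊗ K) (a : X ⊗ H ⟶ X)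
    (hτ : K ◁ i ≫ τ ≫ H ◁ p = p ▷ P ≫ τ' ≫ i ▷ Q) :
    X ◁ i ≫ coactTwistAct c τ a ≫ X ◁ p =
      coactTwistAct (c ≫ X ◁ p) τ' (X ◁ i ≫ a) := by
  calc
    _ = (X ◁ i ≫ c ▷ H) ⊗≫ X ◁ τ ⊗≫ (a ▷ K ≫ X ◁ p) := by rw [coactTwistAct]; monoidal
    _ = c ▷ P ⊗≫ X ◁ (K ◁ i ≫ τ ≫ H ◁ p) ⊗≫ a ▷ Q := by
      rw [whisker_exchange c i, ← whisker_exchange a p]; monoidal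
    _ = _ := by rw [hτ, coactTwistAct]; monoidal

end CoactTwistAct

section CrossedModules

variable {C : Type u} [Category.{v} C] [MonoidalCategory C] [BraidedCategory C]

theorem tensorHom_tensorμ_tensorHom {H P Q X : C} (c : X ⟶ X ⊗ Q) (d : P ⟶ P ⊗ H) (a : X ⊗ P ⟶ X)
    (m : Q ⊗ H ⟶ Q) :
    (c ⊗ₘ d) ≫ tensorμ X Q P H ≫ (a ⊗ₘ m) = coactTwistAct c (twist m d) a := by
  rw [tensorμ, coactTwistAct, twist, MonoidalCategory.tensorHom_def,
    MonoidalCategory.tensorHom_def']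
  monoidal

theorem mul_comul_eq_coactTwistAct (H : C) [BimonObj H] :
    μ[H] ≫ Δ[H] = coactTwistAct Δ[H] (twist μ[H] Δ[H]) μ[H] := by
  rw [BimonObj.mul_comul, tensorHom_tensorμ_tensorHom]

variable {H : C} [HopfObj H] {X Y W : C} {a : X ⊗ H ⟶ X} {c : X ⟶ X ⊗ H}
  {b : Y ⊗ H ⟶ Y} {d : Y ⟶ Y ⊗ H}

theorem isCrossedModule_iff_twist :
    IsCrossedModule H a c ↔ IsAct η[H] μ[H] a ∧ IsCoact ε[H] Δ[H] c ∧
      twist a Δ[H] ≫ twist μ[H] c = coactTwistAct c (twist μ[H] Δ[H]) a := by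
  have hlhs : twist a Δ[H] ≫ twist μ[H] c =
      X ◁ Δ[H] ≫ (α_ X H H).inv ≫ (β_ X H).hom ▷ H ≫ (α_ H X H).hom ≫ H ◁ a ≫
        H ◁ c ≫ (α_ H X H).inv ≫ (β_ H X).hom ▷ H ≫ (α_ X H H).hom ≫ X ◁ μ[H] := by simp [twist]
  rw [hlhs, ← tensorHom_tensorμ_tensorHom]
  exact ⟨fun h ↦ ⟨⟨h.act_one, h.act_mul⟩, ⟨h.coact_counit, h.coact_comul⟩, h.compat⟩,
    fun ⟨ha, hc, h⟩ ↦ ⟨ha.one, ha.mul, hc.counit, hc.comul, h⟩⟩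

theorem IsCrossedModule.isAct (h : IsCrossedModule H a c) : IsAct η[H] μ[H] a :=
  (isCrossedModule_iff_twist.1 h).1

theorem IsCrossedModule.isCoact (h : IsCrossedModule H a c) : IsCoact ε[H] Δ[H] c :=
  (isCrossedModule_iff_twist.1 h).2.1

theorem IsCrossedModule.twist_comp_twist (h : IsCrossedModule H a c) :
    twist a Δ[H] ≫ twist μ[H] c = coactTwistAct c (twist μ[H] Δ[H]) a :=
  (isCrossedModule_iff_twist.1 h).2.2

theorem tensorAct_twist (h : IsAct η[H] μ[H] a) (k : IsCrossedModule H b d) :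
    tensorAct a b ≫ twist a d = twist a d ▷ H ≫ tensorAct b a := by
  calc
    _ = 𝟙 _ ⊗≫ X ◁ (twist b Δ[H] ≫ twist μ[H] d) ⊗≫ (β_ X Y).hom ▷ H ⊗≫ Y ◁ a := by
      rw [tensorAct_eq_twist, Category.assoc, Category.assoc, Category.assoc, h.whiskerRight_twist]
      monoidal
    _ = 𝟙 _ ⊗≫ X ◁ d ▷ H ⊗≫ X ◁ Y ◁ twist μ[H] Δ[H] ⊗≫ (X ◁ b ≫ (β_ X Y).hom) ▷ H ⊗≫ Y ◁ a := by
      rw [k.twist_comp_twist, coactTwistAct]; monoidal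
    _ = 𝟙 _ ⊗≫ X ◁ d ▷ H ⊗≫ ((X ⊗ Y) ◁ twist μ[H] Δ[H] ≫ (β_ X Y).hom ▷ (H ⊗ H)) ⊗≫
        Y ◁ (β_ X H).hom ▷ H ⊗≫ (b ▷ (X ⊗ H) ≫ Y ◁ a) := by
      rw [BraidedCategory.braiding_naturality_right, BraidedCategory.braiding_tensor_right_hom]
      monoidal
    _ = 𝟙 _ ⊗≫ X ◁ d ▷ H ⊗≫ (β_ X Y).hom ▷ H ▷ H ⊗≫ Y ◁ ((α_ X H H).hom ≫ X ◁ twist μ[H] Δ[H] ≫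
        (α_ X H H).inv ≫ (β_ X H).hom ▷ H ≫ (α_ H X H).hom ≫ H ◁ a) ⊗≫ b ▷ X := by
      rw [whisker_exchange, ← whisker_exchange b]; monoidal
    _ = _ := by rw [← h.whiskerRight_twist, twist.eq_def a d, tensorAct_eq_twist]; monoidal

theorem twist_yang_baxter {e : W ⟶ W ⊗ H} (h : IsAct η[H] μ[H] a) (k : IsCrossedModule H b d)
    (l : IsCoact ε[H] Δ[H] e) :
    twist a d ▷ W ≫ (α_ Y X W).hom ≫ Y ◁ twist a e ≫ (α_ Y W X).inv ≫ twist b e ▷ X =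
      (α_ X Y W).hom ≫ X ◁ twist b e ≫ (α_ X W Y).inv ≫ twist a e ▷ Y ≫ (α_ W X Y).hom ≫
        W ◁ twist a d ≫ (α_ W Y X).inv := by
  have hnat := whiskerRight_twist (tensorAct_twist h k) e
  simp only [twist_tensorAct _ _ l, Category.assoc] at hnat
  rw [← cancel_mono (α_ W Y X).hom]
  simp only [Category.assoc, hnat, Iso.inv_hom_id, Category.comp_id]

theorem twist_unitCoact (ha : IsAct η[H] μ[H] a) :
    twist a (unitCoact H) = (ρ_ X).hom ≫ (λ_ X).inv := by
  calc
    _ = 𝟙 _ ⊗≫ (X ◁ η[H] ≫ a) ⊗≫ 𝟙 _ := by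
      rw [twist, unitCoact, braiding_tensorUnit_right]; monoidal
    _ = _ := by rw [ha.one]; monoidal

theorem twist_unitAct (hc : IsCoact ε[H] Δ[H] c) :
    twist (unitAct H) c = (λ_ X).hom ≫ (ρ_ X).inv := by
  calc
    _ = 𝟙 _ ⊗≫ (c ≫ X ◁ ε[H]) ⊗≫ 𝟙 _ := by
      rw [twist, unitAct, braiding_tensorUnit_left]; monoidal
    _ = _ := by rw [hc.counit]; monoidal

theorem whiskerLeft_unit_twist (ha : IsAct η[H] μ[H] a) {e : 𝟙_ C ⟶ Y}
    (he : e ≫ d = unitCoact H ≫ e ▷ H) :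
    X ◁ e ≫ twist a d = (ρ_ X).hom ≫ (λ_ X).inv ≫ e ▷ X := by
  rw [whiskerLeft_twist a he, twist_unitCoact ha, Category.assoc]

theorem twist_counit_whiskerRight (ha : IsAct η[H] μ[H] a) {f : Y ⟶ 𝟙_ C}
    (hf : f ≫ unitCoact H = d ≫ f ▷ H) :
    twist a d ≫ f ▷ X = X ◁ f ≫ (ρ_ X).hom ≫ (λ_ X).inv := by
  rw [← whiskerLeft_twist a hf, twist_unitCoact ha]

theorem unit_whiskerRight_twist (hc : IsCoact ε[H] Δ[H] c) {e : 𝟙_ C ⟶ Y}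
    (he : unitAct H ≫ e = e ▷ H ≫ b) :
    e ▷ X ≫ twist b c = (λ_ X).hom ≫ (ρ_ X).inv ≫ X ◁ e := by
  rw [whiskerRight_twist he, twist_unitAct hc, Category.assoc]

theorem twist_whiskerLeft_counit (hc : IsCoact ε[H] Δ[H] c) {f : Y ⟶ 𝟙_ C}
    (hf : b ≫ f = f ▷ H ≫ unitAct H) :
    twist b c ≫ X ◁ f = f ▷ X ≫ (λ_ X).hom ≫ (ρ_ X).inv := by
  rw [← whiskerRight_twist hf, twist_unitAct hc]

theorem whiskerLeft_one_twist_comul (ha : IsAct η[H] μ[H] a) :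
    X ◁ η[H] ≫ twist a Δ[H] = (ρ_ X).hom ≫ (λ_ X).inv ≫ η[H] ▷ X :=
  whiskerLeft_unit_twist ha (by
    rw [unitCoact, Bimon.one_comul, MonoidalCategory.tensorHom_def']; monoidal)

theorem twist_mul_whiskerLeft_counit (hc : IsCoact ε[H] Δ[H] c) :
    twist μ[H] c ≫ X ◁ ε[H] = ε[H] ▷ X ≫ (λ_ X).hom ≫ (ρ_ X).inv :=
  twist_whiskerLeft_counit hc (by
    rw [unitAct, Bimon.mul_counit, MonoidalCategory.tensorHom_def]; monoidal)

theorem IsAct.tensorAct (ha : IsAct η[H] μ[H] a) (hb : IsAct η[H] μ[H] b) :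
    IsAct η[H] μ[H] (tensorAct a b) := by
  simp only [tensorAct_eq_twist]
  constructor
  · calc
      _ = 𝟙 _ ⊗≫ X ◁ (Y ◁ η[H] ≫ twist b Δ[H]) ⊗≫ a ▷ Y := by monoidal
      _ = 𝟙 _ ⊗≫ (X ◁ η[H] ≫ a) ▷ Y := by rw [whiskerLeft_one_twist_comul hb]; monoidal
      _ = _ := by rw [ha.one]; monoidal
  · have hmul := whiskerLeft_twist b (d := tensorCoact Δ[H] Δ[H]) (d' := Δ[H]) (g := μ[H]) (by
      rw [BimonObj.mul_comul, tensorCoact, MonoidalCategory.tensorHom_def' μ[H] μ[H]]; simp)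
    rw [twist_tensorCoact hb] at hmul
    calc
      _ = 𝟙 _ ⊗≫ X ◁ (Y ◁ μ[H] ≫ twist b Δ[H]) ⊗≫ a ▷ Y := by monoidal
      _ = 𝟙 _ ⊗≫ X ◁ twist b Δ[H] ▷ H ⊗≫ X ◁ H ◁ twist b Δ[H] ⊗≫ (X ◁ μ[H] ≫ a) ▷ Y := by
        rw [hmul]; monoidal
      _ = 𝟙 _ ⊗≫ X ◁ twist b Δ[H] ▷ H ⊗≫ ((X ⊗ H) ◁ twist b Δ[H] ≫ a ▷ (H ⊗ Y)) ⊗≫ a ▷ Y := by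
        rw [ha.mul]; monoidal
      _ = _ := by rw [whisker_exchange]; monoidal

theorem IsCoact.tensorCoact (hc : IsCoact ε[H] Δ[H] c) (hd : IsCoact ε[H] Δ[H] d) :
    IsCoact ε[H] Δ[H] (tensorCoact c d) := by
  simp only [tensorCoact_eq_twist]
  constructor
  · calc
      _ = c ▷ Y ⊗≫ X ◁ (twist μ[H] d ≫ Y ◁ ε[H]) ⊗≫ 𝟙 _ := by monoidal
      _ = (c ≫ X ◁ ε[H]) ▷ Y ⊗≫ 𝟙 _ := by rw [twist_mul_whiskerLeft_counit hd]; monoidal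
      _ = _ := by rw [hc.counit]; monoidal
  · have hcomul := whiskerRight_twist (f := Δ[H]) (a := μ[H]) (a' := Braided.tensorAct μ[H] μ[H])
      (by rw [BimonObj.mul_comul, Braided.tensorAct, MonoidalCategory.tensorHom_def Δ[H] Δ[H]]
          simp) d
    rw [twist_tensorAct _ _ hd] at hcomul
    calc
      _ = c ▷ Y ⊗≫ X ◁ (twist μ[H] d ≫ Y ◁ Δ[H]) ⊗≫ 𝟙 _ := by monoidal
      _ = (c ≫ X ◁ Δ[H]) ▷ Y ⊗≫ X ◁ H ◁ twist μ[H] d ⊗≫ X ◁ twist μ[H] d ▷ H ⊗≫ 𝟙 _ := by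
        rw [← hcomul]; monoidal
      _ = c ▷ Y ⊗≫ (c ▷ (H ⊗ Y) ≫ (X ⊗ H) ◁ twist μ[H] d) ⊗≫ X ◁ twist μ[H] d ▷ H ⊗≫ 𝟙 _ := by
        rw [hc.comul]; monoidal
      _ = _ := by rw [← whisker_exchange]; monoidal

end CrossedModules

section Counits

open BraidedCategory

variable {C : Type u} [Category.{v} C] [MonoidalCategory C] [BraidedCategory C] {H X : C}

theorem twist_comul_counit_whiskerRight [ComonObj H] (a : X ⊗ H ⟶ X) :
    twist a Δ[H] ≫ ε[H] ▷ X = a ≫ (λ_ X).inv := by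
  calc
    _ = 𝟙 _ ⊗≫ X ◁ Δ[H] ⊗≫ (β_ X H).hom ▷ H ⊗≫ (H ◁ a ≫ ε[H] ▷ X) := by rw [twist]; monoidal
    _ = 𝟙 _ ⊗≫ X ◁ Δ[H] ⊗≫ ((β_ X H).hom ≫ ε[H] ▷ X) ▷ H ⊗≫ 𝟙_ C ◁ a := by
      rw [whisker_exchange]; monoidal
    _ = 𝟙 _ ⊗≫ X ◁ (Δ[H] ≫ ε[H] ▷ H) ⊗≫ a ⊗≫ 𝟙 _ := by
      rw [← braiding_naturality_right, braiding_tensorUnit_right]; monoidal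
    _ = _ := by rw [ComonObj.counit_comul]; monoidal

theorem one_whiskerRight_twist_mul [MonObj H] (c : X ⟶ X ⊗ H) :
    η[H] ▷ X ≫ twist μ[H] c = (λ_ X).hom ≫ c := by
  calc
    _ = (η[H] ▷ X ≫ H ◁ c) ⊗≫ (β_ H X).hom ▷ H ⊗≫ X ◁ μ[H] := by rw [twist]; monoidal
    _ = 𝟙_ C ◁ c ⊗≫ (η[H] ▷ X ≫ (β_ H X).hom) ▷ H ⊗≫ X ◁ μ[H] := by
      rw [← whisker_exchange]; monoidal
    _ = 𝟙 _ ⊗≫ c ⊗≫ X ◁ (η[H] ▷ H ≫ μ[H]) := by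
      rw [braiding_naturality_left, braiding_tensorUnit_left]; monoidal
    _ = _ := by rw [MonObj.one_mul]; monoidal

end Counits

section Invertibility

open BraidedCategory

variable {C : Type u} [Category.{v} C] [MonoidalCategory C] [BraidedCategory C] {H : C} [HopfObj H]
  {X Y : C} {a : X ⊗ H ⟶ X} {d : Y ⟶ Y ⊗ H}

/-- Turning a right coaction into a left one by the inverse braiding takes composition to the
opposite convolution. -/
theorem IsCoact.comp_braiding_inv_comp (l : IsCoact ε[H] Δ[H] d) (f g : H ⟶ H) :
    d ≫ Y ◁ f ≫ (β_ H Y).inv ≫ H ◁ (d ≫ Y ◁ g ≫ (β_ H Y).inv) ≫ (α_ H H Y).inv ≫ μ[H] ▷ Y =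
      d ≫ Y ◁ (Δ[H] ≫ (β_ H H).inv ≫ (f ⊗ₘ g) ≫ μ[H]) ≫ (β_ H Y).inv := by
  calc
    _ = d ≫ Y ◁ f ≫ ((β_ H Y).inv ≫ H ◁ d) ≫ H ◁ Y ◁ g ≫ H ◁ (β_ H Y).inv ≫ (α_ H H Y).inv ≫
        μ[H] ▷ Y := by monoidal
    _ = (d ≫ Y ◁ f ≫ d ▷ H) ≫ (β_ H (Y ⊗ H)).inv ≫ H ◁ Y ◁ g ≫ H ◁ (β_ H Y).inv ≫
        (α_ H H Y).inv ≫ μ[H] ▷ Y := by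
      rw [← braiding_inv_naturality_left]; simp only [Category.assoc]
    _ = (d ≫ Y ◁ Δ[H]) ≫ (α_ Y H H).inv ≫ (Y ⊗ H) ◁ f ≫ (Y ◁ g) ▷ H ≫ (β_ H (Y ⊗ H)).inv ≫
        H ◁ (β_ H Y).inv ≫ (α_ H H Y).inv ≫ μ[H] ▷ Y := by
      rw [l.comul, whisker_exchange, ← braiding_inv_naturality_left_assoc]
      simp only [Category.assoc, Iso.hom_inv_id_assoc]
    _ = _ := by
      rw [← braiding_inv_naturality_assoc]
      simp only [whiskerLeft_comp, Category.assoc]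
      rw [braiding_inv_naturality_right, braiding_tensor_right_inv, braiding_tensor_left_inv,
        MonoidalCategory.tensorHom_def']
      monoidal

theorem phi_comp_phi (h : IsAct η[H] μ[H] a) (l : IsCoact ε[H] Δ[H] d) (f g : H ⟶ H) :
    phi a d f ≫ phi a d g = phi a d (Δ[H] ≫ (β_ H H).inv ≫ (f ⊗ₘ g) ≫ μ[H]) := by
  calc
    _ = 𝟙 _ ⊗≫ X ◁ (d ≫ Y ◁ f ≫ (β_ H Y).inv) ⊗≫
        (a ▷ Y ≫ X ◁ (d ≫ Y ◁ g ≫ (β_ H Y).inv)) ⊗≫ a ▷ Y := by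
      simp only [phi]; monoidal
    _ = 𝟙 _ ⊗≫ X ◁ (d ≫ Y ◁ f ≫ (β_ H Y).inv) ⊗≫
        X ◁ H ◁ (d ≫ Y ◁ g ≫ (β_ H Y).inv) ⊗≫ (a ▷ H ≫ a) ▷ Y := by
      rw [← whisker_exchange]; monoidal
    _ = 𝟙 _ ⊗≫ X ◁ (d ≫ Y ◁ f ≫ (β_ H Y).inv ≫ H ◁ (d ≫ Y ◁ g ≫ (β_ H Y).inv) ≫
        (α_ H H Y).inv ≫ μ[H] ▷ Y) ⊗≫ a ▷ Y := by
      rw [h.whiskerRight_comp_self]; monoidal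
    _ = _ := by rw [l.comp_braiding_inv_comp, phi]; monoidal

theorem phi_counit_one (h : IsAct η[H] μ[H] a) (l : IsCoact ε[H] Δ[H] d) :
    phi a d (ε[H] ≫ η[H]) = 𝟙 _ := by
  have hd : d ≫ Y ◁ (ε[H] ≫ η[H]) ≫ (β_ H Y).inv = (λ_ Y).inv ≫ η[H] ▷ Y := by
    rw [whiskerLeft_comp, Category.assoc, reassoc_of% l.counit, braiding_inv_naturality_right]
    simp
  calc
    _ = 𝟙 _ ⊗≫ (X ◁ η[H] ≫ a) ▷ Y ⊗≫ 𝟙 _ := by rw [phi, hd]; monoidal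
    _ = _ := by rw [h.one]; monoidal

theorem isIso_twist [IsIso 𝒮[H]] (h : IsAct η[H] μ[H] a) (l : IsCoact ε[H] Δ[H] d) :
    IsIso (twist a d) := by
  have : IsIso (phi a d (𝟙 H)) := ⟨phi a d (inv 𝒮[H]),
    by rw [phi_comp_phi h l, conv1, phi_counit_one h l],
    by rw [phi_comp_phi h l, conv2, phi_counit_one h l]⟩
  have htwist : twist a d = phi a d (𝟙 H) ≫ (β_ X Y).hom := yBr_eq_phi
  rw [htwist]
  infer_instance

end Invertibility

section Iterated

variable {C : Type u} [Category.{v} C] [MonoidalCategory C]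

/-- The action of `A ⊗ B` that acts by `A` first and by `B` second. -/
def iterAct {A B X : C} (a : X ⊗ A ⟶ X) (a' : X ⊗ B ⟶ X) : X ⊗ (A ⊗ B) ⟶ X :=
  (α_ X A B).inv ≫ a ▷ B ≫ a'

/-- The coaction of `A ⊗ B` that coacts by `B` first and by `A` second. -/
def iterCoact {A B X : C} (c : X ⟶ X ⊗ A) (c' : X ⟶ X ⊗ B) : X ⟶ X ⊗ (A ⊗ B) :=
  c' ≫ c ▷ B ≫ (α_ X A B).hom

/-- The unit of the cross product of `A` and `B` for a unit `e` of `B`. -/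
def smashOne (A : C) [MonObj A] {B : C} (e : 𝟙_ C ⟶ B) : 𝟙_ C ⟶ A ⊗ B :=
  (λ_ (𝟙_ C)).inv ≫ (η[A] ⊗ₘ e)

/-- The counit of the cross product of `A` and `B` for a counit `f` of `B`. -/
def smashCounit (A : C) [ComonObj A] {B : C} (f : B ⟶ 𝟙_ C) : A ⊗ B ⟶ 𝟙_ C :=
  (ε[A] ⊗ₘ f) ≫ (λ_ (𝟙_ C)).hom

variable [BraidedCategory C]

/-- The analogue of `twist` for the actions and coactions of `B`, with `twist` for those of `A`
in place of the braiding. -/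
def iterTwist {A B X Y : C} (a : X ⊗ A ⟶ X) (a' : X ⊗ B ⟶ X) (c : Y ⟶ Y ⊗ A) (c' : Y ⟶ Y ⊗ B) :
    X ⊗ Y ⟶ Y ⊗ X :=
  X ◁ c' ≫ (α_ X Y B).inv ≫ twist a c ▷ B ≫ (α_ Y X B).hom ≫ Y ◁ a'

theorem twist_iterAct_iterCoact {A B X Y : C} (a : X ⊗ A ⟶ X) (a' : X ⊗ B ⟶ X) (c : Y ⟶ Y ⊗ A)
    (c' : Y ⟶ Y ⊗ B) : twist (iterAct a a') (iterCoact c c') = iterTwist a a' c c' := by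
  simp only [twist, iterTwist, iterAct, iterCoact]
  monoidal

end Iterated

section Smash

variable {C : Type u} [Category.{v} C] [MonoidalCategory C] [BraidedCategory C]
  {A B X : C} [HopfObj A]

/-- The multiplication of the cross product of `A` and `B` for an action `b` of `A` on `B` and a
multiplication `m` of `B`. -/
def smashMul (b : B ⊗ A ⟶ B) (m : B ⊗ B ⟶ B) : (A ⊗ B) ⊗ (A ⊗ B) ⟶ A ⊗ B :=
  iterAct (tensorAct μ[A] b) ((α_ A B B).hom ≫ A ◁ m)

/-- The comultiplication of the cross product of `A` and `B` for a coaction `k` of `A` on `B` and a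
comultiplication `d` of `B`. -/
def smashComul (k : B ⟶ B ⊗ A) (d : B ⟶ B ⊗ B) : A ⊗ B ⟶ (A ⊗ B) ⊗ (A ⊗ B) :=
  iterCoact (tensorCoact Δ[A] k) (A ◁ d ≫ (α_ A B B).inv)

variable {e : 𝟙_ C ⟶ B} {m : B ⊗ B ⟶ B} {f : B ⟶ 𝟙_ C} {d : B ⟶ B ⊗ B}
  {b : B ⊗ A ⟶ B} {k : B ⟶ B ⊗ A}
  {a : X ⊗ A ⟶ X} {a' : X ⊗ B ⟶ X} {c : X ⟶ X ⊗ A} {c' : X ⟶ X ⊗ B}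

theorem twist_smashComul (ha : IsAct η[A] μ[A] a) (a' : X ⊗ B ⟶ X) (k : B ⟶ B ⊗ A)
    (d : B ⟶ B ⊗ B) :
    twist (iterAct a a') (smashComul k d) = (α_ X A B).inv ≫ twist a Δ[A] ▷ B ≫ (α_ A X B).hom ≫
      A ◁ iterTwist a a' k d ≫ (α_ A B X).inv := by
  rw [smashComul, twist_iterAct_iterCoact, iterTwist, twist_tensorCoact ha, iterTwist]
  calc
    _ = 𝟙 _ ⊗≫ ((X ⊗ A) ◁ d ≫ twist a Δ[A] ▷ (B ⊗ B)) ⊗≫ A ◁ twist a k ▷ B ⊗≫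
        A ◁ B ◁ a' ⊗≫ 𝟙 _ := by monoidal
    _ = _ := by rw [whisker_exchange]; monoidal

theorem twist_smashMul (hc : IsCoact ε[A] Δ[A] c) (c' : X ⟶ X ⊗ B) (b : B ⊗ A ⟶ B)
    (m : B ⊗ B ⟶ B) :
    twist (smashMul b m) (iterCoact c c') = (α_ A B X).hom ≫ A ◁ iterTwist b m c c' ≫
      (α_ A X B).inv ≫ twist μ[A] c ▷ B ≫ (α_ X A B).hom := by
  rw [smashMul, twist_iterAct_iterCoact, iterTwist, twist_tensorAct _ _ hc, iterTwist]
  calc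
    _ = 𝟙 _ ⊗≫ A ◁ B ◁ c' ⊗≫ A ◁ twist b c ▷ B ⊗≫ (twist μ[A] c ▷ (B ⊗ B) ≫
        (X ⊗ A) ◁ m) ⊗≫ 𝟙 _ := by monoidal
    _ = _ := by rw [← whisker_exchange]; monoidal

theorem twist_smashMul_smashComul (hb : IsAct η[A] μ[A] b) (hk : IsCoact ε[A] Δ[A] k)
    (m : B ⊗ B ⟶ B) (d : B ⟶ B ⊗ B) :
    twist (smashMul b m) (smashComul k d) =
      𝟙 _ ⊗≫ A ◁ twist b Δ[A] ▷ B ⊗≫ twist μ[A] Δ[A] ▷ B ▷ B ⊗≫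
        A ◁ A ◁ iterTwist b m k d ⊗≫ A ◁ twist μ[A] k ▷ B ⊗≫ 𝟙 _ := by
  have hcomul := twist_smashComul ((isAct_mul A).tensorAct hb) ((α_ A B B).hom ≫ A ◁ m) k d
  have hmul := twist_smashMul hk d b m
  rw [smashMul, twist_iterAct_iterCoact] at hmul
  rw [smashMul, hcomul, hmul, twist_tensorAct _ _ (isCoact_comul A)]
  monoidal

theorem IsAct.iterAct (ha : IsAct η[A] μ[A] a) (ha' : IsAct e m a')
    (hlin : Braided.tensorAct a b ≫ a' = a' ▷ A ≫ a) :
    IsAct (smashOne A e) (smashMul b m) (iterAct a a') := by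
  constructor
  · calc
      _ = 𝟙 _ ⊗≫ X ◁ η[A] ⊗≫ ((X ⊗ A) ◁ e ≫ a ▷ B) ≫ a' := by
        rw [smashOne, MonoidalCategory.tensorHom_def, Braided.iterAct]; monoidal
      _ = 𝟙 _ ⊗≫ (X ◁ η[A] ≫ a) ⊗≫ X ◁ e ≫ a' := by rw [whisker_exchange]; monoidal
      _ = _ := by rw [ha.one, ha'.one]; monoidal
  · simp only [tensorAct_eq_twist, Category.assoc] at hlin
    simp only [Braided.iterAct, smashMul, tensorAct_eq_twist]
    calc
      _ = 𝟙 _ ⊗≫ X ◁ A ◁ twist b Δ[A] ▷ B ⊗≫ X ◁ μ[A] ▷ (B ⊗ B) ⊗≫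
          ((X ⊗ A) ◁ m ≫ a ▷ B) ⊗≫ a' := by
        monoidal
      _ = 𝟙 _ ⊗≫ X ◁ A ◁ twist b Δ[A] ▷ B ⊗≫ (X ◁ μ[A] ≫ a) ▷ (B ⊗ B) ⊗≫ X ◁ m ≫ a' := by
        rw [whisker_exchange]; monoidal
      _ = 𝟙 _ ⊗≫ ((X ⊗ A) ◁ twist b Δ[A] ≫ a ▷ (A ⊗ B)) ▷ B ⊗≫ a ▷ B ▷ B ⊗≫ a' ▷ B ≫ a' := by
        rw [ha.mul, ha'.mul]; monoidal
      _ = 𝟙 _ ⊗≫ a ▷ B ▷ A ▷ B ⊗≫ ((α_ X B A).hom ≫ X ◁ twist b Δ[A] ≫ (α_ X A B).inv ≫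
          a ▷ B ≫ a') ▷ B ⊗≫ a' := by
        rw [whisker_exchange]; monoidal
      _ = _ := by rw [hlin]; monoidal

theorem IsCoact.iterCoact (hc : IsCoact ε[A] Δ[A] c) (hc' : IsCoact f d c')
    (hcolin : c' ≫ Braided.tensorCoact c k = c ≫ c' ▷ A) :
    IsCoact (smashCounit A f) (smashComul k d) (iterCoact c c') := by
  constructor
  · calc
      _ = c' ≫ (c ▷ B ≫ (X ⊗ A) ◁ f) ⊗≫ X ◁ ε[A] ⊗≫ 𝟙 _ := by
        rw [smashCounit, MonoidalCategory.tensorHom_def', Braided.iterCoact]; monoidal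
      _ = (c' ≫ X ◁ f) ⊗≫ (c ≫ X ◁ ε[A]) ⊗≫ 𝟙 _ := by rw [← whisker_exchange]; monoidal
      _ = _ := by rw [hc.counit, hc'.counit]; monoidal
  · rw [tensorCoact_eq_twist] at hcolin
    simp only [Braided.iterCoact, smashComul, tensorCoact_eq_twist]
    calc
      _ = c' ⊗≫ (c ▷ B ≫ (X ⊗ A) ◁ d) ⊗≫ X ◁ Δ[A] ▷ (B ⊗ B) ⊗≫
          X ◁ A ◁ twist μ[A] k ▷ B ⊗≫ 𝟙 _ := by
        monoidal
      _ = (c' ≫ X ◁ d) ⊗≫ (c ≫ X ◁ Δ[A]) ▷ (B ⊗ B) ⊗≫ X ◁ A ◁ twist μ[A] k ▷ B ⊗≫ 𝟙 _ := by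
        rw [← whisker_exchange]; monoidal
      _ = c' ≫ c' ▷ B ⊗≫ c ▷ B ▷ B ⊗≫ (c ▷ (A ⊗ B) ≫ (X ⊗ A) ◁ twist μ[A] k) ▷ B ⊗≫ 𝟙 _ := by
        rw [hc.comul, hc'.comul]; monoidal
      _ = c' ⊗≫ (c' ≫ c ▷ B ≫ (α_ X A B).hom ≫ X ◁ twist μ[A] k ≫ (α_ X B A).inv) ▷ B ⊗≫
          c ▷ B ▷ A ▷ B ⊗≫ 𝟙 _ := by
        rw [← whisker_exchange]; monoidal
      _ = _ := by rw [hcolin]; monoidal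

theorem coactTwistAct_smash (hb : IsAct η[A] μ[A] b) (hk : IsCoact ε[A] Δ[A] k)
    (m : B ⊗ B ⟶ B) (d : B ⟶ B ⊗ B) (a : X ⊗ A ⟶ X) (a' : X ⊗ B ⟶ X) (c : X ⟶ X ⊗ A)
    (c' : X ⟶ X ⊗ B) :
    coactTwistAct (iterCoact c c') (twist (smashMul b m) (smashComul k d)) (iterAct a a') =
      𝟙 _ ⊗≫ c' ▷ A ▷ B ⊗≫ X ◁ twist b Δ[A] ▷ B ⊗≫ (X ⊗ A) ◁ iterTwist b m k d ⊗≫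
        coactTwistAct c (twist μ[A] Δ[A]) a ▷ B ▷ B ⊗≫ X ◁ twist μ[A] k ▷ B ⊗≫
        a' ▷ A ▷ B ⊗≫ 𝟙 _ := by
  symm
  calc
    _ = 𝟙 _ ⊗≫ c' ▷ A ▷ B ⊗≫ X ◁ twist b Δ[A] ▷ B ⊗≫
        ((X ⊗ A) ◁ iterTwist b m k d ≫ c ▷ A ▷ (B ⊗ B)) ⊗≫ X ◁ twist μ[A] Δ[A] ▷ B ▷ B ⊗≫
        (a ▷ (A ⊗ B) ≫ X ◁ twist μ[A] k) ▷ B ⊗≫ a' ▷ A ▷ B ⊗≫ 𝟙 _ := by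
      rw [coactTwistAct]; monoidal
    _ = 𝟙 _ ⊗≫ c' ▷ A ▷ B ⊗≫ (X ◁ twist b Δ[A] ≫ c ▷ (A ⊗ B)) ▷ B ⊗≫
        (X ⊗ A ⊗ A) ◁ iterTwist b m k d ⊗≫ X ◁ twist μ[A] Δ[A] ▷ (B ⊗ B) ⊗≫
        (X ⊗ A) ◁ twist μ[A] k ▷ B ⊗≫ a ▷ B ▷ A ▷ B ⊗≫ a' ▷ A ▷ B ⊗≫ 𝟙 _ := by
      rw [← whisker_exchange, whisker_exchange (c ▷ A)]; monoidal
    _ = 𝟙 _ ⊗≫ c' ▷ A ▷ B ⊗≫ c ▷ B ▷ A ▷ B ⊗≫ (X ⊗ A) ◁ twist b Δ[A] ▷ B ⊗≫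
        X ◁ ((A ⊗ A) ◁ iterTwist b m k d ≫ twist μ[A] Δ[A] ▷ (B ⊗ B)) ⊗≫
        (X ⊗ A) ◁ twist μ[A] k ▷ B ⊗≫ a ▷ B ▷ A ▷ B ⊗≫ a' ▷ A ▷ B ⊗≫ 𝟙 _ := by
      rw [whisker_exchange]; monoidal
    _ = _ := by
      rw [whisker_exchange, coactTwistAct, twist_smashMul_smashComul hb hk, iterAct, iterCoact]
      monoidal

theorem twist_comp_twist_smash (ha : IsAct η[A] μ[A] a) (hc : IsCoact ε[A] Δ[A] c)
    (hb : IsAct η[A] μ[A] b) (hk : IsCoact ε[A] Δ[A] k)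
    (hA : twist a Δ[A] ≫ twist μ[A] c = coactTwistAct c (twist μ[A] Δ[A]) a)
    (hAB : a ≫ c' = c' ▷ A ≫ tensorAct a b) (hBA : a' ≫ c = tensorCoact c k ≫ a' ▷ A)
    (hB : iterTwist a a' k d ≫ iterTwist b m c c' = coactTwistAct c' (iterTwist b m k d) a') :
    twist (iterAct a a') (smashComul k d) ≫ twist (smashMul b m) (iterCoact c c') =
      coactTwistAct (iterCoact c c') (twist (smashMul b m) (smashComul k d)) (iterAct a a') := by
  have hact := whiskerRight_twist hAB Δ[A]
  have hcoact := whiskerLeft_twist μ[A] hBA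
  rw [twist_tensorAct _ _ (isCoact_comul A)] at hact
  rw [twist_tensorCoact (isAct_mul A)] at hcoact
  rw [twist_smashComul ha, twist_smashMul hc, coactTwistAct_smash hb hk, ← hA]
  calc
    _ = 𝟙 _ ⊗≫ twist a Δ[A] ▷ B ⊗≫ A ◁ (iterTwist a a' k d ≫ iterTwist b m c c') ⊗≫
        twist μ[A] c ▷ B ⊗≫ 𝟙 _ := by monoidal
    _ = 𝟙 _ ⊗≫ (twist a Δ[A] ≫ A ◁ c') ▷ B ⊗≫ A ◁ X ◁ iterTwist b m k d ⊗≫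
        (A ◁ a' ≫ twist μ[A] c) ▷ B ⊗≫ 𝟙 _ := by rw [hB, coactTwistAct]; monoidal
    _ = 𝟙 _ ⊗≫ c' ▷ A ▷ B ⊗≫ X ◁ twist b Δ[A] ▷ B ⊗≫ (twist a Δ[A] ▷ (B ⊗ B) ≫
        (A ⊗ X) ◁ iterTwist b m k d) ⊗≫ twist μ[A] c ▷ B ▷ B ⊗≫ X ◁ twist μ[A] k ▷ B ⊗≫
        a' ▷ A ▷ B ⊗≫ 𝟙 _ := by
      rw [← hact, hcoact]; monoidal
    _ = _ := by rw [← whisker_exchange]; monoidal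

theorem act_comp_coact_smash (hb : IsAct η[A] μ[A] b) (hk : IsCoact ε[A] Δ[A] k)
    (hA : a ≫ c = coactTwistAct c (twist μ[A] Δ[A]) a)
    (hAB : a ≫ c' = c' ▷ A ≫ tensorAct a b) (hBA : a' ≫ c = tensorCoact c k ≫ a' ▷ A)
    (hB : a' ≫ c' = coactTwistAct c' (iterTwist b m k d) a') :
    iterAct a a' ≫ iterCoact c c' =
      coactTwistAct (iterCoact c c') (twist (smashMul b m) (smashComul k d)) (iterAct a a') := by
  rw [tensorAct_eq_twist] at hAB
  rw [tensorCoact_eq_twist] at hBA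
  rw [coactTwistAct_smash hb hk, ← hA, iterAct, iterCoact]
  calc
    _ = 𝟙 _ ⊗≫ a ▷ B ≫ (a' ≫ c') ⊗≫ c ▷ B ⊗≫ 𝟙 _ := by monoidal
    _ = 𝟙 _ ⊗≫ (a ≫ c') ▷ B ⊗≫ X ◁ iterTwist b m k d ⊗≫ (a' ≫ c) ▷ B ⊗≫ 𝟙 _ := by
      rw [hB, coactTwistAct]; monoidal
    _ = 𝟙 _ ⊗≫ c' ▷ A ▷ B ⊗≫ X ◁ twist b Δ[A] ▷ B ⊗≫ (a ▷ (B ⊗ B) ≫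
        X ◁ iterTwist b m k d) ⊗≫ c ▷ B ▷ B ⊗≫ X ◁ twist μ[A] k ▷ B ⊗≫ a' ▷ A ▷ B ⊗≫ 𝟙 _ := by
      rw [hAB, hBA]; monoidal
    _ = _ := by rw [← whisker_exchange]; monoidal

end Smash

/-- `b` and `k` make `B` a crossed module over `A`, and `e`, `m`, `f`, `d` make it a bimonoid in the
category of crossed modules; the conditions are stated in the underlying category. -/
structure IsCrossedBimon {C : Type u} [Category.{v} C] [MonoidalCategory C] [BraidedCategory C]
    (A : C) [HopfObj A] {B : C} (b : B ⊗ A ⟶ B) (k : B ⟶ B ⊗ A) (e : 𝟙_ C ⟶ B) (m : B ⊗ B ⟶ B)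
    (f : B ⟶ 𝟙_ C) (d : B ⟶ B ⊗ B) : Prop where
  crossed : IsCrossedModule A b k
  one_mul : e ▷ B ≫ m = (λ_ B).hom
  isAct : IsAct e m m
  counit_comul : d ≫ f ▷ B = (λ_ B).inv
  isCoact : IsCoact f d d
  one_act : unitAct A ≫ e = e ▷ A ≫ b
  one_coact : e ≫ k = unitCoact A ≫ e ▷ A
  mul_act : tensorAct b b ≫ m = m ▷ A ≫ b
  mul_coact : m ≫ k = tensorCoact k k ≫ m ▷ A
  counit_act : b ≫ f = f ▷ A ≫ unitAct A
  counit_coact : f ≫ unitCoact A = k ≫ f ▷ A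
  comul_act : b ≫ d = d ▷ A ≫ tensorAct b b
  comul_coact : d ≫ tensorCoact k k = k ≫ d ▷ A
  mul_comul : m ≫ d = coactTwistAct d (iterTwist b m k d) m
  one_comul : e ≫ d = (λ_ (𝟙_ C)).inv ≫ (e ⊗ₘ e)
  mul_counit : m ≫ f = (f ⊗ₘ f) ≫ (λ_ (𝟙_ C)).hom
  one_counit : e ≫ f = 𝟙 _

section TensorProducts

variable {C : Type u} [Category.{v} C] [MonoidalCategory C] [BraidedCategory C] {A : C} [HopfObj A]
  {X Y Y' W : C}

theorem tensorAct_tensorAct (a : X ⊗ A ⟶ X) (b : Y ⊗ A ⟶ Y) (e : W ⊗ A ⟶ W) :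
    tensorAct (tensorAct a b) e =
      (α_ X Y W).hom ▷ A ≫ tensorAct a (tensorAct b e) ≫ (α_ X Y W).inv := by
  rw [← reassoc_of% tensorAct_assoc e, Iso.hom_inv_id, Category.comp_id]

theorem tensorCoact_tensorCoact (c : X ⟶ X ⊗ A) (d : Y ⟶ Y ⊗ A) (e : W ⟶ W ⊗ A) :
    tensorCoact (tensorCoact c d) e =
      (α_ X Y W).hom ≫ tensorCoact c (tensorCoact d e) ≫ (α_ X Y W).inv ▷ A := by
  rw [reassoc_of% tensorCoact_assoc e, hom_inv_whiskerRight, Category.comp_id]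

theorem tensorAct_whiskerLeft (a : X ⊗ A ⟶ X) {b : Y ⊗ A ⟶ Y} {b' : Y' ⊗ A ⟶ Y'} {g : Y ⟶ Y'}
    (hg : b ≫ g = g ▷ A ≫ b') : tensorAct a b ≫ X ◁ g = (X ◁ g) ▷ A ≫ tensorAct a b' := by
  simpa using tensorAct_hom (a := a) (f := 𝟙 X) (by simp) hg

theorem tensorCoact_whiskerLeft (c : X ⟶ X ⊗ A) {k : Y ⟶ Y ⊗ A} {k' : Y' ⟶ Y' ⊗ A} {g : Y ⟶ Y'}
    (hg : g ≫ k' = k ≫ g ▷ A) : X ◁ g ≫ tensorCoact c k' = tensorCoact c k ≫ (X ◁ g) ▷ A := by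
  simpa using tensorCoact_hom (c := c) (f := 𝟙 X) (by simp) hg

/-- The Yang–Baxter equation makes the tensor product of a Hopf module and a crossed module a Hopf
module. -/
theorem tensorAct_comp_tensorCoact {a : X ⊗ A ⟶ X} {c : X ⟶ X ⊗ A} {b : Y ⊗ A ⟶ Y} {k : Y ⟶ Y ⊗ A}
    (hX : a ≫ c = coactTwistAct c (twist μ[A] Δ[A]) a) (hY : IsCrossedModule A b k) :
    tensorAct a b ≫ tensorCoact c k =
      coactTwistAct (tensorCoact c k) (twist μ[A] Δ[A]) (tensorAct a b) := by
  rw [tensorAct_eq_twist, tensorCoact_eq_twist, coactTwistAct]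
  calc
    _ = 𝟙 _ ⊗≫ X ◁ twist b Δ[A] ⊗≫ (a ≫ c) ▷ Y ⊗≫ X ◁ twist μ[A] k ⊗≫ 𝟙 _ := by monoidal
    _ = 𝟙 _ ⊗≫ (X ◁ twist b Δ[A] ≫ c ▷ (A ⊗ Y)) ⊗≫ X ◁ twist μ[A] Δ[A] ▷ Y ⊗≫
        (a ▷ (A ⊗ Y) ≫ X ◁ twist μ[A] k) ⊗≫ 𝟙 _ := by
      rw [hX, coactTwistAct]; monoidal
    _ = 𝟙 _ ⊗≫ c ▷ (Y ⊗ A) ⊗≫ X ◁ ((α_ A Y A).hom ≫ A ◁ twist b Δ[A] ≫ (α_ A A Y).inv ≫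
        twist μ[A] Δ[A] ▷ Y ≫ (α_ A A Y).hom ≫ A ◁ twist μ[A] k ≫ (α_ A Y A).inv) ⊗≫
        a ▷ (Y ⊗ A) ⊗≫ 𝟙 _ := by
      rw [whisker_exchange c, ← whisker_exchange a]; monoidal
    _ = _ := by rw [← twist_yang_baxter (isAct_mul A) hY (isCoact_comul A)]; monoidal

end TensorProducts

namespace IsCrossedBimon

variable {C : Type u} [Category.{v} C] [MonoidalCategory C] [BraidedCategory C] {A : C} [HopfObj A]
  {B : C} {b : B ⊗ A ⟶ B} {k : B ⟶ B ⊗ A} {e : 𝟙_ C ⟶ B} {m : B ⊗ B ⟶ B}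
  {f : B ⟶ 𝟙_ C} {d : B ⟶ B ⊗ B}

theorem isAct_smashMul (h : IsCrossedBimon A b k e m f d) :
    IsAct (smashOne A e) (smashMul b m) (smashMul b m) :=
  ((isAct_mul A).tensorAct h.crossed.isAct).iterAct (h.isAct.whiskerLeft A) (by
    rw [reassoc_of% tensorAct_assoc b, tensorAct_whiskerLeft _ h.mul_act, comp_whiskerRight_assoc])

theorem isCoact_smashComul (h : IsCrossedBimon A b k e m f d) :
    IsCoact (smashCounit A f) (smashComul k d) (smashComul k d) :=
  ((isCoact_comul A).tensorCoact h.crossed.isCoact).iterCoact (h.isCoact.whiskerLeft A) (by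
    simp [tensorCoact_tensorCoact, reassoc_of% tensorCoact_whiskerLeft Δ[A] h.comul_coact])

theorem smashOne_whiskerRight_smashMul (h : IsCrossedBimon A b k e m f d) :
    smashOne A e ▷ (A ⊗ B) ≫ smashMul b m = (λ_ (A ⊗ B)).hom := by
  rw [smashOne, smashMul, iterAct, tensorAct_eq_twist, MonoidalCategory.tensorHom_def]
  calc
    _ = 𝟙 _ ⊗≫ η[A] ▷ A ▷ B ⊗≫ A ◁ (e ▷ A ≫ twist b Δ[A]) ▷ B ⊗≫ μ[A] ▷ B ▷ B ⊗≫ A ◁ m := by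
      monoidal
    _ = 𝟙 _ ⊗≫ η[A] ▷ A ▷ B ⊗≫ ((A ⊗ A) ◁ e ≫ μ[A] ▷ B) ▷ B ⊗≫ A ◁ m := by
      rw [unit_whiskerRight_twist (isCoact_comul A) h.one_act]; monoidal
    _ = 𝟙 _ ⊗≫ (η[A] ▷ A ≫ μ[A]) ▷ B ⊗≫ A ◁ (e ▷ B ≫ m) := by rw [whisker_exchange]; monoidal
    _ = _ := by rw [MonObj.one_mul, h.one_mul]; monoidal

theorem smashComul_smashCounit_whiskerRight (h : IsCrossedBimon A b k e m f d) :
    smashComul k d ≫ smashCounit A f ▷ (A ⊗ B) = (λ_ (A ⊗ B)).inv := by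
  rw [smashCounit, smashComul, iterCoact, tensorCoact_eq_twist, MonoidalCategory.tensorHom_def']
  calc
    _ = A ◁ d ⊗≫ Δ[A] ▷ B ▷ B ⊗≫ A ◁ (twist μ[A] k ≫ f ▷ A) ▷ B ⊗≫ ε[A] ▷ A ▷ B ⊗≫ 𝟙 _ := by
      monoidal
    _ = A ◁ d ⊗≫ (Δ[A] ▷ B ≫ (A ⊗ A) ◁ f) ▷ B ⊗≫ ε[A] ▷ A ▷ B ⊗≫ 𝟙 _ := by
      rw [twist_counit_whiskerRight (isAct_mul A) h.counit_coact]; monoidal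
    _ = A ◁ (d ≫ f ▷ B) ⊗≫ (Δ[A] ≫ ε[A] ▷ A) ▷ B ⊗≫ 𝟙 _ := by rw [← whisker_exchange]; monoidal
    _ = _ := by rw [ComonObj.counit_comul, h.counit_comul]; monoidal

theorem smashMul_smashComul (h : IsCrossedBimon A b k e m f d) :
    smashMul b m ≫ smashComul k d =
      coactTwistAct (smashComul k d) (twist (smashMul b m) (smashComul k d)) (smashMul b m) := by
  refine act_comp_coact_smash (m := m) (d := d) h.crossed.isAct h.crossed.isCoact
    (tensorAct_comp_tensorCoact (mul_comul_eq_coactTwistAct A) h.crossed) ?_ ?_ ?_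
  · rw [reassoc_of% tensorAct_whiskerLeft _ h.comul_act, tensorAct_tensorAct]
    simp
  · rw [Category.assoc, tensorCoact_whiskerLeft _ h.mul_coact, reassoc_of% tensorCoact_assoc,
      comp_whiskerRight]
  · calc
      _ = 𝟙 _ ⊗≫ A ◁ (m ≫ d) ⊗≫ 𝟙 _ := by monoidal
      _ = _ := by rw [h.mul_comul]; simp only [coactTwistAct]; monoidal

theorem smashOne_smashComul (h : IsCrossedBimon A b k e m f d) :
    smashOne A e ≫ smashComul k d = (λ_ (𝟙_ C)).inv ≫ (smashOne A e ⊗ₘ smashOne A e) := by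
  rw [smashOne, smashComul, iterCoact, tensorCoact_eq_twist, MonoidalCategory.tensorHom_def η[A] e]
  calc
    _ = 𝟙 _ ⊗≫ η[A] ⊗≫ (A ◁ (e ≫ d) ≫ Δ[A] ▷ (B ⊗ B)) ⊗≫ A ◁ twist μ[A] k ▷ B ⊗≫ 𝟙 _ := by
      monoidal
    _ = 𝟙 _ ⊗≫ (η[A] ≫ Δ[A]) ⊗≫ (A ⊗ A) ◁ (e ≫ d) ⊗≫ A ◁ twist μ[A] k ▷ B ⊗≫ 𝟙 _ := by
      rw [whisker_exchange]; monoidal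
    _ = 𝟙 _ ⊗≫ η[A] ⊗≫ A ◁ η[A] ⊗≫ A ◁ A ◁ e ⊗≫
        A ◁ ((A ⊗ B) ◁ e ≫ twist μ[A] k ▷ B) ⊗≫ 𝟙 _ := by
      rw [h.one_comul, Bimon.one_comul, MonoidalCategory.tensorHom_def η[A] η[A],
        MonoidalCategory.tensorHom_def e e]
      monoidal
    _ = 𝟙 _ ⊗≫ η[A] ⊗≫ A ◁ η[A] ⊗≫ A ◁ (A ◁ e ≫ twist μ[A] k) ⊗≫ A ◁ B ◁ A ◁ e ⊗≫ 𝟙 _ := by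
      rw [whisker_exchange]; monoidal
    _ = 𝟙 _ ⊗≫ η[A] ⊗≫ A ◁ (𝟙_ C ◁ η[A] ≫ e ▷ A) ⊗≫ A ◁ B ◁ A ◁ e ⊗≫ 𝟙 _ := by
      rw [whiskerLeft_unit_twist (isAct_mul A) h.one_coact]; monoidal
    _ = _ := by rw [whisker_exchange, MonoidalCategory.tensorHom_def]; monoidal

theorem smashMul_smashCounit (h : IsCrossedBimon A b k e m f d) :
    smashMul b m ≫ smashCounit A f = (smashCounit A f ⊗ₘ smashCounit A f) ≫ (λ_ (𝟙_ C)).hom := by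
  rw [smashCounit, smashMul, iterAct, tensorAct_eq_twist, MonoidalCategory.tensorHom_def' ε[A] f]
  calc
    _ = 𝟙 _ ⊗≫ A ◁ twist b Δ[A] ▷ B ⊗≫ (μ[A] ▷ (B ⊗ B) ≫ A ◁ (m ≫ f)) ⊗≫ ε[A] ⊗≫ 𝟙 _ := by
      monoidal
    _ = 𝟙 _ ⊗≫ A ◁ twist b Δ[A] ▷ B ⊗≫ (A ⊗ A) ◁ (m ≫ f) ⊗≫ (μ[A] ≫ ε[A]) ⊗≫ 𝟙 _ := by
      rw [← whisker_exchange]; monoidal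
    _ = 𝟙 _ ⊗≫ A ◁ (twist b Δ[A] ▷ B ≫ (A ⊗ B) ◁ f) ⊗≫ A ◁ A ◁ f ⊗≫ A ◁ ε[A] ⊗≫ ε[A] ⊗≫ 𝟙 _ := by
      rw [h.mul_counit, Bimon.mul_counit, MonoidalCategory.tensorHom_def' ε[A] ε[A],
        MonoidalCategory.tensorHom_def' f f]
      monoidal
    _ = 𝟙 _ ⊗≫ A ◁ B ◁ A ◁ f ⊗≫ A ◁ (twist b Δ[A] ≫ A ◁ f) ⊗≫ A ◁ ε[A] ⊗≫ ε[A] ⊗≫ 𝟙 _ := by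
      rw [← whisker_exchange]; monoidal
    _ = 𝟙 _ ⊗≫ A ◁ B ◁ A ◁ f ⊗≫ A ◁ (f ▷ A ≫ 𝟙_ C ◁ ε[A]) ⊗≫ ε[A] ⊗≫ 𝟙 _ := by
      rw [twist_whiskerLeft_counit (isCoact_comul A) h.counit_act]; monoidal
    _ = _ := by rw [← whisker_exchange, MonoidalCategory.tensorHom_def']; monoidal

theorem smashOne_smashCounit (h : IsCrossedBimon A b k e m f d) :
    smashOne A e ≫ smashCounit A f = 𝟙 _ := by
  rw [smashOne, smashCounit, Category.assoc, tensorHom_comp_tensorHom_assoc, h.one_counit,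
    BimonObj.one_counit]
  simp

end IsCrossedBimon

section Factors

variable {C : Type u} [Category.{v} C] [MonoidalCategory C] {A B X : C}

/-- The inclusion of the first factor of a cross product in which `e` is the unit of `B`. -/
def smashInl (A : C) (e : 𝟙_ C ⟶ B) : A ⟶ A ⊗ B := (ρ_ A).inv ≫ A ◁ e

/-- The inclusion of the second factor of a cross product. -/
def smashInr (A B : C) [MonObj A] : B ⟶ A ⊗ B := (λ_ B).inv ≫ η[A] ▷ B

/-- The projection to the first factor of a cross product in which `f` is the counit of `B`. -/
def smashFst (A : C) (f : B ⟶ 𝟙_ C) : A ⊗ B ⟶ A := A ◁ f ≫ (ρ_ A).hom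

/-- The projection to the second factor of a cross product. -/
def smashSnd (A B : C) [ComonObj A] : A ⊗ B ⟶ B := ε[A] ▷ B ≫ (λ_ B).hom

theorem whiskerLeft_smashInl_iterAct {e : 𝟙_ C ⟶ B} {m : B ⊗ B ⟶ B} (a : X ⊗ A ⟶ X)
    {a' : X ⊗ B ⟶ X} (h : IsAct e m a') : X ◁ smashInl A e ≫ iterAct a a' = a := by
  calc
    _ = 𝟙 _ ⊗≫ ((X ⊗ A) ◁ e ≫ a ▷ B) ≫ a' := by rw [smashInl, iterAct]; monoidal
    _ = 𝟙 _ ⊗≫ a ⊗≫ (X ◁ e ≫ a') := by rw [whisker_exchange]; monoidal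
    _ = _ := by rw [h.one]; monoidal

theorem whiskerLeft_smashInr_iterAct [MonObj A] {a : X ⊗ A ⟶ X} (h : IsAct η[A] μ[A] a)
    (a' : X ⊗ B ⟶ X) : X ◁ smashInr A B ≫ iterAct a a' = a' := by
  calc
    _ = 𝟙 _ ⊗≫ (X ◁ η[A] ≫ a) ▷ B ⊗≫ a' := by rw [smashInr, iterAct]; monoidal
    _ = _ := by rw [h.one]; monoidal

theorem iterCoact_whiskerLeft_smashFst {f : B ⟶ 𝟙_ C} {d : B ⟶ B ⊗ B} (c : X ⟶ X ⊗ A)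
    {c' : X ⟶ X ⊗ B} (h : IsCoact f d c') : iterCoact c c' ≫ X ◁ smashFst A f = c := by
  calc
    _ = c' ≫ (c ▷ B ≫ (X ⊗ A) ◁ f) ⊗≫ 𝟙 _ := by rw [smashFst, iterCoact]; monoidal
    _ = (c' ≫ X ◁ f) ⊗≫ c ⊗≫ 𝟙 _ := by rw [← whisker_exchange]; monoidal
    _ = _ := by rw [h.counit]; monoidal

theorem iterCoact_whiskerLeft_smashSnd [ComonObj A] {c : X ⟶ X ⊗ A} (h : IsCoact ε[A] Δ[A] c)
    (c' : X ⟶ X ⊗ B) : iterCoact c c' ≫ X ◁ smashSnd A B = c' := by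
  calc
    _ = c' ⊗≫ (c ≫ X ◁ ε[A]) ▷ B ⊗≫ 𝟙 _ := by rw [smashSnd, iterCoact]; monoidal
    _ = _ := by rw [h.counit]; monoidal

theorem one_smashInl [MonObj A] (e : 𝟙_ C ⟶ B) : η[A] ≫ smashInl A e = smashOne A e := by
  rw [smashInl, smashOne, MonoidalCategory.tensorHom_def]; monoidal

theorem one_smashInr [MonObj A] (e : 𝟙_ C ⟶ B) : e ≫ smashInr A B = smashOne A e := by
  rw [smashInr, smashOne, MonoidalCategory.tensorHom_def']; monoidal

theorem smashFst_counit [ComonObj A] (f : B ⟶ 𝟙_ C) : smashFst A f ≫ ε[A] = smashCounit A f := by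
  rw [smashFst, smashCounit, MonoidalCategory.tensorHom_def']; monoidal

theorem smashSnd_counit [ComonObj A] (f : B ⟶ 𝟙_ C) : smashSnd A B ≫ f = smashCounit A f := by
  rw [smashSnd, smashCounit, MonoidalCategory.tensorHom_def]; monoidal

end Factors

namespace IsCrossedBimon

variable {C : Type u} [Category.{v} C] [MonoidalCategory C] [BraidedCategory C] {A : C} [HopfObj A]
  {B : C} {b : B ⊗ A ⟶ B} {k : B ⟶ B ⊗ A} {e : 𝟙_ C ⟶ B} {m : B ⊗ B ⟶ B}
  {f : B ⟶ 𝟙_ C} {d : B ⟶ B ⊗ B}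

theorem whiskerLeft_smashInl_smashMul (h : IsCrossedBimon A b k e m f d) :
    (A ⊗ B) ◁ smashInl A e ≫ smashMul b m = tensorAct μ[A] b :=
  whiskerLeft_smashInl_iterAct _ (h.isAct.whiskerLeft A)

theorem whiskerLeft_smashInr_smashMul (h : IsCrossedBimon A b k e m f d) :
    (A ⊗ B) ◁ smashInr A B ≫ smashMul b m = (α_ A B B).hom ≫ A ◁ m :=
  whiskerLeft_smashInr_iterAct ((isAct_mul A).tensorAct h.crossed.isAct) _

theorem smashComul_whiskerLeft_smashFst (h : IsCrossedBimon A b k e m f d) :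
    smashComul k d ≫ (A ⊗ B) ◁ smashFst A f = tensorCoact Δ[A] k :=
  iterCoact_whiskerLeft_smashFst _ (h.isCoact.whiskerLeft A)

theorem smashComul_whiskerLeft_smashSnd (h : IsCrossedBimon A b k e m f d) :
    smashComul k d ≫ (A ⊗ B) ◁ smashSnd A B = A ◁ d ≫ (α_ A B B).inv :=
  iterCoact_whiskerLeft_smashSnd ((isCoact_comul A).tensorCoact h.crossed.isCoact) _

theorem smashInl_smashInl_smashMul (h : IsCrossedBimon A b k e m f d) :
    (smashInl A e ⊗ₘ smashInl A e) ≫ smashMul b m = μ[A] ≫ smashInl A e := by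
  rw [MonoidalCategory.tensorHom_def, Category.assoc, h.whiskerLeft_smashInl_smashMul,
    tensorAct_eq_twist, smashInl]
  calc
    _ = 𝟙 _ ⊗≫ A ◁ (e ▷ A ≫ twist b Δ[A]) ⊗≫ μ[A] ▷ B := by monoidal
    _ = 𝟙 _ ⊗≫ ((A ⊗ A) ◁ e ≫ μ[A] ▷ B) := by
      rw [unit_whiskerRight_twist (isCoact_comul A) h.one_act]; monoidal
    _ = _ := by rw [whisker_exchange]; monoidal

theorem smashInl_smashInr_smashMul (h : IsCrossedBimon A b k e m f d) :
    (smashInl A e ⊗ₘ smashInr A B) ≫ smashMul b m = 𝟙 _ := by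
  rw [MonoidalCategory.tensorHom_def, Category.assoc, h.whiskerLeft_smashInr_smashMul, smashInl]
  calc
    _ = 𝟙 _ ⊗≫ A ◁ (e ▷ B ≫ m) := by monoidal
    _ = _ := by rw [h.one_mul]; monoidal

theorem smashInr_smashInl_smashMul (h : IsCrossedBimon A b k e m f d) :
    (smashInr A B ⊗ₘ smashInl A e) ≫ smashMul b m = twist b Δ[A] := by
  rw [MonoidalCategory.tensorHom_def, Category.assoc, h.whiskerLeft_smashInl_smashMul,
    tensorAct_eq_twist, smashInr]
  calc
    _ = 𝟙 _ ⊗≫ (η[A] ▷ (B ⊗ A) ≫ A ◁ twist b Δ[A]) ⊗≫ μ[A] ▷ B := by monoidal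
    _ = 𝟙 _ ⊗≫ twist b Δ[A] ⊗≫ (η[A] ▷ A ≫ μ[A]) ▷ B := by rw [← whisker_exchange]; monoidal
    _ = _ := by rw [MonObj.one_mul]; monoidal

theorem smashInr_smashInr_smashMul (h : IsCrossedBimon A b k e m f d) :
    (smashInr A B ⊗ₘ smashInr A B) ≫ smashMul b m = m ≫ smashInr A B := by
  rw [MonoidalCategory.tensorHom_def, Category.assoc, h.whiskerLeft_smashInr_smashMul, smashInr]
  calc
    _ = 𝟙 _ ⊗≫ (η[A] ▷ (B ⊗ B) ≫ A ◁ m) := by monoidal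
    _ = _ := by rw [← whisker_exchange]; monoidal

theorem smashComul_smashFst_smashFst (h : IsCrossedBimon A b k e m f d) :
    smashComul k d ≫ (smashFst A f ⊗ₘ smashFst A f) = smashFst A f ≫ Δ[A] := by
  rw [MonoidalCategory.tensorHom_def', reassoc_of% h.smashComul_whiskerLeft_smashFst,
    tensorCoact_eq_twist, smashFst]
  calc
    _ = Δ[A] ▷ B ⊗≫ A ◁ (twist μ[A] k ≫ f ▷ A) ⊗≫ 𝟙 _ := by monoidal
    _ = (Δ[A] ▷ B ≫ (A ⊗ A) ◁ f) ⊗≫ 𝟙 _ := by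
      rw [twist_counit_whiskerRight (isAct_mul A) h.counit_coact]; monoidal
    _ = _ := by rw [← whisker_exchange]; monoidal

theorem smashComul_smashFst_smashSnd (h : IsCrossedBimon A b k e m f d) :
    smashComul k d ≫ (smashFst A f ⊗ₘ smashSnd A B) = 𝟙 _ := by
  rw [MonoidalCategory.tensorHom_def', reassoc_of% h.smashComul_whiskerLeft_smashSnd, smashFst]
  calc
    _ = A ◁ (d ≫ f ▷ B) ⊗≫ 𝟙 _ := by monoidal
    _ = _ := by rw [h.counit_comul]; monoidal

theorem smashComul_smashSnd_smashFst (h : IsCrossedBimon A b k e m f d) :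
    smashComul k d ≫ (smashSnd A B ⊗ₘ smashFst A f) = twist μ[A] k := by
  rw [MonoidalCategory.tensorHom_def', reassoc_of% h.smashComul_whiskerLeft_smashFst,
    tensorCoact_eq_twist, smashSnd]
  calc
    _ = Δ[A] ▷ B ⊗≫ (A ◁ twist μ[A] k ≫ ε[A] ▷ (B ⊗ A)) ⊗≫ 𝟙 _ := by monoidal
    _ = (Δ[A] ≫ ε[A] ▷ A) ▷ B ⊗≫ twist μ[A] k ⊗≫ 𝟙 _ := by rw [whisker_exchange]; monoidal
    _ = _ := by rw [ComonObj.counit_comul]; monoidal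

theorem smashComul_smashSnd_smashSnd (h : IsCrossedBimon A b k e m f d) :
    smashComul k d ≫ (smashSnd A B ⊗ₘ smashSnd A B) = smashSnd A B ≫ d := by
  rw [MonoidalCategory.tensorHom_def', reassoc_of% h.smashComul_whiskerLeft_smashSnd, smashSnd]
  calc
    _ = (A ◁ d ≫ ε[A] ▷ (B ⊗ B)) ⊗≫ 𝟙 _ := by monoidal
    _ = _ := by rw [whisker_exchange]; monoidal

end IsCrossedBimon

section Convolution

variable {C : Type u} [Category.{v} C] [MonoidalCategory C] {M N : C}

/-- The convolution product of two morphisms with respect to a comultiplication `d` of the source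
and a multiplication `m` of the target. -/
def conv (d : M ⟶ M ⊗ M) (m : N ⊗ N ⟶ N) (g h : M ⟶ N) : M ⟶ N := d ≫ (g ⊗ₘ h) ≫ m

theorem conv_comp {P Q R T : C} (d : M ⟶ M ⊗ M) (m : N ⊗ N ⟶ N) (x : M ⟶ P) (y : P ⟶ R)
    (z : R ⟶ N) (x' : M ⟶ Q) (y' : Q ⟶ T) (z' : T ⟶ N) :
    conv d m (x ≫ y ≫ z) (x' ≫ y' ≫ z') = (d ≫ (x ⊗ₘ x')) ≫ (y ⊗ₘ y') ≫ (z ⊗ₘ z') ≫ m := by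
  simp only [conv, ← tensorHom_comp_tensorHom, Category.assoc]

theorem conv_comp_self {P R : C} {d : M ⟶ M ⊗ M} {m : N ⊗ N ⟶ N} {d' : P ⟶ P ⊗ P}
    {m' : R ⊗ R ⟶ R} {x : M ⟶ P} {z : R ⟶ N} (hx : d ≫ (x ⊗ₘ x) = x ≫ d')
    (hz : (z ⊗ₘ z) ≫ m = m' ≫ z) (y y' : P ⟶ R) :
    conv d m (x ≫ y ≫ z) (x ≫ y' ≫ z) = x ≫ conv d' m' y y' ≫ z := by
  rw [conv_comp, hx, hz, conv]
  simp only [Category.assoc]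

theorem conv_conv_eq_counit_comp_one [ComonObj M] [MonObj N] {u u' v v' : M ⟶ N}
    (hu : conv Δ[M] μ[N] u' u = ε[M] ≫ η[N]) (hv : conv Δ[M] μ[N] v' v = ε[M] ≫ η[N]) :
    conv Δ[M] μ[N] (conv Δ[M] μ[N] v' u') (conv Δ[M] μ[N] u v) = ε[M] ≫ η[N] := by
  let toConv : (M ⟶ N) → Conv M N := id
  have toConv_conv (g h : M ⟶ N) : toConv (conv Δ[M] μ[N] g h) = toConv g * toConv h :=
    congrArg (Δ[M] ≫ ·) (MonoidalCategory.tensorHom_def_assoc g h μ[N])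
  have hu' : toConv u' * toConv u = 1 := (toConv_conv u' u).symm.trans hu
  have hv' : toConv v' * toConv v = 1 := (toConv_conv v' v).symm.trans hv
  calc
    _ = toConv v' * toConv u' * (toConv u * toConv v) :=
      (toConv_conv _ _).trans (congrArg₂ (· * ·) (toConv_conv v' u') (toConv_conv u v))
    _ = 1 := by rw [mul_assoc, ← mul_assoc (toConv u'), hu', _root_.one_mul, hv']

end Convolution

section Antipode

variable {C : Type u} [Category.{v} C] [MonoidalCategory C] [BraidedCategory C]
  {A B : C} [HopfObj A]

/-- The antipode of the cross product of `A` and `B` for an antipode `s` of `B`. -/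
def smashAntipode (b : B ⊗ A ⟶ B) (k : B ⟶ B ⊗ A) (s : B ⟶ B) : A ⊗ B ⟶ A ⊗ B :=
  twist μ[A] k ≫ (s ⊗ₘ 𝒮[A]) ≫ twist b Δ[A]

end Antipode

namespace IsCrossedBimon

variable {C : Type u} [Category.{v} C] [MonoidalCategory C] [BraidedCategory C] {A : C} [HopfObj A]
  {B : C} {b : B ⊗ A ⟶ B} {k : B ⟶ B ⊗ A} {e : 𝟙_ C ⟶ B} {m : B ⊗ B ⟶ B}
  {f : B ⟶ 𝟙_ C} {d : B ⟶ B ⊗ B}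

/-- The cross product of `A` and `B` as a bimonoid. -/
@[reducible]
def bimonObj (h : IsCrossedBimon A b k e m f d) : BimonObj (A ⊗ B) where
  one := smashOne A e
  mul := smashMul b m
  one_mul := h.smashOne_whiskerRight_smashMul
  mul_one := h.isAct_smashMul.one
  mul_assoc := by rw [h.isAct_smashMul.mul, Iso.hom_inv_id_assoc]
  counit := smashCounit A f
  comul := smashComul k d
  counit_comul := h.smashComul_smashCounit_whiskerRight
  comul_counit := h.isCoact_smashComul.counit
  comul_assoc := h.isCoact_smashComul.comul
  mul_comul := by rw [tensorHom_tensorμ_tensorHom, h.smashMul_smashComul]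
  one_comul := h.smashOne_smashComul
  mul_counit := h.smashMul_smashCounit
  one_counit := h.smashOne_smashCounit

theorem conv_smashFst_smashInl (h : IsCrossedBimon A b k e m f d) {g g' : A ⟶ A}
    (hg : conv Δ[A] μ[A] g g' = ε[A] ≫ η[A]) :
    conv (smashComul k d) (smashMul b m) (smashFst A f ≫ g ≫ smashInl A e)
      (smashFst A f ≫ g' ≫ smashInl A e) = smashCounit A f ≫ smashOne A e := by
  rw [conv_comp_self h.smashComul_smashFst_smashFst h.smashInl_smashInl_smashMul, hg,
    ← smashFst_counit f, ← one_smashInl e]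
  simp only [Category.assoc]

theorem conv_smashSnd_smashInr (h : IsCrossedBimon A b k e m f d) {g g' : B ⟶ B}
    (hg : conv d m g g' = f ≫ e) :
    conv (smashComul k d) (smashMul b m) (smashSnd A B ≫ g ≫ smashInr A B)
      (smashSnd A B ≫ g' ≫ smashInr A B) = smashCounit A f ≫ smashOne A e := by
  rw [conv_comp_self h.smashComul_smashSnd_smashSnd h.smashInr_smashInr_smashMul, hg,
    ← smashSnd_counit f, ← one_smashInr e]
  simp only [Category.assoc]

theorem conv_smashFst_smashSnd (h : IsCrossedBimon A b k e m f d) :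
    conv (smashComul k d) (smashMul b m) (smashFst A f ≫ 𝟙 A ≫ smashInl A e)
      (smashSnd A B ≫ 𝟙 B ≫ smashInr A B) = 𝟙 (A ⊗ B) := by
  rw [conv_comp, h.smashComul_smashFst_smashSnd, h.smashInl_smashInr_smashMul]
  simp

theorem conv_smashSnd_smashFst (h : IsCrossedBimon A b k e m f d) (s : B ⟶ B) :
    conv (smashComul k d) (smashMul b m) (smashSnd A B ≫ s ≫ smashInr A B)
      (smashFst A f ≫ 𝒮[A] ≫ smashInl A e) = smashAntipode b k s := by
  rw [conv_comp, h.smashComul_smashSnd_smashFst, h.smashInr_smashInl_smashMul, smashAntipode]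

theorem smashAntipode_left (h : IsCrossedBimon A b k e m f d) {s : B ⟶ B}
    (hs : d ≫ s ▷ B ≫ m = f ≫ e) :
    smashComul k d ≫ smashAntipode b k s ▷ (A ⊗ B) ≫ smashMul b m =
      smashCounit A f ≫ smashOne A e := by
  have hA := h.conv_smashFst_smashInl (g := 𝒮[A]) (g' := 𝟙 A) (by simp [conv])
  have hB := h.conv_smashSnd_smashInr (g := s) (g' := 𝟙 B) (by simpa [conv] using hs)
  let _ := h.bimonObj
  rw [← tensorHom_id]
  exact (congrArg₂ (conv (smashComul k d) (smashMul b m)) (h.conv_smashSnd_smashFst s)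
    h.conv_smashFst_smashSnd).symm.trans (conv_conv_eq_counit_comp_one hA hB)

theorem smashAntipode_right (h : IsCrossedBimon A b k e m f d) {s : B ⟶ B}
    (hs : d ≫ B ◁ s ≫ m = f ≫ e) :
    smashComul k d ≫ (A ⊗ B) ◁ smashAntipode b k s ≫ smashMul b m =
      smashCounit A f ≫ smashOne A e := by
  have hA := h.conv_smashFst_smashInl (g := 𝟙 A) (g' := 𝒮[A]) (by simp [conv])
  have hB := h.conv_smashSnd_smashInr (g := 𝟙 B) (g' := s) (by simpa [conv] using hs)
  let _ := h.bimonObj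
  rw [← id_tensorHom]
  exact (congrArg₂ (conv (smashComul k d) (smashMul b m)) h.conv_smashFst_smashSnd
    (h.conv_smashSnd_smashFst s)).symm.trans (conv_conv_eq_counit_comp_one hB hA)

/-- The cross product of `A` and `B` as a Hopf monoid. -/
@[reducible]
def hopfObj (h : IsCrossedBimon A b k e m f d) {s : B ⟶ B} (hs : d ≫ s ▷ B ≫ m = f ≫ e)
    (hs' : d ≫ B ◁ s ≫ m = f ≫ e) : HopfObj (A ⊗ B) where
  toBimonObj := h.bimonObj
  antipode := smashAntipode b k s
  antipode_left := h.smashAntipode_left hs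
  antipode_right := h.smashAntipode_right hs'

theorem isIso_smashAntipode [IsIso 𝒮[A]] (h : IsCrossedBimon A b k e m f d) (s : B ⟶ B)
    [IsIso s] : IsIso (smashAntipode b k s) := by
  have := isIso_twist (isAct_mul A) h.crossed.isCoact
  have := isIso_twist h.crossed.isAct (isCoact_comul A)
  rw [smashAntipode]
  infer_instance

end IsCrossedBimon

section IterTwist

variable {C : Type u} [Category.{v} C] [MonoidalCategory C] [BraidedCategory C]

theorem whiskerLeft_iterTwist {A B X Y Y' : C} (a : X ⊗ A ⟶ X) (a' : X ⊗ B ⟶ X) {k : Y ⟶ Y ⊗ A}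
    {d : Y ⟶ Y ⊗ B} {k' : Y' ⟶ Y' ⊗ A} {d' : Y' ⟶ Y' ⊗ B} {g : Y ⟶ Y'}
    (hk : g ≫ k' = k ≫ g ▷ A) (hd : g ≫ d' = d ≫ g ▷ B) :
    X ◁ g ≫ iterTwist a a' k' d' = iterTwist a a' k d ≫ g ▷ X := by
  calc
    _ = X ◁ (g ≫ d') ⊗≫ twist a k' ▷ B ⊗≫ Y' ◁ a' := by rw [iterTwist]; monoidal
    _ = X ◁ d ⊗≫ (X ◁ g ≫ twist a k') ▷ B ⊗≫ Y' ◁ a' := by rw [hd]; monoidal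
    _ = X ◁ d ⊗≫ twist a k ▷ B ⊗≫ (g ▷ (X ⊗ B) ≫ Y' ◁ a') := by
      rw [whiskerLeft_twist a hk]; monoidal
    _ = _ := by rw [← whisker_exchange, iterTwist]; monoidal

end IterTwist

section Factors

variable {C : Type u} [Category.{v} C] [MonoidalCategory C] {A B : C}

theorem smashInl_smashFst {e : 𝟙_ C ⟶ B} {f : B ⟶ 𝟙_ C} (h : e ≫ f = 𝟙 _) :
    smashInl A e ≫ smashFst A f = 𝟙 A := by
  calc
    _ = 𝟙 _ ⊗≫ A ◁ (e ≫ f) ⊗≫ 𝟙 _ := by rw [smashInl, smashFst]; monoidal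
    _ = _ := by rw [h]; monoidal

theorem smashInl_smashSnd [ComonObj A] (e : 𝟙_ C ⟶ B) :
    smashInl A e ≫ smashSnd A B = ε[A] ≫ e := by
  calc
    _ = 𝟙 _ ⊗≫ (A ◁ e ≫ ε[A] ▷ B) ⊗≫ 𝟙 _ := by rw [smashInl, smashSnd]; monoidal
    _ = _ := by rw [whisker_exchange]; monoidal

theorem smashInr_smashFst [MonObj A] (f : B ⟶ 𝟙_ C) :
    smashInr A B ≫ smashFst A f = f ≫ η[A] := by
  calc
    _ = 𝟙 _ ⊗≫ (η[A] ▷ B ≫ A ◁ f) ⊗≫ 𝟙 _ := by rw [smashInr, smashFst]; monoidal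
    _ = _ := by rw [← whisker_exchange]; monoidal

theorem smashInr_comul [MonObj A] (d : B ⟶ B ⊗ B) :
    smashInr A B ≫ A ◁ d ≫ (α_ A B B).inv = d ≫ smashInr A B ▷ B := by
  calc
    _ = 𝟙 _ ⊗≫ (η[A] ▷ B ≫ A ◁ d) ⊗≫ 𝟙 _ := by rw [smashInr]; monoidal
    _ = _ := by rw [← whisker_exchange, smashInr]; monoidal

variable [BraidedCategory C]

theorem smashInr_smashSnd (A B : C) [BimonObj A] : smashInr A B ≫ smashSnd A B = 𝟙 B := by
  calc
    _ = 𝟙 _ ⊗≫ (η[A] ≫ ε[A]) ▷ B ⊗≫ 𝟙 _ := by rw [smashInr, smashSnd]; monoidal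
    _ = _ := by rw [BimonObj.one_counit]; monoidal

variable [HopfObj A]

theorem tensorAct_smashFst {b : B ⊗ A ⟶ B} {f : B ⟶ 𝟙_ C} (hf : b ≫ f = f ▷ A ≫ unitAct A) :
    tensorAct μ[A] b ≫ smashFst A f = smashFst A f ▷ A ≫ μ[A] := by
  rw [smashFst, reassoc_of% tensorAct_whiskerLeft μ[A] hf, rightUnitor_act, comp_whiskerRight,
    Category.assoc]

theorem tensorAct_smashSnd (b : B ⊗ A ⟶ B) :
    tensorAct μ[A] b ≫ smashSnd A B = smashSnd A B ▷ A ≫ b := by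
  have hcounit : μ[A] ≫ ε[A] = ε[A] ▷ A ≫ unitAct A := by
    rw [unitAct, Bimon.mul_counit, MonoidalCategory.tensorHom_def]; monoidal
  have hwhisker : tensorAct μ[A] b ≫ ε[A] ▷ B = (ε[A] ▷ B) ▷ A ≫ tensorAct (unitAct A) b := by
    simpa using tensorAct_hom hcounit (g := 𝟙 B) (by simp)
  rw [smashSnd, reassoc_of% hwhisker, leftUnitor_act, comp_whiskerRight, Category.assoc]

theorem smashInr_tensorCoact (k : B ⟶ B ⊗ A) :
    smashInr A B ≫ tensorCoact Δ[A] k = k ≫ smashInr A B ▷ A := by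
  have hone : η[A] ≫ Δ[A] = unitCoact A ≫ η[A] ▷ A := by
    rw [unitCoact, Bimon.one_comul, MonoidalCategory.tensorHom_def']; monoidal
  have hwhisker : η[A] ▷ B ≫ tensorCoact Δ[A] k = tensorCoact (unitCoact A) k ≫ (η[A] ▷ B) ▷ A := by
    simpa using tensorCoact_hom hone (g := 𝟙 B) (by simp)
  rw [smashInr, Category.assoc, hwhisker, Iso.inv_comp_eq, comp_whiskerRight,
    reassoc_of% leftUnitor_coact, ← comp_whiskerRight_assoc, Iso.hom_inv_id, id_whiskerRight,
    Category.id_comp]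

end Factors

namespace IsCrossedBimon

variable {C : Type u} [Category.{v} C] [MonoidalCategory C] [BraidedCategory C] {A : C} [HopfObj A]
  {B : C} {b : B ⊗ A ⟶ B} {k : B ⟶ B ⊗ A} {e : 𝟙_ C ⟶ B} {m : B ⊗ B ⟶ B}
  {f : B ⟶ 𝟙_ C} {d : B ⟶ B ⊗ B} {X : C} {a : X ⊗ A ⟶ X} {a' : X ⊗ B ⟶ X} {c : X ⟶ X ⊗ A}
  {c' : X ⟶ X ⊗ B}

theorem whiskerLeft_one_iterTwist (h : IsCrossedBimon A b k e m f d) (ha : IsAct η[A] μ[A] a)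
    (ha' : IsAct e m a') : X ◁ e ≫ iterTwist a a' k d = (ρ_ X).hom ≫ (λ_ X).inv ≫ e ▷ X := by
  calc
    _ = X ◁ (e ≫ d) ⊗≫ twist a k ▷ B ⊗≫ B ◁ a' := by rw [iterTwist]; monoidal
    _ = 𝟙 _ ⊗≫ X ◁ e ⊗≫ ((X ⊗ B) ◁ e ≫ twist a k ▷ B) ⊗≫ B ◁ a' := by
      rw [h.one_comul, MonoidalCategory.tensorHom_def]; monoidal
    _ = 𝟙 _ ⊗≫ (X ◁ e ≫ twist a k) ⊗≫ B ◁ (X ◁ e ≫ a') := by rw [whisker_exchange]; monoidal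
    _ = _ := by rw [whiskerLeft_unit_twist ha h.one_coact, ha'.one]; monoidal

theorem iterTwist_whiskerLeft_counit (h : IsCrossedBimon A b k e m f d)
    (hc : IsCoact ε[A] Δ[A] c) (hc' : IsCoact f d c') :
    iterTwist b m c c' ≫ X ◁ f = f ▷ X ≫ (λ_ X).hom ≫ (ρ_ X).inv := by
  calc
    _ = B ◁ c' ⊗≫ twist b c ▷ B ⊗≫ X ◁ (m ≫ f) := by rw [iterTwist]; monoidal
    _ = B ◁ c' ⊗≫ (twist b c ▷ B ≫ (X ⊗ B) ◁ f) ⊗≫ X ◁ f ⊗≫ 𝟙 _ := by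
      rw [h.mul_counit, MonoidalCategory.tensorHom_def']; monoidal
    _ = B ◁ (c' ≫ X ◁ f) ⊗≫ (twist b c ≫ X ◁ f) ⊗≫ 𝟙 _ := by rw [← whisker_exchange]; monoidal
    _ = _ := by rw [twist_whiskerLeft_counit hc h.counit_act, hc'.counit]; monoidal

theorem iterTwist_counit_whiskerRight (h : IsCrossedBimon A b k e m f d)
    (ha : IsAct η[A] μ[A] a) (a' : X ⊗ B ⟶ X) :
    iterTwist a a' k d ≫ f ▷ X = a' ≫ (λ_ X).inv := by
  calc
    _ = X ◁ d ⊗≫ twist a k ▷ B ⊗≫ (B ◁ a' ≫ f ▷ X) := by rw [iterTwist]; monoidal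
    _ = X ◁ d ⊗≫ (twist a k ≫ f ▷ X) ▷ B ⊗≫ a' ⊗≫ 𝟙 _ := by rw [whisker_exchange]; monoidal
    _ = X ◁ (d ≫ f ▷ B) ⊗≫ a' ⊗≫ 𝟙 _ := by
      rw [twist_counit_whiskerRight ha h.counit_coact]; monoidal
    _ = _ := by rw [h.counit_comul]; monoidal

theorem one_whiskerRight_iterTwist (h : IsCrossedBimon A b k e m f d)
    (hc : IsCoact ε[A] Δ[A] c) (c' : X ⟶ X ⊗ B) :
    e ▷ X ≫ iterTwist b m c c' = (λ_ X).hom ≫ c' := by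
  calc
    _ = (e ▷ X ≫ B ◁ c') ⊗≫ twist b c ▷ B ⊗≫ X ◁ m := by rw [iterTwist]; monoidal
    _ = 𝟙 _ ⊗≫ c' ⊗≫ (e ▷ X ≫ twist b c) ▷ B ⊗≫ X ◁ m := by rw [← whisker_exchange]; monoidal
    _ = 𝟙 _ ⊗≫ c' ⊗≫ X ◁ (e ▷ B ≫ m) := by rw [unit_whiskerRight_twist hc h.one_act]; monoidal
    _ = _ := by rw [h.one_mul]; monoidal

theorem whiskerLeft_smashInl_twist (h : IsCrossedBimon A b k e m f d) (ha : IsAct η[A] μ[A] a)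
    (ha' : IsAct e m a') :
    X ◁ smashInl A e ≫ twist (iterAct a a') (smashComul k d) =
      twist a Δ[A] ≫ smashInl A e ▷ X := by
  rw [twist_smashComul ha, smashInl]
  calc
    _ = 𝟙 _ ⊗≫ ((X ⊗ A) ◁ e ≫ twist a Δ[A] ▷ B) ⊗≫ A ◁ iterTwist a a' k d ⊗≫ 𝟙 _ := by monoidal
    _ = 𝟙 _ ⊗≫ twist a Δ[A] ⊗≫ A ◁ (X ◁ e ≫ iterTwist a a' k d) ⊗≫ 𝟙 _ := by
      rw [whisker_exchange]; monoidal
    _ = _ := by rw [h.whiskerLeft_one_iterTwist ha ha']; monoidal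

theorem twist_whiskerLeft_smashFst (h : IsCrossedBimon A b k e m f d) (hc : IsCoact ε[A] Δ[A] c)
    (hc' : IsCoact f d c') :
    twist (smashMul b m) (iterCoact c c') ≫ X ◁ smashFst A f =
      smashFst A f ▷ X ≫ twist μ[A] c := by
  rw [twist_smashMul hc, smashFst]
  calc
    _ = 𝟙 _ ⊗≫ A ◁ iterTwist b m c c' ⊗≫ (twist μ[A] c ▷ B ≫ (X ⊗ A) ◁ f) ⊗≫ 𝟙 _ := by monoidal
    _ = 𝟙 _ ⊗≫ A ◁ (iterTwist b m c c' ≫ X ◁ f) ⊗≫ twist μ[A] c ⊗≫ 𝟙 _ := by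
      rw [← whisker_exchange]; monoidal
    _ = _ := by rw [h.iterTwist_whiskerLeft_counit hc hc']; monoidal

end IsCrossedBimon

section Factors

variable {C : Type u} [Category.{v} C] [MonoidalCategory C] [BraidedCategory C] {A : C} [HopfObj A]
  {B X : C}

theorem whiskerLeft_smashInr_twist {a : X ⊗ A ⟶ X} (ha : IsAct η[A] μ[A] a) (a' : X ⊗ B ⟶ X)
    (k : B ⟶ B ⊗ A) (d : B ⟶ B ⊗ B) :
    X ◁ smashInr A B ≫ twist (iterAct a a') (smashComul k d) =
      iterTwist a a' k d ≫ smashInr A B ▷ X := by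
  rw [twist_smashComul ha, smashInr]
  calc
    _ = 𝟙 _ ⊗≫ (X ◁ η[A] ≫ twist a Δ[A]) ▷ B ⊗≫ A ◁ iterTwist a a' k d ⊗≫ 𝟙 _ := by monoidal
    _ = 𝟙 _ ⊗≫ (η[A] ▷ (X ⊗ B) ≫ A ◁ iterTwist a a' k d) ⊗≫ 𝟙 _ := by
      rw [whiskerLeft_one_twist_comul ha]; monoidal
    _ = _ := by rw [← whisker_exchange]; monoidal

theorem twist_whiskerLeft_smashSnd {c : X ⟶ X ⊗ A} (hc : IsCoact ε[A] Δ[A] c) (c' : X ⟶ X ⊗ B)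
    (b : B ⊗ A ⟶ B) (m : B ⊗ B ⟶ B) :
    twist (smashMul b m) (iterCoact c c') ≫ X ◁ smashSnd A B =
      smashSnd A B ▷ X ≫ iterTwist b m c c' := by
  rw [twist_smashMul hc, smashSnd]
  calc
    _ = 𝟙 _ ⊗≫ A ◁ iterTwist b m c c' ⊗≫ (twist μ[A] c ≫ X ◁ ε[A]) ▷ B ⊗≫ 𝟙 _ := by monoidal
    _ = 𝟙 _ ⊗≫ (A ◁ iterTwist b m c c' ≫ ε[A] ▷ (X ⊗ B)) ⊗≫ 𝟙 _ := by
      rw [twist_mul_whiskerLeft_counit hc]; monoidal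
    _ = _ := by rw [whisker_exchange]; monoidal

end Factors

namespace IsCrossedBimon

variable {C : Type u} [Category.{v} C] [MonoidalCategory C] [BraidedCategory C] {A : C} [HopfObj A]
  {B : C} {b : B ⊗ A ⟶ B} {k : B ⟶ B ⊗ A} {e : 𝟙_ C ⟶ B} {m : B ⊗ B ⟶ B}
  {f : B ⟶ 𝟙_ C} {d : B ⟶ B ⊗ B}

theorem smashInl_twist_smash (h : IsCrossedBimon A b k e m f d) :
    (A ⊗ B) ◁ smashInl A e ≫ twist (smashMul b m) (smashComul k d) =
      twist (tensorAct μ[A] b) Δ[A] ≫ smashInl A e ▷ (A ⊗ B) :=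
  h.whiskerLeft_smashInl_twist ((isAct_mul A).tensorAct h.crossed.isAct) (h.isAct.whiskerLeft A)

theorem twist_smash_smashFst (h : IsCrossedBimon A b k e m f d) :
    twist (smashMul b m) (smashComul k d) ≫ (A ⊗ B) ◁ smashFst A f =
      smashFst A f ▷ (A ⊗ B) ≫ twist μ[A] (tensorCoact Δ[A] k) :=
  h.twist_whiskerLeft_smashFst ((isCoact_comul A).tensorCoact h.crossed.isCoact)
    (h.isCoact.whiskerLeft A)

theorem twist_smash_smashSnd (h : IsCrossedBimon A b k e m f d) :
    twist (smashMul b m) (smashComul k d) ≫ (A ⊗ B) ◁ smashSnd A B =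
      smashSnd A B ▷ (A ⊗ B) ≫
        iterTwist b m (tensorCoact Δ[A] k) (A ◁ d ≫ (α_ A B B).inv) :=
  twist_whiskerLeft_smashSnd ((isCoact_comul A).tensorCoact h.crossed.isCoact) _ b m

theorem smashInl_twist_smash_smashFst (h : IsCrossedBimon A b k e m f d) :
    (A ⊗ B) ◁ smashInl A e ≫ twist (smashMul b m) (smashComul k d) ≫ (A ⊗ B) ◁ smashFst A f =
      smashFst A f ▷ A ≫ twist μ[A] Δ[A] ≫ smashInl A e ▷ A := by
  rw [reassoc_of% h.smashInl_twist_smash, ← whisker_exchange,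
    ← reassoc_of% whiskerRight_twist (tensorAct_smashFst h.counit_act)]

theorem smashInl_twist_smash_smashSnd (h : IsCrossedBimon A b k e m f d) :
    (A ⊗ B) ◁ smashInl A e ≫ twist (smashMul b m) (smashComul k d) ≫ (A ⊗ B) ◁ smashSnd A B =
      smashSnd A B ▷ A ≫ twist b Δ[A] ≫ smashInl A e ▷ B := by
  rw [reassoc_of% h.smashInl_twist_smash, ← whisker_exchange,
    ← reassoc_of% whiskerRight_twist (tensorAct_smashSnd b)]

theorem smashInr_twist_smash_smashFst (h : IsCrossedBimon A b k e m f d) :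
    (A ⊗ B) ◁ smashInr A B ≫ twist (smashMul b m) (smashComul k d) ≫ (A ⊗ B) ◁ smashFst A f =
      smashFst A f ▷ B ≫ twist μ[A] k ≫ smashInr A B ▷ A := by
  rw [h.twist_smash_smashFst, whisker_exchange_assoc,
    whiskerLeft_twist μ[A] (smashInr_tensorCoact k)]

theorem smashInr_twist_smash_smashSnd (h : IsCrossedBimon A b k e m f d) :
    (A ⊗ B) ◁ smashInr A B ≫ twist (smashMul b m) (smashComul k d) ≫ (A ⊗ B) ◁ smashSnd A B =
      smashSnd A B ▷ B ≫ iterTwist b m k d ≫ smashInr A B ▷ B := by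
  rw [h.twist_smash_smashSnd, whisker_exchange_assoc,
    whiskerLeft_iterTwist b m (smashInr_tensorCoact k) (smashInr_comul d)]

end IsCrossedBimon

/-- The conditions, stated in the underlying category, for `a`, `c` to make `X` a crossed module
over `A` and for `a'`, `c'` to make it a crossed module over the bimonoid `B` in the category of
crossed modules over `A`. -/
structure IsIteratedCrossedModule {C : Type u} [Category.{v} C] [MonoidalCategory C]
    [BraidedCategory C] (A : C) [HopfObj A] {B : C} (b : B ⊗ A ⟶ B) (k : B ⟶ B ⊗ A)
    (e : 𝟙_ C ⟶ B) (m : B ⊗ B ⟶ B) (f : B ⟶ 𝟙_ C) (d : B ⟶ B ⊗ B) {X : C} (a : X ⊗ A ⟶ X)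
    (c : X ⟶ X ⊗ A) (a' : X ⊗ B ⟶ X) (c' : X ⟶ X ⊗ B) : Prop where
  crossed : IsCrossedModule A a c
  isAct : IsAct e m a'
  isCoact : IsCoact f d c'
  act_act : tensorAct a b ≫ a' = a' ▷ A ≫ a
  act_coact : a' ≫ c = tensorCoact c k ≫ a' ▷ A
  coact_act : a ≫ c' = c' ▷ A ≫ tensorAct a b
  coact_coact : c' ≫ tensorCoact c k = c ≫ c' ▷ A
  twist_comp_twist :
    iterTwist a a' k d ≫ iterTwist b m c c' = coactTwistAct c' (iterTwist b m k d) a'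

section Iterated

variable {C : Type u} [Category.{v} C] [MonoidalCategory C] [BraidedCategory C] {A : C} [HopfObj A]
  {B : C} {b : B ⊗ A ⟶ B} {k : B ⟶ B ⊗ A} {e : 𝟙_ C ⟶ B} {m : B ⊗ B ⟶ B}
  {f : B ⟶ 𝟙_ C} {d : B ⟶ B ⊗ B} {X : C} {a : X ⊗ A ⟶ X} {a' : X ⊗ B ⟶ X} {c : X ⟶ X ⊗ A}
  {c' : X ⟶ X ⊗ B}

namespace IsIteratedCrossedModule

theorem isAct_iterAct (h : IsIteratedCrossedModule A b k e m f d a c a' c') :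
    IsAct (smashOne A e) (smashMul b m) (iterAct a a') :=
  h.crossed.isAct.iterAct h.isAct h.act_act

theorem isCoact_iterCoact (h : IsIteratedCrossedModule A b k e m f d a c a' c') :
    IsCoact (smashCounit A f) (smashComul k d) (iterCoact c c') :=
  h.crossed.isCoact.iterCoact h.isCoact h.coact_coact

theorem twist_comp_twist_iter (h : IsIteratedCrossedModule A b k e m f d a c a' c')
    (hB : IsCrossedModule A b k) :
    twist (iterAct a a') (smashComul k d) ≫ twist (smashMul b m) (iterCoact c c') =
      coactTwistAct (iterCoact c c') (twist (smashMul b m) (smashComul k d)) (iterAct a a') :=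
  twist_comp_twist_smash h.crossed.isAct h.crossed.isCoact hB.isAct hB.isCoact
    h.crossed.twist_comp_twist h.coact_act h.act_coact h.twist_comp_twist

end IsIteratedCrossedModule

namespace IsCrossedBimon

theorem twist_comp_twist_of_smash (h : IsCrossedBimon A b k e m f d) (ha : IsAct η[A] μ[A] a)
    (hc : IsCoact ε[A] Δ[A] c) (ha' : IsAct e m a') (hc' : IsCoact f d c')
    (w : twist (iterAct a a') (smashComul k d) ≫ twist (smashMul b m) (iterCoact c c') =
      coactTwistAct (iterCoact c c') (twist (smashMul b m) (smashComul k d)) (iterAct a a')) :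
    twist a Δ[A] ≫ twist μ[A] c = coactTwistAct c (twist μ[A] Δ[A]) a := by
  have hrestrict := whiskerLeft_coactTwistAct_whiskerLeft (iterCoact c c') (iterAct a a')
    h.smashInl_twist_smash_smashFst
  rw [← w, iterCoact_whiskerLeft_smashFst c hc', whiskerLeft_smashInl_iterAct a ha'] at hrestrict
  rw [← hrestrict, Category.assoc, h.twist_whiskerLeft_smashFst hc hc',
    reassoc_of% h.whiskerLeft_smashInl_twist ha ha', ← comp_whiskerRight_assoc,
    smashInl_smashFst h.one_counit, id_whiskerRight, Category.id_comp]

theorem coact_act_of_smash (h : IsCrossedBimon A b k e m f d) (ha : IsAct η[A] μ[A] a)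
    (hc : IsCoact ε[A] Δ[A] c) (ha' : IsAct e m a')
    (w : twist (iterAct a a') (smashComul k d) ≫ twist (smashMul b m) (iterCoact c c') =
      coactTwistAct (iterCoact c c') (twist (smashMul b m) (smashComul k d)) (iterAct a a')) :
    a ≫ c' = c' ▷ A ≫ tensorAct a b := by
  have hrestrict := whiskerLeft_coactTwistAct_whiskerLeft (iterCoact c c') (iterAct a a')
    h.smashInl_twist_smash_smashSnd
  rw [← w, iterCoact_whiskerLeft_smashSnd hc, whiskerLeft_smashInl_iterAct a ha'] at hrestrict
  rw [tensorAct_eq_twist, ← coactTwistAct, ← hrestrict, Category.assoc,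
    twist_whiskerLeft_smashSnd hc, reassoc_of% h.whiskerLeft_smashInl_twist ha ha',
    ← comp_whiskerRight_assoc, smashInl_smashSnd, comp_whiskerRight_assoc,
    h.one_whiskerRight_iterTwist hc, reassoc_of% twist_comul_counit_whiskerRight,
    Iso.inv_hom_id_assoc]

theorem act_coact_of_smash (h : IsCrossedBimon A b k e m f d) (ha : IsAct η[A] μ[A] a)
    (hc : IsCoact ε[A] Δ[A] c) (hc' : IsCoact f d c')
    (w : twist (iterAct a a') (smashComul k d) ≫ twist (smashMul b m) (iterCoact c c') =
      coactTwistAct (iterCoact c c') (twist (smashMul b m) (smashComul k d)) (iterAct a a')) :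
    a' ≫ c = tensorCoact c k ≫ a' ▷ A := by
  have hrestrict := whiskerLeft_coactTwistAct_whiskerLeft (iterCoact c c') (iterAct a a')
    h.smashInr_twist_smash_smashFst
  rw [← w, iterCoact_whiskerLeft_smashFst c hc', whiskerLeft_smashInr_iterAct ha] at hrestrict
  simp only [tensorCoact_eq_twist, Category.assoc]
  rw [← coactTwistAct, ← hrestrict, Category.assoc, h.twist_whiskerLeft_smashFst hc hc',
    reassoc_of% whiskerLeft_smashInr_twist ha, ← comp_whiskerRight_assoc, smashInr_smashFst,
    comp_whiskerRight_assoc, one_whiskerRight_twist_mul,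
    reassoc_of% h.iterTwist_counit_whiskerRight ha, Iso.inv_hom_id_assoc]

theorem iterTwist_comp_iterTwist_of_smash (h : IsCrossedBimon A b k e m f d)
    (ha : IsAct η[A] μ[A] a) (hc : IsCoact ε[A] Δ[A] c)
    (w : twist (iterAct a a') (smashComul k d) ≫ twist (smashMul b m) (iterCoact c c') =
      coactTwistAct (iterCoact c c') (twist (smashMul b m) (smashComul k d)) (iterAct a a')) :
    iterTwist a a' k d ≫ iterTwist b m c c' = coactTwistAct c' (iterTwist b m k d) a' := by
  have hrestrict := whiskerLeft_coactTwistAct_whiskerLeft (iterCoact c c') (iterAct a a')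
    h.smashInr_twist_smash_smashSnd
  rw [← w, iterCoact_whiskerLeft_smashSnd hc, whiskerLeft_smashInr_iterAct ha] at hrestrict
  rw [← hrestrict, Category.assoc, twist_whiskerLeft_smashSnd hc,
    reassoc_of% whiskerLeft_smashInr_twist ha, ← comp_whiskerRight_assoc, smashInr_smashSnd,
    id_whiskerRight, Category.id_comp]

variable {x : X ⊗ (A ⊗ B) ⟶ X} {z : X ⟶ X ⊗ (A ⊗ B)}

theorem iterAct_smashInl_smashInr (h : IsCrossedBimon A b k e m f d)
    (hx : IsAct (smashOne A e) (smashMul b m) x) :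
    iterAct (X ◁ smashInl A e ≫ x) (X ◁ smashInr A B ≫ x) = x := by
  rw [iterAct, ← hx.whiskerLeft_tensorHom_comp, h.smashInl_smashInr_smashMul, whiskerLeft_id,
    Category.id_comp]

theorem iterCoact_smashFst_smashSnd (h : IsCrossedBimon A b k e m f d)
    (hz : IsCoact (smashCounit A f) (smashComul k d) z) :
    iterCoact (z ≫ X ◁ smashFst A f) (z ≫ X ◁ smashSnd A B) = z := by
  rw [iterCoact, ← hz.comp_whiskerLeft_tensorHom, h.smashComul_smashFst_smashSnd, whiskerLeft_id,
    Category.comp_id]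

theorem tensorAct_smashInl_smashInr (h : IsCrossedBimon A b k e m f d)
    (hx : IsAct (smashOne A e) (smashMul b m) x) :
    tensorAct (X ◁ smashInl A e ≫ x) b ≫ X ◁ smashInr A B ≫ x =
      (X ◁ smashInr A B ≫ x) ▷ A ≫ X ◁ smashInl A e ≫ x := by
  have hfactor := h.iterAct_smashInl_smashInr hx
  have hswap := hx.whiskerLeft_tensorHom_comp (smashInr A B) (smashInl A e)
  rw [h.smashInr_smashInl_smashMul, Iso.eq_inv_comp] at hswap
  rw [iterAct] at hfactor
  rw [tensorAct_eq_twist, ← hswap]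
  simp only [Category.assoc] at hfactor ⊢
  rw [hfactor]

theorem tensorCoact_smashFst_smashSnd (h : IsCrossedBimon A b k e m f d)
    (hz : IsCoact (smashCounit A f) (smashComul k d) z) :
    (z ≫ X ◁ smashSnd A B) ≫ tensorCoact (z ≫ X ◁ smashFst A f) k =
      (z ≫ X ◁ smashFst A f) ≫ (z ≫ X ◁ smashSnd A B) ▷ A := by
  have hfactor := h.iterCoact_smashFst_smashSnd hz
  have hswap := hz.comp_whiskerLeft_tensorHom (smashSnd A B) (smashFst A f)
  rw [h.smashComul_smashSnd_smashFst, ← Category.assoc, ← Iso.comp_inv_eq] at hswap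
  rw [iterCoact] at hfactor
  rw [tensorCoact_eq_twist, ← hswap]
  simp only [Category.assoc] at hfactor ⊢
  rw [reassoc_of% hfactor]

theorem isIteratedCrossedModule (h : IsCrossedBimon A b k e m f d)
    (hx : IsAct (smashOne A e) (smashMul b m) x)
    (hz : IsCoact (smashCounit A f) (smashComul k d) z)
    (w : twist x (smashComul k d) ≫ twist (smashMul b m) z =
      coactTwistAct z (twist (smashMul b m) (smashComul k d)) x) :
    IsIteratedCrossedModule A b k e m f d (X ◁ smashInl A e ≫ x) (z ≫ X ◁ smashFst A f)
      (X ◁ smashInr A B ≫ x) (z ≫ X ◁ smashSnd A B) := by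
  have ha := hx.comp (one_smashInl e) h.smashInl_smashInl_smashMul.symm
  have ha' := hx.comp (one_smashInr e) h.smashInr_smashInr_smashMul.symm
  have hc := hz.comp (smashFst_counit f) h.smashComul_smashFst_smashFst.symm
  have hc' := hz.comp (smashSnd_counit f) h.smashComul_smashSnd_smashSnd.symm
  rw [← h.iterAct_smashInl_smashInr hx, ← h.iterCoact_smashFst_smashSnd hz] at w
  exact {
    crossed := isCrossedModule_iff_twist.2 ⟨ha, hc, h.twist_comp_twist_of_smash ha hc ha' hc' w⟩
    isAct := ha'
    isCoact := hc'
    act_act := h.tensorAct_smashInl_smashInr hx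
    act_coact := h.act_coact_of_smash ha hc hc' w
    coact_act := h.coact_act_of_smash ha hc ha' w
    coact_coact := h.tensorCoact_smashFst_smashSnd hz
    twist_comp_twist := h.iterTwist_comp_iterTwist_of_smash ha hc w }

end IsCrossedBimon

end Iterated

section Iterated

variable {C : Type u} [Category.{v} C] [MonoidalCategory C] [BraidedCategory C] {A B : C}
  [HopfObj A]

theorem iterAct_unitAct (f : B ⟶ 𝟙_ C) :
    iterAct (unitAct A) ((λ_ B).hom ≫ f) = (λ_ (A ⊗ B)).hom ≫ smashCounit A f := by
  rw [iterAct, unitAct, smashCounit, MonoidalCategory.tensorHom_def]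
  monoidal

theorem iterCoact_unitCoact (e : 𝟙_ C ⟶ B) :
    iterCoact (unitCoact A) (e ≫ (λ_ B).inv) = smashOne A e ≫ (λ_ (A ⊗ B)).inv := by
  rw [iterCoact, unitCoact, smashOne, MonoidalCategory.tensorHom_def']
  monoidal

variable {X Y : C}

theorem iterAct_tensorAct {y : Y ⊗ A ⟶ Y} (hy : IsAct η[A] μ[A] y) (y' : Y ⊗ B ⟶ Y)
    (a : X ⊗ A ⟶ X) (a' : X ⊗ B ⟶ X) (k : B ⟶ B ⊗ A) (d : B ⟶ B ⊗ B) :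
    iterAct (tensorAct a y)
        ((α_ X Y B).hom ≫ X ◁ iterTwist y y' k d ≫ (α_ X B Y).inv ≫ a' ▷ Y) =
      (α_ X Y (A ⊗ B)).hom ≫ X ◁ twist (iterAct y y') (smashComul k d) ≫
        (α_ X (A ⊗ B) Y).inv ≫ iterAct a a' ▷ Y := by
  rw [twist_smashComul hy, iterAct, iterAct, tensorAct_eq_twist]
  calc
    _ = 𝟙 _ ⊗≫ X ◁ twist y Δ[A] ▷ B ⊗≫ (a ▷ (Y ⊗ B) ≫ X ◁ iterTwist y y' k d) ⊗≫
        a' ▷ Y := by monoidal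
    _ = _ := by rw [← whisker_exchange]; monoidal

theorem iterCoact_tensorCoact {y : Y ⟶ Y ⊗ A} (hy : IsCoact ε[A] Δ[A] y) (y' : Y ⟶ Y ⊗ B)
    (c : X ⟶ X ⊗ A) (c' : X ⟶ X ⊗ B) (b : B ⊗ A ⟶ B) (m : B ⊗ B ⟶ B) :
    iterCoact (tensorCoact c y)
        (c' ▷ Y ≫ (α_ X B Y).hom ≫ X ◁ iterTwist b m y y' ≫ (α_ X Y B).inv) =
      iterCoact c c' ▷ Y ≫ (α_ X (A ⊗ B) Y).hom ≫
        X ◁ twist (smashMul b m) (iterCoact y y') ≫ (α_ X Y (A ⊗ B)).inv := by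
  rw [twist_smashMul hy, iterCoact, iterCoact, tensorCoact_eq_twist]
  calc
    _ = c' ▷ Y ⊗≫ (X ◁ iterTwist b m y y' ≫ c ▷ (Y ⊗ B)) ⊗≫ X ◁ twist μ[A] y ▷ B ⊗≫ 𝟙 _ := by
      monoidal
    _ = _ := by rw [whisker_exchange]; monoidal

end Iterated

section CrossedModules

variable {C : Type u} [Category.{v} C] [MonoidalCategory C] [BraidedCategory C] {H : C} [HopfObj H]

theorem CrossedModule.mk_eq {M : CrossedModule H} {a : M.X ⊗ H ⟶ M.X} {c : M.X ⟶ M.X ⊗ H}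
    {h : IsCrossedModule H a c} (ha : a = M.act) (hc : c = M.coact) :
    CrossedModule.mk M.X a c h = M := by
  subst ha hc
  rfl

theorem CrossedModule.hom_hext {M M' N N' : CrossedModule H} (hM : M = M') (hN : N = N')
    {g : M ⟶ N} {g' : M' ⟶ N'} (h : g.hom ≍ g'.hom) : g ≍ g' := by
  subst hM hN
  exact heq_of_eq (CrossedModule.hom_ext (eq_of_heq h))

/-- The isomorphism with underlying morphism the identity between crossed modules with the same
underlying object and equal structure morphisms. -/
def CrossedModule.isoOfEq {X : C} {a a' : X ⊗ H ⟶ X} {c c' : X ⟶ X ⊗ H}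
    {h : IsCrossedModule H a c} {h' : IsCrossedModule H a' c'} (ha : a = a') (hc : c = c') :
    CrossedModule.mk X a c h ≅ CrossedModule.mk X a' c' h' :=
  CrossedModule.mkIso (Iso.refl X) (by simp [ha]) (by simp [hc])

theorem CrossedModule.whiskerLeft_act_hom {P : C} {M N : CrossedModule H} (g : M ⟶ N)
    (x : P ⟶ H) : (M.X ◁ x ≫ M.act) ≫ g.hom = g.hom ▷ P ≫ N.X ◁ x ≫ N.act := by
  rw [Category.assoc, g.act_hom, whisker_exchange_assoc]

theorem CrossedModule.hom_coact_whiskerLeft {P : C} {M N : CrossedModule H} (g : M ⟶ N)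
    (x : H ⟶ P) : g.hom ≫ N.coact ≫ N.X ◁ x = (M.coact ≫ M.X ◁ x) ≫ g.hom ▷ P := by
  rw [reassoc_of% g.hom_coact, ← whisker_exchange, Category.assoc]

end CrossedModules

section CrossProduct

variable {C : Type u} [Category.{v} C] [MonoidalCategory C] [BraidedCategory C]
  (A : C) [HopfObj A] [IsIso 𝒮[A]] (B : CrossedModule A) [HopfObj B]

theorem isCrossedBimon : IsCrossedBimon A B.act B.coact (uOne A B) (uMul A B) (uCounit A B)
    (uComul A B) where
  crossed := B.isCrossedModule
  one_mul := congrArg CrossedModule.Hom.hom (MonObj.one_mul B)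
  isAct := ⟨congrArg CrossedModule.Hom.hom (isAct_mul B).one,
    congrArg CrossedModule.Hom.hom (isAct_mul B).mul⟩
  counit_comul := congrArg CrossedModule.Hom.hom (ComonObj.counit_comul B)
  isCoact := ⟨congrArg CrossedModule.Hom.hom (isCoact_comul B).counit,
    congrArg CrossedModule.Hom.hom (isCoact_comul B).comul⟩
  one_act := η[B].act_hom
  one_coact := η[B].hom_coact
  mul_act := μ[B].act_hom
  mul_coact := μ[B].hom_coact
  counit_act := ε[B].act_hom
  counit_coact := ε[B].hom_coact
  comul_act := Δ[B].act_hom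
  comul_coact := Δ[B].hom_coact
  mul_comul := congrArg CrossedModule.Hom.hom (mul_comul_eq_coactTwistAct B)
  one_comul := congrArg CrossedModule.Hom.hom (Bimon.one_comul B)
  mul_counit := congrArg CrossedModule.Hom.hom (Bimon.mul_counit B)
  one_counit := congrArg CrossedModule.Hom.hom (BimonObj.one_counit (M := B))

/-- The cross product of `A` and `B` as a Hopf monoid. -/
@[reducible]
def crossHopfObj : HopfObj (A ⊗ B.X) :=
  (isCrossedBimon A B).hopfObj (s := uAntipode A B)
    (congrArg CrossedModule.Hom.hom (HopfObj.antipode_left B))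
    (congrArg CrossedModule.Hom.hom (HopfObj.antipode_right B))

theorem smashMul_eq_crossMul : smashMul B.act (uMul A B) = crossMul A B := by
  rw [smashMul, iterAct, tensorAct_eq_twist, twist, crossMul, MonoidalCategory.tensorHom_def]
  monoidal

theorem smashComul_eq_crossComul : smashComul B.coact (uComul A B) = crossComul A B := by
  rw [smashComul, iterCoact, tensorCoact_eq_twist, twist, crossComul,
    MonoidalCategory.tensorHom_def']
  monoidal

theorem smashAntipode_eq_crossAntipode :
    smashAntipode B.act B.coact (uAntipode A B) = crossAntipode A B := by
  rw [smashAntipode, twist, twist, crossAntipode]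
  monoidal

attribute [local instance] crossHopfObj

theorem isIso_crossHopfObj_antipode [IsIso 𝒮[B]] : IsIso 𝒮[A ⊗ B.X] :=
  have : IsIso (uAntipode A B) := inferInstanceAs (IsIso ((CrossedModule.forget A).map 𝒮[B]))
  (isCrossedBimon A B).isIso_smashAntipode (uAntipode A B)

variable {A B}

theorem isIteratedCrossedModule (X : CrossedModule B) :
    IsIteratedCrossedModule A B.act B.coact (uOne A B) (uMul A B) (uCounit A B) (uComul A B)
      X.X.act X.X.coact (uAct X) (uCoact X) where
  crossed := X.X.isCrossedModule
  isAct := ⟨congrArg CrossedModule.Hom.hom X.isCrossedModule.act_one,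
    congrArg CrossedModule.Hom.hom X.isCrossedModule.act_mul⟩
  isCoact := ⟨congrArg CrossedModule.Hom.hom X.isCrossedModule.coact_counit,
    congrArg CrossedModule.Hom.hom X.isCrossedModule.coact_comul⟩
  act_act := X.act.act_hom
  act_coact := X.act.hom_coact
  coact_act := X.coact.act_hom
  coact_coact := X.coact.hom_coact
  twist_comp_twist := congrArg CrossedModule.Hom.hom X.isCrossedModule.twist_comp_twist

theorem isCrossedModule_crossAct_crossCoact (X : CrossedModule B) :
    IsCrossedModule (A ⊗ B.X) (crossAct X) (crossCoact X) :=
  have hX := isIteratedCrossedModule X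
  isCrossedModule_iff_twist.2
    ⟨hX.isAct_iterAct, hX.isCoact_iterCoact, hX.twist_comp_twist_iter B.isCrossedModule⟩

/-- The crossed module over `B` in the category of crossed modules over `A` given by structure
morphisms in `C`. -/
def IsIteratedCrossedModule.crossedModule {X : C} {a : X ⊗ A ⟶ X} {c : X ⟶ X ⊗ A}
    {a' : X ⊗ B.X ⟶ X} {c' : X ⟶ X ⊗ B.X}
    (h : IsIteratedCrossedModule A B.act B.coact (uOne A B) (uMul A B) (uCounit A B) (uComul A B)
      a c a' c') : CrossedModule B where
  X := ⟨X, a, c, h.crossed⟩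
  act := ⟨a', h.act_act, h.act_coact⟩
  coact := ⟨c', h.coact_act, h.coact_coact⟩
  isCrossedModule := isCrossedModule_iff_twist.2
    ⟨⟨CrossedModule.hom_ext h.isAct.one, CrossedModule.hom_ext h.isAct.mul⟩,
      ⟨CrossedModule.hom_ext h.isCoact.counit, CrossedModule.hom_ext h.isCoact.comul⟩,
      CrossedModule.hom_ext h.twist_comp_twist⟩

theorem IsIteratedCrossedModule.crossedModule_eq {Y : CrossedModule B} {a c a' c'}
    {h : IsIteratedCrossedModule A B.act B.coact (uOne A B) (uMul A B) (uCounit A B) (uComul A B)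
      a c a' c'}
    (ha : a = Y.X.act) (hc : c = Y.X.coact) (ha' : a' = uAct Y) (hc' : c' = uCoact Y) :
    h.crossedModule = Y := by
  subst ha hc ha' hc'
  rfl

/-- The crossed module over `B` underlying a crossed module over the cross product, obtained by
restriction along the inclusions of the two factors and corestriction along the projections. -/
def crossRestrict (Y : CrossedModule (A ⊗ B.X)) : CrossedModule B :=
  ((isCrossedBimon A B).isIteratedCrossedModule Y.isCrossedModule.isAct
    Y.isCrossedModule.isCoact Y.isCrossedModule.twist_comp_twist).crossedModule

variable (A B) in
/-- The inverse of `crossFunctor`. -/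
def crossInverse : CrossedModule (A ⊗ B.X) ⥤ CrossedModule B where
  obj Y := crossRestrict Y
  map g :=
    ⟨⟨g.hom, CrossedModule.whiskerLeft_act_hom g _, CrossedModule.hom_coact_whiskerLeft g _⟩,
      CrossedModule.hom_ext (CrossedModule.whiskerLeft_act_hom g _),
      CrossedModule.hom_ext (CrossedModule.hom_coact_whiskerLeft g _)⟩

theorem crossFunctor_crossInverse :
    crossFunctor (isCrossedModule_crossAct_crossCoact (A := A) (B := B)) ⋙ crossInverse A B =
      𝟭 _ := by
  have hobj (X : CrossedModule B) :
      crossRestrict ((crossFunctor isCrossedModule_crossAct_crossCoact).obj X) = X :=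
    have hX := isIteratedCrossedModule X
    IsIteratedCrossedModule.crossedModule_eq (Y := X)
      (whiskerLeft_smashInl_iterAct _ hX.isAct)
      (iterCoact_whiskerLeft_smashFst _ hX.isCoact)
      (whiskerLeft_smashInr_iterAct hX.crossed.isAct _)
      (iterCoact_whiskerLeft_smashSnd hX.crossed.isCoact _)
  exact CategoryTheory.Functor.hext hobj fun X Y _ =>
    CrossedModule.hom_hext (hobj X) (hobj Y) <|
      CrossedModule.hom_hext (congrArg _ (hobj X)) (congrArg _ (hobj Y)) .rfl

theorem crossInverse_crossFunctor :
    crossInverse A B ⋙ crossFunctor (isCrossedModule_crossAct_crossCoact (A := A) (B := B)) =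
      𝟭 _ := by
  have hobj (Y : CrossedModule (A ⊗ B.X)) :
      (crossFunctor isCrossedModule_crossAct_crossCoact).obj (crossRestrict Y) = Y :=
    CrossedModule.mk_eq
      ((isCrossedBimon A B).iterAct_smashInl_smashInr Y.isCrossedModule.isAct)
      ((isCrossedBimon A B).iterCoact_smashFst_smashSnd Y.isCrossedModule.isCoact)
  exact CategoryTheory.Functor.hext hobj fun X Y _ =>
    CrossedModule.hom_hext (hobj X) (hobj Y) .rfl

theorem unitAct_eq_crossAct : unitAct (A ⊗ B.X) = crossAct (𝟙_ (CrossedModule B)) :=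
  (iterAct_unitAct (A := A) (uCounit A B)).symm

theorem unitCoact_eq_crossCoact : unitCoact (A ⊗ B.X) = crossCoact (𝟙_ (CrossedModule B)) :=
  (iterCoact_unitCoact (A := A) (uOne A B)).symm

theorem tensorAct_crossAct (X Y : CrossedModule B) :
    tensorAct (crossAct X) (crossAct Y) = crossAct (X ⊗ Y) := by
  have htensor : uAct (X ⊗ Y) = (α_ X.X.X Y.X.X B.X).hom ≫
      X.X.X ◁ iterTwist Y.X.act (uAct Y) B.coact (uComul A B) ≫
        (α_ X.X.X B.X Y.X.X).inv ≫ uAct X ▷ Y.X.X :=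
    congrArg CrossedModule.Hom.hom (tensorAct_eq_twist X.act Y.act)
  exact (tensorAct_eq_twist (crossAct X) (crossAct Y)).trans
    ((iterAct_tensorAct Y.X.isCrossedModule.isAct _ _ _ _ _).symm.trans
      (congrArg (iterAct (tensorAct X.X.act Y.X.act)) htensor.symm))

theorem tensorCoact_crossCoact (X Y : CrossedModule B) :
    tensorCoact (crossCoact X) (crossCoact Y) = crossCoact (X ⊗ Y) := by
  have htensor : uCoact (X ⊗ Y) = uCoact X ▷ Y.X.X ≫ (α_ X.X.X B.X Y.X.X).hom ≫
      X.X.X ◁ iterTwist B.act (uMul A B) Y.X.coact (uCoact Y) ≫ (α_ X.X.X Y.X.X B.X).inv :=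
    congrArg CrossedModule.Hom.hom (tensorCoact_eq_twist X.coact Y.coact)
  exact (tensorCoact_eq_twist (crossCoact X) (crossCoact Y)).trans
    ((iterCoact_tensorCoact Y.X.isCrossedModule.isCoact _ _ _ _ _).symm.trans
      (congrArg (iterCoact (tensorCoact X.X.coact Y.X.coact)) htensor.symm))

variable (A B) in
/-- The strict monoidal structure of `crossFunctor`. -/
noncomputable def crossFunctorCoreMonoidal :
    (crossFunctor (isCrossedModule_crossAct_crossCoact (A := A) (B := B))).CoreMonoidal where
  εIso := CrossedModule.isoOfEq unitAct_eq_crossAct unitCoact_eq_crossCoact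
  μIso X Y := CrossedModule.isoOfEq (tensorAct_crossAct X Y) (tensorCoact_crossCoact X Y)
  μIso_hom_natural_left f Z :=
    CrossedModule.hom_ext ((Category.comp_id _).trans (Category.id_comp _).symm)
  μIso_hom_natural_right Z f :=
    CrossedModule.hom_ext ((Category.comp_id _).trans (Category.id_comp _).symm)
  associativity X Y Z := CrossedModule.hom_ext (by
    change 𝟙 (X.X.X ⊗ Y.X.X) ▷ Z.X.X ≫ 𝟙 ((X.X.X ⊗ Y.X.X) ⊗ Z.X.X) ≫ (α_ X.X.X Y.X.X Z.X.X).hom =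
      (α_ X.X.X Y.X.X Z.X.X).hom ≫ X.X.X ◁ 𝟙 (Y.X.X ⊗ Z.X.X) ≫ 𝟙 (X.X.X ⊗ Y.X.X ⊗ Z.X.X)
    simp)
  left_unitality X := CrossedModule.hom_ext (by
    change (λ_ X.X.X).hom = 𝟙 (𝟙_ C) ▷ X.X.X ≫ 𝟙 (𝟙_ C ⊗ X.X.X) ≫ (λ_ X.X.X).hom
    simp)
  right_unitality X := CrossedModule.hom_ext (by
    change (ρ_ X.X.X).hom = X.X.X ◁ 𝟙 (𝟙_ C) ≫ 𝟙 (X.X.X ⊗ 𝟙_ C) ≫ (ρ_ X.X.X).hom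
    simp)

variable (A B) in
/-- The strict braided structure of `crossFunctor`. -/
@[reducible]
noncomputable def crossFunctorBraided [IsIso 𝒮[B]] [IsIso 𝒮[A ⊗ B.X]] :
    (crossFunctor (isCrossedModule_crossAct_crossCoact (A := A) (B := B))).Braided where
  __ := (crossFunctorCoreMonoidal A B).toMonoidal
  braided X Y := CrossedModule.hom_ext ((Category.id_comp _).trans
    ((twist_iterAct_iterCoact X.X.act (uAct X) Y.X.coact (uCoact Y)).symm.trans
      (Category.comp_id _).symm))

end CrossProduct

end Braided

theorem mainTheorem7 {C : Type u} [Category.{v} C] [MonoidalCategory C] [BraidedCategory C]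
    (A : C) [HopfObj A] [IsIso 𝒮[A]]
    (B : Braided.CrossedModule A) [HopfObj B] [IsIso 𝒮[B]] :
    ∃ (_ : HopfObj (A ⊗ B.X)) (_ : IsIso 𝒮[A ⊗ B.X]),
      (η[A ⊗ B.X] = Braided.crossOne A B ∧
        μ[A ⊗ B.X] = Braided.crossMul A B ∧
        ε[A ⊗ B.X] = Braided.crossCounit A B ∧
        Δ[A ⊗ B.X] = Braided.crossComul A B ∧
        𝒮[A ⊗ B.X] = Braided.crossAntipode A B) ∧
      ∃ (h : ∀ X : Braided.CrossedModule B, Braided.IsCrossedModule (A ⊗ B.X)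
          (Braided.crossAct X) (Braided.crossCoact X))
        (_ : (Braided.crossFunctor h).Braided),
        (∃ G : Braided.CrossedModule (A ⊗ B.X) ⥤ Braided.CrossedModule B,
          Braided.crossFunctor h ⋙ G = 𝟭 _ ∧ G ⋙ Braided.crossFunctor h = 𝟭 _) ∧
        (Functor.LaxMonoidal.ε (Braided.crossFunctor h)).hom = 𝟙 (𝟙_ C) ∧
        ∀ X Y : Braided.CrossedModule B,
          (Functor.LaxMonoidal.μ (Braided.crossFunctor h) X Y).hom = 𝟙 (X.X.X ⊗ Y.X.X) := by
  let _ := Braided.crossHopfObj A B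
  have hS : IsIso 𝒮[A ⊗ B.X] := Braided.isIso_crossHopfObj_antipode A B
  exact ⟨Braided.crossHopfObj A B, hS,
    ⟨rfl, Braided.smashMul_eq_crossMul A B, rfl, Braided.smashComul_eq_crossComul A B,
      Braided.smashAntipode_eq_crossAntipode A B⟩,
    Braided.isCrossedModule_crossAct_crossCoact, Braided.crossFunctorBraided A B,
    ⟨Braided.crossInverse A B, Braided.crossFunctor_crossInverse,
      Braided.crossInverse_crossFunctor⟩,
    rfl, fun _ _ => rfl⟩
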